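/- **Setting.** There are $K$ data sources. Source $k\in[K]$ produces $X^k_1,X^k_2,\dots$. For $s\subseteq[K]$ let $\mathcal F^s_n$ be the $\sigma$-field generated by the observations of the sources in $s$ up to time $n$, and $\mathcal F_n=\mathcal F_n^{[K]}$. Let $\mathcal P$ be a finite family of distributions of $X=(X^k_n)$; write $\mathsf P^s$ for the marginal of $\mathsf P$ on the sources in $s$. For each $k$, let $\mathcal H^k,\mathcal G^k$ be disjoint non-empty subfamilies of $\{\mathsf P^k:\mathsf P\in\mathcal P\}$, and let $\mathcal A(\mathsf P)=\{k:\mathsf P^k\in\mathcal G^k\}$ be the set of signals. Fix $1\le u\le K$, let $\Psi=\{A\subseteq[K]:0\le|A|\le u\}$, and let $\mathcal P_\Psi$ be the set of $\mathsf P\in\mathcal P$ with $\mathsf P^k\in\mathcal H^k\cup\mathcal G^k$ for all $k$ and $\mathcal A(\mathsf P)\in\Psi$. Put $\mathcal H_0=\{\mathsf P\in\mathcal P_\Psi:\mathcal A(\mathsf P)=\emptyset\}$, $\mathcal H_{\Psi,k}=\{\mathsf P\in\mathcal P_\Psi\setminus\mathcal H_0:k\notin\mathcal A(\mathsf P)\}$,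 $\mathcal G_{\Psi,k}=\{\mathsf P\in\mathcal P_\Psi:k\in\mathcal A(\mathsf P)\}$. **Assumptions.** 1. Every $\mathsf P\in\mathcal P_\Psi$ is the product $\mathsf P^1\otimes\dots\otimes\mathsf P^K$ (independent sources), and every product $\nu^1\otimes\dots\otimes\nu^K$ with $\nu^k\in\mathcal H^k\cup\mathcal G^k$ for all $k$ and $|\{k:\nu^k\in\mathcal G^k\}|\le u$ belongs to $\mathcal P$. 2. For all $k$, $\mathsf P\in\mathcal G_{\Psi,k}\cup\mathcal H_0$, $\mathsf Q\in\mathcal H_{\Psi,k}\cup\mathcal H_0$, $s\ni k$ and $n\ge1$, $\mathsf P^s$ and $\mathsf Q^s$ are mutually absolutely continuous on $\mathcal F^s_n$. Let $\Lambda_n(\mathsf P^s,\mathsf Q^s)=\frac{d\mathsf P^s}{d\mathsf Q^s}(\mathcal F_n^s)$ and $Z_n=\log\Lambda_n$. 3. For all $k$, $\mathsf P\in\mathcal G_{\Psi,k}$, $\mathsf Q\in\mathcal H_{\Psi,k}\cup\mathcal H_0$ and $s\ni k$ there are positive numbers $\mathcal I(\mathsf P^s,\mathsf Q^s)$ and $\mathcal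 I(\mathsf Q^s,\mathsf P^s)$ such that $\mathsf P(\max_{1\le m\le n}Z_m(\mathsf P^s,\mathsf Q^s)\ge n\rho)\to0$ for all $\rho>\mathcal I(\mathsf P^s,\mathsf Q^s)$ and $\sum_n\mathsf P(Z_n(\mathsf P^s,\mathsf Q^s)<n\rho)<\infty$ for all $\rho<\mathcal I(\mathsf P^s,\mathsf Q^s)$, and the same holds with $\mathsf P$ and $\mathsf Q$ interchanged. **Statistics.** For subsystems $s_k,s'_k\ni k$ and arbitrary reference distributions $\mathsf P_0,\mathsf P_0'$ in $\mathcal H_0$ (or with $\mathsf P_0^k\in\mathcal H^k$ for $\Lambda_k$), let $$\Lambda_{k,\rm det}(n)=\frac{\max_{\mathsf P\in\mathcal G_{\Psi,k}}\Lambda_n(\mathsf P^{s_k},\mathsf P_0^{s_k})}{\max_{\mathsf P\in\mathcal H_0}\Lambda_n(\mathsf P^{s_k},\mathsf P_0^{s_k})},\quad \Lambda_{k,\rm iso}(n)=\frac{\max_{\mathsf P\in\mathcal G_{\Psi,k}}\Lambda_n(\mathsf P^{s'_k},\mathsf P_0'^{s'_k})}{\max_{\mathsf P\in\mathcal H_{\Psi,k}}\Lambda_n(\mathsf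 P^{s'_k},\mathsf P_0'^{s'_k})},\quad \Lambda_k(n)=\frac{\max_{\nu\in\mathcal G^k}\Lambda_n(\nu,\mathsf P_0^k)}{\max_{\nu\in\mathcal H^k}\Lambda_n(\nu,\mathsf P_0^k)}$$ (a maximum over the empty set is $0$ and a ratio $x/0$ with $x>0$ is $\infty$; this occurs only for $K=1$). Let $\Lambda_{(1)}(n)\ge\dots\ge\Lambda_{(K)}(n)$ be the ordered local statistics, $p(n)=|\{k:\Lambda_k(n)>1\}|$ and $D_{\rm iso}(n)=\{k:\Lambda_{k,\rm iso}(n)>1\}$. **Test.** A test is a pair $(T,D)$ of an $(\mathcal F_n)$-stopping time $T\in\{1,2,\dots\}\cup\{\infty\}$ and an $\mathcal F_T$-measurable, $\Psi$-valued $D$. For $\gamma,\delta\in(0,1)$, $\mathcal E_\Psi(\gamma,\delta)$ is the class of tests with $\mathsf P(D\setminus\mathcal A(\mathsf P)\ne\emptyset)\le\gamma$ and $\mathsf P(\mathcal A(\mathsf P)\setminus D\ne\emptyset)\le\delta$ for all $\mathsf P\in\mathcal P_\Psi$. For thresholds $A,B>1$, with all infima over $n\ge1$, let $\chi^*_{fwer}=(T^*_{fwer},D^*_{fwer})$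 with $T^*_{fwer}=\min\{T_0,T_{joint}\}$, $$T_0=\inf\{n:\Lambda_{k,\rm det}(n)\le 1/A\ \forall k\},$$ $$T_{joint}=\inf\{n:\ \Lambda_{k,\rm det}(n)\ge B\text{ for some }k,\ \Lambda_{k,\rm iso}(n)\notin(1/A,B)\ \forall k,\ D_{\rm iso}(n)\in\Psi\setminus\{\emptyset\}\},$$ $D^*_{fwer}=D_{\rm iso}(T^*_{fwer})$ if $T_{joint}<T_0$, and $D^*_{fwer}=\emptyset$ otherwise. The thresholds are *admissibly selected* if $A=A(\gamma,\delta)>1$ and $B=B(\gamma,\delta)>1$ are such that $\chi^*_{fwer}\in\mathcal E_\Psi(\gamma,\delta)$ for all $\gamma,\delta\in(0,1)$ and $\log A\sim|\log\delta|$, $\log B\sim|\log\gamma|$ as $\gamma,\delta\to0$. The test $\chi^*_{fwer}$ is *asymptotically optimal* if, for every admissible selection of the thresholds and every $\mathsf P\in\mathcal P_\Psi$, $$\mathsf E_{\mathsf P}[T^*_{fwer}]\sim\inf\{\mathsf E_{\mathsf P}[T]:(T,D)\in\mathcal E_\Psi(\gamma,\delta)\}\quad\text{as }\gamma,\delta\to0.$$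 **Theorem.** Let $s_k=\{k\}$ for every $k\in[K]$. (i) If $u=K$ and $s'_k=\{k\}$ for every $k$, then $\chi^*_{fwer}$ is asymptotically optimal. Moreover, for all $A,B>1$, almost surely under every $\mathsf P\in\mathcal P_\Psi$, it is the intersection rule: $$T^*_{fwer}=\inf\{n:\Lambda_k(n)\notin(1/A,B)\ \ \forall k\in[K]\},\qquad D^*_{fwer}=\{k:\Lambda_k(T^*_{fwer})>1\}\ \text{ on }\{T^*_{fwer}<\infty\}.$$ (ii) If $u<K$ and $s'_k=[K]$ for every $k$, then $\chi^*_{fwer}$ is asymptotically optimal. Moreover, for all $A,B>1$, almost surely under every $\mathsf P\in\mathcal P_\Psi$, $T^*_{fwer}=T_0\wedge T_1\wedge T_2\wedge T_3\wedge T_4$, where \begin{align*} T_0&=\inf\{n:\Lambda_{(1)}(n)\le1/A\},\\ T_1&=\inf\{n:\Lambda_{(1)}(n)\ge B,\ \Lambda_{(2)}(n)\le\min\{1/A,\Lambda_{(1)}(n)/B\}\},\\ T_2&=\inf\{n:1<p(n)<u,\ \Lambda_{(1)}(n)\ge B,\ \Lambda_k(n)\notin(1/A,B)\ \forall k\in[K]\},\\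 T_3&=\inf\{n:p(n)=u,\ \Lambda_{(u)}(n)\ge\max\{B,A\,\Lambda_{(u+1)}(n)\}\},\\ T_4&=\inf\{n:p(n)>u,\ \Lambda_{(1)}(n)\ge B,\ \Lambda_{(u)}(n)\ge\Lambda_{(u+1)}(n)\max\{A,B\}\}. \end{align*} -/

import Mathlib

open MeasureTheory Filter Topology Asymptotics
open scoped ENNReal

noncomputable section

namespace SeqTest

/-- Complete observation sequences of `K` sources: source `k` takes values in `E k`, and
`ω k m` is the observation of source `k` at time `m + 1` (times are `1, 2, 3, …`). -/
abbrev Paths {K : ℕ} (E : Fin K → Type*) : Type _ := (k : Fin K) → ℕ → E k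

section Observations

variable {K : ℕ} {E : Fin K → Type*}

/-- The observations of the sources in `s` at the times `1, …, n`. -/
def obs (s : Finset (Fin K)) (n : ℕ) (ω : Paths E) : (k : s) → Fin n → E k :=
  fun k m => ω k m

variable [∀ k, MeasurableSpace (E k)]

theorem measurable_obs (s : Finset (Fin K)) (n : ℕ) :
    Measurable (obs s n : Paths E → (k : s) → Fin n → E k) := by
  unfold obs
  fun_prop

/-- The filtration `(ℱ_n^s)`: the `σ`-field generated by the observations of the sources in `s`
up to time `n`. -/
def filt (s : Finset (Fin K)) :
    Filtration ℕ (inferInstance : MeasurableSpace (Paths E)) where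
  seq n := MeasurableSpace.comap (obs s n) inferInstance
  mono' := by
    intro n m hnm
    have h : (obs s n : Paths E → (k : s) → Fin n → E k) =
        (fun x k i => x k (Fin.castLE hnm i)) ∘ obs s m := rfl
    change MeasurableSpace.comap (obs s n) inferInstance ≤
      MeasurableSpace.comap (obs s m) inferInstance
    rw [h, ← MeasurableSpace.comap_comp]
    apply MeasurableSpace.comap_mono
    rw [← measurable_iff_comap_le]
    fun_prop
  le' n := (measurable_obs s n).comap_le

/-- The marginal distribution `P^k` of the observations of source `k`. -/
def marg (k : Fin K) (P : Measure (Paths E)) : Measure (ℕ → E k) :=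
  P.map (fun ω => ω k)

/-- The restriction of `P^s` to `ℱ_n^s`. -/
def restr (s : Finset (Fin K)) (n : ℕ) (P : Measure (Paths E)) :
    @Measure (Paths E) (filt s n) :=
  P.trim ((filt s).le n)

/-- The likelihood ratio `Λ_n(P^s, Q^s)`: the Radon-Nikodym derivative of `P^s` with respect to
`Q^s` on `ℱ_n^s`. -/
def LR (s : Finset (Fin K)) (n : ℕ) (P Q : Measure (Paths E)) : Paths E → ℝ≥0∞ :=
  (restr s n P).rnDeriv (restr s n Q)

/-- The log-likelihood ratio `Z_n(P^s, Q^s)`. -/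
def Z (s : Finset (Fin K)) (n : ℕ) (P Q : Measure (Paths E)) (ω : Paths E) : ℝ :=
  Real.log (LR s n P Q ω).toReal

/-- The positive number `I` is an information number `ℐ(P^s, Q^s)`: the running maximum of
`Z_n(P^s, Q^s)` exceeds `n ρ` with vanishing `P`-probability if `ρ > I`, and the `P`-probabilities
that `Z_n(P^s, Q^s) < n ρ` are summable if `ρ < I`. -/
def HasInfo (s : Finset (Fin K)) (P Q : Measure (Paths E)) (I : ℝ) : Prop :=
  0 < I ∧
  (∀ ρ : ℝ, I < ρ → Tendsto
    (fun n : ℕ => P {ω | ∃ m ∈ Finset.Icc 1 n, (n : ℝ) * ρ ≤ Z s m P Q ω}) atTop (𝓝 0)) ∧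
  (∀ ρ : ℝ, ρ < I → ∑' n : ℕ, P {ω | Z s n P Q ω < (n : ℝ) * ρ} < ∞)

end Observations

/-- `inf {n ≥ 1 : ω ∈ S n}`, with value `⊤` if there is no such `n`. -/
def firstTime {Ω : Type*} (S : ℕ → Set Ω) (ω : Ω) : ℕ∞ :=
  ⨅ (n : ℕ) (_ : 1 ≤ n ∧ ω ∈ S n), (n : ℕ∞)

/-- The `j`-th largest of the values `x 0, …, x (K - 1)`, for `1 ≤ j ≤ K`, written as the largest
possible minimum over `j` of them; see `ordStat_eq_of_antitone`. -/
def ordStat {K : ℕ} (j : ℕ) (x : Fin K → ℝ≥0∞) : ℝ≥0∞ :=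
  ⨆ (S : Finset (Fin K)) (_ : S.card = j), ⨅ k ∈ S, x k

/-- If `σ` lists the indices so that the values are in decreasing order, then `ordStat (j + 1)` is
the value in the (zero-based) position `j`. -/
theorem ordStat_eq_of_antitone {K : ℕ} (x : Fin K → ℝ≥0∞) (σ : Equiv.Perm (Fin K))
    (hσ : Antitone (fun i => x (σ i))) (j : Fin K) :
    ordStat ((j : ℕ) + 1) x = x (σ j) := by
  apply le_antisymm
  · refine iSup₂_le fun S hS => ?_
    have hex : ∃ k ∈ S, j ≤ σ.symm k := by
      by_contra hcon
      push Not at hcon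
      have hsub : S.map σ.symm.toEmbedding ⊆ Finset.Iio j := by
        intro i hi
        rw [Finset.mem_map] at hi
        obtain ⟨k, hk, rfl⟩ := hi
        exact Finset.mem_Iio.2 (hcon k hk)
      have := Finset.card_le_card hsub
      rw [Finset.card_map, hS, Fin.card_Iio] at this
      omega
    obtain ⟨k, hk, hjk⟩ := hex
    refine (iInf₂_le k hk).trans ?_
    simpa using hσ hjk
  · refine le_iSup₂_of_le ((Finset.Iic j).map σ.toEmbedding) (by simp) ?_
    refine le_iInf₂ fun k hk => ?_
    rw [Finset.mem_map] at hk
    obtain ⟨i, hi, rfl⟩ := hk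
    exact hσ (Finset.mem_Iic.1 hi)

/-- `Ψ_{l,u}`: the sets of at least `l` and at most `u` units. -/
def PsiLU (K l u : ℕ) : Set (Finset (Fin K)) := {A | l ≤ A.card ∧ A.card ≤ u}

/-- A finite family `fam` of global distributions of the observations of `K` sources and, for every
source `k`, a null family `H k` and an alternative family `G k` of marginal distributions, which are
disjoint non-empty subfamilies of the family of the marginals on source `k`.  The units are the
individual sources; the unit `{k}` is denoted by `k`. -/
structure Model {K : ℕ} (E : Fin K → Type*) [∀ k, MeasurableSpace (E k)] where
  fam : Set (Measure (Paths E))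
  finite_fam : fam.Finite
  prob : ∀ P ∈ fam, IsProbabilityMeasure P
  H : (k : Fin K) → Set (Measure (ℕ → E k))
  G : (k : Fin K) → Set (Measure (ℕ → E k))
  H_sub : ∀ k, H k ⊆ marg k '' fam
  G_sub : ∀ k, G k ⊆ marg k '' fam
  H_nonempty : ∀ k, (H k).Nonempty
  G_nonempty : ∀ k, (G k).Nonempty
  disj : ∀ k, Disjoint (H k) (G k)

namespace Model

variable {K : ℕ} {E : Fin K → Type*} [∀ k, MeasurableSpace (E k)] (M : Model E)

open Classical in
/-- The set `𝒜(P)` of signals under `P`. -/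
def signals (P : Measure (Paths E)) : Finset (Fin K) :=
  Finset.univ.filter fun k => marg k P ∈ M.G k

/-- `𝒫_Ψ`: the global distributions compatible with the prior information `Ψ`. -/
def famPsi (Ψ : Set (Finset (Fin K))) : Set (Measure (Paths E)) :=
  {P | P ∈ M.fam ∧ (∀ k, marg k P ∈ M.H k ∪ M.G k) ∧ M.signals P ∈ Ψ}

/-- `ℋ_0`: the global null distributions. -/
def H0 : Set (Measure (Paths E)) := M.famPsi {∅}

/-- `ℋ_{Ψ,k}`: the non-null distributions in `𝒫_Ψ` under which `k` is not a signal. -/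
def HPsi (Ψ : Set (Finset (Fin K))) (k : Fin K) : Set (Measure (Paths E)) :=
  {P | P ∈ M.famPsi Ψ \ M.H0 ∧ k ∉ M.signals P}

/-- `𝒢_{Ψ,k}`: the distributions in `𝒫_Ψ` under which `k` is a signal. -/
def GPsi (Ψ : Set (Finset (Fin K))) (k : Fin K) : Set (Measure (Paths E)) :=
  {P | P ∈ M.famPsi Ψ ∧ k ∈ M.signals P}

/-! ### Standing assumptions -/

/-- The mutual absolute continuity on every `ℱ_n^s` which makes the likelihood ratios meaningful. -/
def MutuallyAC (Ψ : Set (Finset (Fin K))) : Prop :=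
  ∀ k, ∀ P ∈ M.GPsi Ψ k ∪ M.H0, ∀ Q ∈ M.HPsi Ψ k ∪ M.H0,
    ∀ s : Finset (Fin K), k ∈ s → ∀ n : ℕ, 1 ≤ n →
      restr s n P ≪ restr s n Q ∧ restr s n Q ≪ restr s n P

/-- The distributional assumptions: the information numbers `ℐ(P^s, Q^s)`, `ℐ(Q^s, P^s)` exist. -/
def InfoNumbersExist (Ψ : Set (Finset (Fin K))) : Prop :=
  ∀ k, ∀ P ∈ M.GPsi Ψ k, ∀ Q ∈ M.HPsi Ψ k ∪ M.H0,
    ∀ s : Finset (Fin K), k ∈ s → (∃ I, HasInfo s P Q I) ∧ (∃ J, HasInfo s Q P J)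

/-- The sources are independent under every distribution in `𝒫_Ψ`. -/
def IndependentSources (Ψ : Set (Finset (Fin K))) : Prop :=
  ∀ P ∈ M.famPsi Ψ, P = Measure.pi fun k => marg k P

/-- The local hypotheses can be combined freely, subject only to the prior information: a product
of local distributions whose set of signals belongs to `Ψ` is one of the plausible distributions. -/
def AllProducts (Ψ : Set (Finset (Fin K))) : Prop :=
  ∀ ν : (k : Fin K) → Measure (ℕ → E k), (∀ k, ν k ∈ M.H k ∪ M.G k) →
    (∃ A ∈ Ψ, ∀ k, k ∈ A ↔ ν k ∈ M.G k) → Measure.pi ν ∈ M.fam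

/-! ### Tests and familywise error control -/

/-- `(T, D)` is a test: `T ∈ {1, 2, …} ∪ {∞}` is a stopping time of the filtration `(ℱ_n)`, and
`D` is `Ψ`-valued and `ℱ_T`-measurable. -/
structure IsTest (Ψ : Set (Finset (Fin K))) (T : Paths E → ℕ∞) (D : Paths E → Finset (Fin K)) :
    Prop where
  one_le : ∀ ω, 1 ≤ T ω
  stopping : IsStoppingTime (filt (E := E) Finset.univ) T
  mem : ∀ ω, D ω ∈ Ψ
  measurable_decision : ∀ A, MeasurableSet {ω | D ω = A}
  decision : ∀ n : ℕ, 1 ≤ n → ∀ A ∈ Ψ,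
    MeasurableSet[filt (E := E) Finset.univ n] {ω | T ω = n ∧ D ω = A}

/-- `ℰ_Ψ(γ, δ)`: the tests whose familywise error probabilities of false positives and of false
negatives are at most `γ` and `δ`. -/
def fwerClass (Ψ : Set (Finset (Fin K))) (γ δ : ℝ) :
    Set ((Paths E → ℕ∞) × (Paths E → Finset (Fin K))) :=
  {X | IsTest Ψ X.1 X.2 ∧ ∀ P ∈ M.famPsi Ψ,
    P {ω | (X.2 ω \ M.signals P).Nonempty} ≤ ENNReal.ofReal γ ∧
    P {ω | (M.signals P \ X.2 ω).Nonempty} ≤ ENNReal.ofReal δ}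

/-- `inf {E_P[T] : (T, D) ∈ ℰ_Ψ(γ, δ)}`. -/
def optimalESS (Ψ : Set (Finset (Fin K))) (γ δ : ℝ) (P : Measure (Paths E)) : ℝ≥0∞ :=
  ⨅ X ∈ M.fwerClass Ψ γ δ, ∫⁻ ω, (X.1 ω : ℝ≥0∞) ∂P

/-! ### Statistics -/

/-- The detection statistic `Λ_{k,det}(n)`, for the detection subsystem `s` of `k` and the reference
distribution `P₀`. -/
def detStat (Ψ : Set (Finset (Fin K))) (s : Finset (Fin K)) (P₀ : Measure (Paths E))
    (k : Fin K) (n : ℕ) (ω : Paths E) : ℝ≥0∞ :=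
  (⨆ P ∈ M.GPsi Ψ k, LR s n P P₀ ω) / (⨆ P ∈ M.H0, LR s n P P₀ ω)

/-- The isolation statistic `Λ_{k,iso}(n)`, for the isolation subsystem `s'` of `k` and the
reference distribution `P₀`. -/
def isoStat (Ψ : Set (Finset (Fin K))) (s' : Finset (Fin K)) (P₀ : Measure (Paths E))
    (k : Fin K) (n : ℕ) (ω : Paths E) : ℝ≥0∞ :=
  (⨆ P ∈ M.GPsi Ψ k, LR s' n P P₀ ω) / (⨆ P ∈ M.HPsi Ψ k, LR s' n P P₀ ω)

/-- The local statistic `Λ_k(n)`.  The suprema are over the members of `G k` and `H k`, each of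
them represented by the global distributions having it as their marginal on source `k`. -/
def locStat (P₀ : Measure (Paths E)) (k : Fin K) (n : ℕ) (ω : Paths E) : ℝ≥0∞ :=
  (⨆ P ∈ {P | P ∈ M.fam ∧ marg k P ∈ M.G k}, LR {k} n P P₀ ω) /
    (⨆ P ∈ {P | P ∈ M.fam ∧ marg k P ∈ M.H k}, LR {k} n P P₀ ω)

/-- The ordered local statistic `Λ_{(j)}(n)`. -/
def ordLoc (P₀ : Fin K → Measure (Paths E)) (j n : ℕ) (ω : Paths E) : ℝ≥0∞ :=
  ordStat j fun k => M.locStat (P₀ k) k n ω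

open Classical in
/-- The number `p(n)` of units whose local statistics are larger than `1`. -/
def numPos (P₀ : Fin K → Measure (Paths E)) (n : ℕ) (ω : Paths E) : ℕ :=
  (Finset.univ.filter fun k => 1 < M.locStat (P₀ k) k n ω).card

open Classical in
/-- The estimated signal set `D_iso(n)`. -/
def Diso (Ψ : Set (Finset (Fin K))) (s' : Fin K → Finset (Fin K))
    (P₀' : Fin K → Measure (Paths E)) (n : ℕ) (ω : Paths E) : Finset (Fin K) :=
  Finset.univ.filter fun k => 1 < M.isoStat Ψ (s' k) (P₀' k) k n ω

/-! ### The test for joint detection and isolation, and its familywise version -/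

/-- `T_0`. -/
def Tnull (Ψ : Set (Finset (Fin K))) (s : Fin K → Finset (Fin K))
    (P₀ : Fin K → Measure (Paths E)) (C : Fin K → ℝ) : Paths E → ℕ∞ :=
  firstTime fun n => {ω | ∀ k, M.detStat Ψ (s k) (P₀ k) k n ω ≤ ENNReal.ofReal (1 / C k)}

/-- `T_joint`. -/
def Tjoint (Ψ : Set (Finset (Fin K))) (s s' : Fin K → Finset (Fin K))
    (P₀ P₀' : Fin K → Measure (Paths E)) (A B D : Fin K → ℝ) : Paths E → ℕ∞ :=
  firstTime fun n => {ω |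
    (∃ k, ENNReal.ofReal (D k) ≤ M.detStat Ψ (s k) (P₀ k) k n ω) ∧
    (∀ k, M.isoStat Ψ (s' k) (P₀' k) k n ω ∉
      Set.Ioo (ENNReal.ofReal (1 / A k)) (ENNReal.ofReal (B k))) ∧
    M.Diso Ψ s' P₀' n ω ∈ Ψ \ {∅}}

/-- The stopping time `T* = min (T_0, T_joint)`. -/
def Tstar (Ψ : Set (Finset (Fin K))) (s s' : Fin K → Finset (Fin K))
    (P₀ P₀' : Fin K → Measure (Paths E)) (A B C D : Fin K → ℝ) (ω : Paths E) : ℕ∞ :=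
  min (M.Tnull Ψ s P₀ C ω) (M.Tjoint Ψ s s' P₀ P₀' A B D ω)

open Classical in
/-- The decision `D*`: it is `D_iso(T*)` if `T_joint < T_0`, and `∅` if `T_0 < T_joint`
(by convention also if the procedure never stops). -/
def Dstar (Ψ : Set (Finset (Fin K))) (s s' : Fin K → Finset (Fin K))
    (P₀ P₀' : Fin K → Measure (Paths E)) (A B C D : Fin K → ℝ) (ω : Paths E) :
    Finset (Fin K) :=
  if M.Tjoint Ψ s s' P₀ P₀' A B D ω < M.Tnull Ψ s P₀ C ω then
    M.Diso Ψ s' P₀' (M.Tstar Ψ s s' P₀ P₀' A B C D ω).toNat ω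
  else ∅

/-- `T*_fwer` with common thresholds `A`, `B`: the stopping time `T*` with `C = A` and `D = B`. -/
def Tfwer (Ψ : Set (Finset (Fin K))) (s s' : Fin K → Finset (Fin K))
    (P₀ P₀' : Fin K → Measure (Paths E)) (A B : ℝ) : Paths E → ℕ∞ :=
  M.Tstar Ψ s s' P₀ P₀' (fun _ => A) (fun _ => B) (fun _ => A) (fun _ => B)

/-- `D*_fwer` with common thresholds `A`, `B`. -/
def Dfwer (Ψ : Set (Finset (Fin K))) (s s' : Fin K → Finset (Fin K))
    (P₀ P₀' : Fin K → Measure (Paths E)) (A B : ℝ) : Paths E → Finset (Fin K) :=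
  M.Dstar Ψ s s' P₀ P₀' (fun _ => A) (fun _ => B) (fun _ => A) (fun _ => B)

/-- The selection of the thresholds `A`, `B > 1` as functions of `γ, δ ∈ (0, 1)`: the test
`χ*_fwer` belongs to `ℰ_Ψ(γ, δ)` for all `γ`, `δ`, and `log A ∼ |log δ|`, `log B ∼ |log γ|` as
`γ, δ → 0`. -/
structure ThresholdSelection (Ψ : Set (Finset (Fin K))) (s s' : Fin K → Finset (Fin K))
    (P₀ P₀' : Fin K → Measure (Paths E)) (A B : ℝ → ℝ → ℝ) : Prop where
  one_lt_A : ∀ γ ∈ Set.Ioo (0 : ℝ) 1, ∀ δ ∈ Set.Ioo (0 : ℝ) 1, 1 < A γ δ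
  one_lt_B : ∀ γ ∈ Set.Ioo (0 : ℝ) 1, ∀ δ ∈ Set.Ioo (0 : ℝ) 1, 1 < B γ δ
  control : ∀ γ ∈ Set.Ioo (0 : ℝ) 1, ∀ δ ∈ Set.Ioo (0 : ℝ) 1,
    (M.Tfwer Ψ s s' P₀ P₀' (A γ δ) (B γ δ), M.Dfwer Ψ s s' P₀ P₀' (A γ δ) (B γ δ)) ∈
      M.fwerClass Ψ γ δ
  log_A : (fun p : ℝ × ℝ => Real.log (A p.1 p.2)) ~[𝓝[>] 0 ×ˢ 𝓝[>] 0] fun p => |Real.log p.2|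
  log_B : (fun p : ℝ × ℝ => Real.log (B p.1 p.2)) ~[𝓝[>] 0 ×ˢ 𝓝[>] 0] fun p => |Real.log p.1|

/-- `χ*_fwer` is asymptotically optimal under every `P ∈ 𝒫_Ψ`, for every selection of the
thresholds: `E_P[T*_fwer] ∼ inf {E_P[T] : (T, D) ∈ ℰ_Ψ(γ, δ)}` as `γ, δ → 0`. -/
def FwerAsymptoticallyOptimal (Ψ : Set (Finset (Fin K))) (s s' : Fin K → Finset (Fin K))
    (P₀ P₀' : Fin K → Measure (Paths E)) : Prop :=
  ∀ A B : ℝ → ℝ → ℝ, M.ThresholdSelection Ψ s s' P₀ P₀' A B →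
    ∀ P ∈ M.famPsi Ψ, Tendsto
      (fun p : ℝ × ℝ =>
        (∫⁻ ω, (M.Tfwer Ψ s s' P₀ P₀' (A p.1 p.2) (B p.1 p.2) ω : ℝ≥0∞) ∂P) /
          M.optimalESS Ψ p.1 p.2 P)
      (𝓝[>] 0 ×ˢ 𝓝[>] 0) (𝓝 1)

end Model

end SeqTest

end

/-! The first half of the argument removes the families of distributions. Independence makes the
likelihood ratio of all sources the product of the local ones (`LR_univ_eq_prod`), and since local
hypotheses combine freely, a maximum over global distributions with signal set `A` splits into one
maximum per source (`Regular.biSup_LR_univ`). Write `x k` for the local statistic of source `k`. On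
an almost sure event (`Regular`, `ae_regular`) the detection statistics are the `x k`, and the
isolation statistic with all sources is a ratio of two maxima of `∏ j ∈ A, x j`: over sets `A` of at
most `u` elements containing `k`, and over nonempty ones avoiding `k`. An exchange argument
(`prod_le_prod_of_dominates`) identifies the maximizing sets, so the stopping condition at each
fixed time becomes a statement about `K` numbers (`stop_iff`). If `u = K`, isolation with the single
source gives `x k` itself when `K ≥ 2`, and the rule only asks that all `x k` leave the interval.

The second half matches two bounds on the expected sample size under `P` with signal set `S`. Let `I
k` be the smallest information number of `P` against the opposite local hypothesis at `k` (`Rates`).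

Lower bound: a test with small errors separates `P` from each admissible `Q` that differs in one
source, so a change of measure (`UpperRate.eventually_le`) yields `|log γ| / I k` for `k ∈ S`, and
`|log δ| / I k` for `k ∉ S` if there is room for one more signal. If `S` already has `u < K`
elements, a new signal requires dropping an old one, the informations add up, and the bound is `|log
δ| / (I j + I k)`.

Upper bound: with bad events of summable probability, every local log-likelihood ratio at time `n`
is at least `(1 - ε) n I k`, and there the explicit rules have stopped by the time given by the
lower bound up to `ε` (`Rates.lintegral_le`). The gap rule `T_3` produces precisely the sum `I j + I
k`. The bounds are combined in `tendsto_ratio_of_bounds` and `optimal_of_stops`. -/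

namespace SeqTest

open ProbabilityTheory

/-! ### Likelihood ratios, marginals, and factorization under independence. -/

section LikelihoodRatio

variable {K : ℕ} {E : Fin K → Type*} [∀ k, MeasurableSpace (E k)]
  {s : Finset (Fin K)} {n : ℕ} {P Q Q' : Measure (Paths E)}

theorem restr_apply {A : Set (Paths E)} (hA : MeasurableSet[filt s n] A) :
    restr s n P A = P A :=
  trim_measurableSet_eq _ hA

theorem ae_of_ae_restr {p : Paths E → Prop} (h : ∀ᵐ ω ∂(restr s n P), p ω) : ∀ᵐ ω ∂P, p ω :=
  ae_of_ae_trim _ h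

instance [IsProbabilityMeasure P] : IsProbabilityMeasure (restr s n P) :=
  ⟨by rw [restr_apply (@MeasurableSet.univ _ (filt s n))]; exact measure_univ⟩

theorem measurable_LR : Measurable[filt s n] (LR s n P Q) :=
  @Measure.measurable_rnDeriv _ (filt s n) _ _

theorem measurable_Z : Measurable[filt s n] (Z s n P Q) :=
  Real.measurable_log.comp (ENNReal.measurable_toReal.comp measurable_LR)

theorem measurable_Z' : Measurable (Z s n P Q) :=
  measurable_Z.mono ((filt s).le n) le_rfl

theorem measurable_of_coord {Ω : Type*} {m : MeasurableSpace Ω}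
    {g : Ω → (k : s) → Fin n → E k} (h : ∀ j i, Measurable fun ω => g ω j i) : Measurable g :=
  measurable_pi_iff.2 fun j => measurable_pi_iff.2 fun i => h j i

theorem measurable_coord_of {Ω : Type*} {m : MeasurableSpace Ω}
    {g : Ω → (k : s) → Fin n → E k} (h : Measurable g) (j) (i) : Measurable fun ω => g ω j i :=
  measurable_pi_iff.1 (measurable_pi_iff.1 h j) i

theorem measurable_coord {k : Fin K} (hk : k ∈ s) (i : Fin n) :
    Measurable[filt s n] fun ω : Paths E => ω k i :=
  measurable_coord_of (m := filt s n) (comap_measurable (obs s n)) ⟨k, hk⟩ i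

theorem filt_singleton_le (k : Fin K) (n : ℕ) :
    (filt {k} n : MeasurableSpace (Paths E)) ≤
      MeasurableSpace.comap (fun ω : Paths E => ω k) inferInstance := by
  change MeasurableSpace.comap (obs {k} n) inferInstance ≤ _
  rw [← measurable_iff_comap_le]
  refine measurable_of_coord fun j i => ?_
  obtain ⟨j, hj⟩ := j
  obtain rfl := Finset.mem_singleton.1 hj
  exact (measurable_pi_apply (i : ℕ)).comp (comap_measurable (fun ω : Paths E => ω j))

/-- The supremum is bounded by `Set.univ` to match `generateFrom_piiUnionInter_measurableSet`, which
supplies rectangles as a generating π-system. -/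
theorem filt_univ_eq (n : ℕ) :
    (filt Finset.univ n : MeasurableSpace (Paths E)) = ⨆ k ∈ Set.univ, filt {k} n := by
  apply le_antisymm
  · change MeasurableSpace.comap (obs Finset.univ n) inferInstance ≤ _
    rw [← measurable_iff_comap_le]
    refine measurable_of_coord fun j i => ?_
    have h := measurable_coord (E := E) (Finset.mem_singleton_self j.1) i
    exact h.mono (le_iSup₂_of_le j.1 (Set.mem_univ _) le_rfl) le_rfl
  · refine iSup₂_le fun k _ => ?_
    change MeasurableSpace.comap (obs {k} n) inferInstance ≤ _
    rw [← measurable_iff_comap_le]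
    refine measurable_of_coord fun j i => ?_
    exact measurable_coord (Finset.mem_univ j.1) i

/-- The σ-field of source `k` up to time `n` lies in the one generated by coordinate `k`, so only
the marginal counts. Local statements about a measure can thus be moved to a member of 𝒫_Ψ with the
same marginal. -/
theorem restr_singleton_congr {k : Fin K} (h : marg k P = marg k Q) :
    restr {k} n P = restr {k} n Q := by
  refine @Measure.ext _ (filt {k} n) _ _ fun A hA => ?_
  rw [restr_apply hA, restr_apply hA]
  obtain ⟨B, hB, rfl⟩ := filt_singleton_le k n _ hA
  rw [← Measure.map_apply (measurable_pi_apply k) hB, ← Measure.map_apply (measurable_pi_apply k) hB]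
  exact congrArg (fun μ => μ B) h

theorem LR_congr {k : Fin K} {P' Q' : Measure (Paths E)} (h : marg k P = marg k P')
    (h' : marg k Q = marg k Q') : LR {k} n P Q = LR {k} n P' Q' := by
  rw [LR, LR, restr_singleton_congr h, restr_singleton_congr h']

theorem HasInfo.congr {k : Fin K} {P' Q' : Measure (Paths E)} (h : marg k P = marg k P')
    (h' : marg k Q = marg k Q') {I : ℝ} (hI : HasInfo {k} P Q I) : HasInfo {k} P' Q' I := by
  have hZ : ∀ n, Z {k} n P' Q' = Z {k} n P Q := fun n => by
    funext ω; rw [Z, Z, LR_congr h h']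
  have hP : ∀ n (A : Set (Paths E)), MeasurableSet[filt {k} n] A → P' A = P A := fun n A hA => by
    rw [← restr_apply hA, ← restr_singleton_congr h, restr_apply hA]
  refine ⟨hI.1, fun ρ hρ => ?_, fun ρ hρ => ?_⟩
  · refine (hI.2.1 ρ hρ).congr fun n => ?_
    simp_rw [hZ]
    refine (hP n _ ?_).symm
    have : {ω | ∃ m ∈ Finset.Icc 1 n, (n : ℝ) * ρ ≤ Z {k} m P Q ω} =
        ⋃ m ∈ Finset.Icc 1 n, {ω | (n : ℝ) * ρ ≤ Z {k} m P Q ω} := by ext; simp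
    rw [this]
    refine Finset.measurableSet_biUnion _ fun m hm => ?_
    exact (filt {k}).mono (Finset.mem_Icc.1 hm).2 _
      (measurable_Z (s := {k}) measurableSet_Ici)
  · refine lt_of_le_of_lt (le_of_eq (tsum_congr fun n => ?_)) (hI.2.2 ρ hρ)
    simp_rw [hZ]
    exact hP n _ (measurable_Z (s := {k}) measurableSet_Iio)

theorem setLIntegral_LR [IsProbabilityMeasure P] [IsProbabilityMeasure Q]
    (h : restr s n P ≪ restr s n Q) {A : Set (Paths E)} (hA : MeasurableSet[filt s n] A) :
    ∫⁻ ω in A, LR s n P Q ω ∂Q = P A := by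
  have hle := (filt (E := E) s).le n
  rw [← restr_apply (P := P) hA, ← Measure.setLIntegral_rnDeriv' h hA,
    ← lintegral_indicator (hle A hA), ← @lintegral_indicator _ (filt s n) _ _ hA]
  exact (lintegral_trim hle (measurable_LR.indicator hA)).symm

theorem LR_pos [IsProbabilityMeasure P] [IsProbabilityMeasure Q]
    (h : restr s n P ≪ restr s n Q) (h' : restr s n Q ≪ restr s n P) :
    ∀ᵐ ω ∂Q, 0 < LR s n P Q ω :=
  ae_of_ae_restr (h'.ae_le (Measure.rnDeriv_pos h))

theorem LR_lt_top [IsProbabilityMeasure P] [IsProbabilityMeasure Q] :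
    ∀ᵐ ω ∂Q, LR s n P Q ω < ∞ :=
  ae_of_ae_restr (Measure.rnDeriv_lt_top _ _)

theorem LR_chain [IsProbabilityMeasure P] [IsProbabilityMeasure Q] [IsProbabilityMeasure Q']
    (h : restr s n P ≪ restr s n Q) :
    ∀ᵐ ω ∂Q', LR s n P Q' ω = LR s n P Q ω * LR s n Q Q' ω :=
  ae_of_ae_restr ((Measure.rnDeriv_mul_rnDeriv h).mono fun _ hω => hω.symm)

theorem LR_self [IsProbabilityMeasure P] : ∀ᵐ ω ∂P, LR s n P P ω = 1 :=
  ae_of_ae_restr (Measure.rnDeriv_self _)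

/-- Each `X k` is a measurable function of coordinate `k` alone, and the coordinates are independent
under a product measure. -/
theorem lintegral_prod_coord [∀ k, Nonempty (ℕ → E k)] {ν : ∀ k, Measure (ℕ → E k)}
    [∀ k, IsProbabilityMeasure (ν k)] (X : Fin K → Paths E → ℝ≥0∞)
    (hX : ∀ k, Measurable[MeasurableSpace.comap (fun ω : Paths E => ω k) inferInstance] (X k)) :
    ∫⁻ ω, ∏ k, X k ω ∂(Measure.pi ν) = ∏ k, ∫⁻ ω, X k ω ∂(Measure.pi ν) := by
  have hex : ∀ k, ∃ Y : (ℕ → E k) → ℝ≥0∞, Measurable Y ∧ X k = Y ∘ fun ω : Paths E => ω k :=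
    fun k => (hX k).exists_eq_measurable_comp
  choose Y hY hXY using hex
  have hind : iIndepFun (fun k (ω : Paths E) => Y k (ω k)) (Measure.pi ν) :=
    iIndepFun_pi fun k => (hY k).aemeasurable
  have := lintegral_prod_eq_prod_lintegral_of_indepFun Finset.univ _ hind
    fun k => (hY k).comp (measurable_pi_apply k)
  simpa only [hXY, Function.comp_def] using this

/-- The product of the local ratios integrates over a rectangle to the product of the local
probabilities, which is its `P`-probability. Rectangles form a generating π-system, so this product
is a density, and densities are almost surely unique. -/
theorem LR_univ_eq_prod [IsProbabilityMeasure P] [IsProbabilityMeasure Q]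
    (hP : P = Measure.pi fun k => marg k P) (hQ : Q = Measure.pi fun k => marg k Q)
    (hac : ∀ k, restr {k} n P ≪ restr {k} n Q) :
    ∀ᵐ ω ∂Q, LR Finset.univ n P Q ω = ∏ k, LR {k} n P Q ω := by
  have hne : Nonempty (Paths E) := nonempty_of_isProbabilityMeasure P
  have hne' : ∀ k, Nonempty (ℕ → E k) := fun k => hne.map fun ω => ω k
  have hpP : ∀ k, IsProbabilityMeasure (marg k P) := fun k =>
    Measure.isProbabilityMeasure_map (measurable_pi_apply k).aemeasurable
  have hpQ : ∀ k, IsProbabilityMeasure (marg k Q) := fun k =>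
    Measure.isProbabilityMeasure_map (measurable_pi_apply k).aemeasurable
  have hle := (filt (E := E) Finset.univ).le n
  have hlek : ∀ k, (filt {k} n : MeasurableSpace (Paths E)) ≤ filt Finset.univ n := fun k => by
    rw [filt_univ_eq]; exact le_iSup₂_of_le k (Set.mem_univ k) le_rfl
  have hmeas : Measurable[filt Finset.univ n] fun ω : Paths E => ∏ k, LR {k} n P Q ω :=
    Finset.measurable_fun_prod _ fun k _ => measurable_LR.mono (hlek k) le_rfl
  have hrect : ∀ F : Fin K → Set (Paths E), (∀ k, MeasurableSet[filt {k} n] (F k)) →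
      ∫⁻ ω in ⋂ k, F k, ∏ k, LR {k} n P Q ω ∂Q = P (⋂ k, F k) := by
    intro F hF
    have hFm : ∀ k, MeasurableSet (F k) := fun k => (filt {k}).le n _ (hF k)
    have hm := MeasurableSet.iInter hFm
    -- The indicator of a rectangle is absorbed factor by factor, leaving a product of functions of
    -- single sources.
    have hprod : ∀ (f : Fin K → Paths E → ℝ≥0∞) (ω : Paths E),
        (⋂ k, F k).indicator (fun ω => ∏ k, f k ω) ω = ∏ k, (F k).indicator (f k) ω := by
      intro f ω
      by_cases h : ω ∈ ⋂ k, F k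
      · rw [Set.indicator_of_mem h]
        exact Finset.prod_congr rfl fun k _ =>
          (Set.indicator_of_mem (Set.mem_iInter.1 h k) _).symm
      · rw [Set.indicator_of_notMem h]
        obtain ⟨k, hk⟩ := not_forall.1 (mt Set.mem_iInter.2 h)
        exact (Finset.prod_eq_zero (Finset.mem_univ k) (Set.indicator_of_notMem hk _)).symm
    have h1 : ∫⁻ ω in ⋂ k, F k, ∏ k, LR {k} n P Q ω ∂Q = ∏ k, P (F k) := by
      rw [← lintegral_indicator hm]
      simp_rw [hprod]
      have := lintegral_prod_coord (ν := fun k => marg k Q)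
        (fun k => (F k).indicator (LR {k} n P Q)) fun k =>
          (measurable_LR.indicator (hF k)).mono (filt_singleton_le k n) le_rfl
      rw [← hQ] at this
      rw [this]
      refine Finset.prod_congr rfl fun k _ => ?_
      rw [lintegral_indicator (hFm k), setLIntegral_LR (hac k) (hF k)]
    have h2 : P (⋂ k, F k) = ∏ k, P (F k) := by
      rw [← lintegral_indicator_one hm]
      have := hprod (fun _ _ => 1)
      simp only [Finset.prod_const_one] at this
      have h1' : (⋂ k, F k).indicator (1 : Paths E → ℝ≥0∞) =
          fun ω => ∏ k, (F k).indicator (fun _ => 1) ω := funext this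
      rw [h1']
      have := lintegral_prod_coord (ν := fun k => marg k P)
        (fun k => (F k).indicator (fun _ => 1)) fun k =>
          (Measurable.indicator measurable_const (hF k)).mono (filt_singleton_le k n) le_rfl
      rw [← hP] at this
      rw [this]
      exact Finset.prod_congr rfl fun k _ => lintegral_indicator_one (hFm k)
    rw [h1, h2]
  have hall : restr Finset.univ n P =
      (restr Finset.univ n Q).withDensity (fun ω => ∏ k, LR {k} n P Q ω) := by
    have key : ∀ F : Fin K → Set (Paths E), (∀ k, MeasurableSet[filt {k} n] (F k)) →
        restr Finset.univ n P (⋂ k, F k) =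
        (restr Finset.univ n Q).withDensity (fun ω => ∏ k, LR {k} n P Q ω) (⋂ k, F k) := by
      intro F hF
      have hm : MeasurableSet[filt Finset.univ n] (⋂ k, F k) :=
        @MeasurableSet.iInter _ _ (filt Finset.univ n) _ _ fun k => hlek k _ (hF k)
      rw [restr_apply hm, withDensity_apply _ hm, ← hrect F hF, ← lintegral_indicator (hle _ hm),
        ← @lintegral_indicator _ (filt Finset.univ n) _ _ hm]
      exact (lintegral_trim hle (hmeas.indicator hm)).symm
    refine @ext_of_generate_finite _ (filt Finset.univ n) _ _
      (piiUnionInter (fun k => {A | MeasurableSet[filt {k} n] A}) Set.univ) ?_ ?_ inferInstance ?_ ?_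
    · exact (filt_univ_eq n).trans
        (generateFrom_piiUnionInter_measurableSet (fun k => filt {k} n) Set.univ).symm
    · exact isPiSystem_piiUnionInter _
        (fun k => @MeasurableSpace.isPiSystem_measurableSet _ (filt {k} n)) _
    · rintro A ⟨t, -, f, hf, rfl⟩
      -- The π-system consists of intersections over finite subsets of the sources; the missing
      -- sides are filled with `Set.univ`.
      have hset : (⋂ k ∈ t, f k) = ⋂ k, (if k ∈ t then f k else Set.univ) := by
        ext ω
        simp only [Set.mem_iInter]
        refine forall_congr' fun k => ?_
        by_cases hk : k ∈ t <;> simp [hk]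
      rw [hset]
      refine key _ fun k => ?_
      by_cases hk : k ∈ t
      · simp only [hk, if_true]; exact hf k hk
      · simp only [hk, if_false]; exact @MeasurableSet.univ _ (filt {k} n)
    · have := key (fun _ => Set.univ) fun k => @MeasurableSet.univ _ (filt {k} n)
      simpa only [Set.iInter_univ] using this
  refine ae_of_ae_restr (s := Finset.univ) (n := n) ?_
  have := @Measure.rnDeriv_withDensity _ (filt Finset.univ n) (restr Finset.univ n Q) _ _ hmeas
  rw [← hall] at this
  exact this

end LikelihoodRatio

/-! ### Realizable distributions and the almost sure regular event. -/

namespace Model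

variable {K : ℕ} {E : Fin K → Type*} [∀ k, MeasurableSpace (E k)] {M : Model E} {u n : ℕ}
  {P Q R : Measure (Paths E)} {k : Fin K} {Ψ : Set (Finset (Fin K))}

theorem mem_signals : k ∈ M.signals P ↔ marg k P ∈ M.G k := by
  simp [signals]

theorem isProbabilityMeasure_of_mem_famPsi (hP : P ∈ M.famPsi Ψ) : IsProbabilityMeasure P :=
  M.prob P hP.1

theorem isProbabilityMeasure_of_mem {ν : Measure (ℕ → E k)} (hν : ν ∈ M.H k ∪ M.G k) :
    IsProbabilityMeasure ν := by
  have : ν ∈ marg k '' M.fam := hν.elim (fun h => M.H_sub k h) fun h => M.G_sub k h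
  obtain ⟨P, hP, rfl⟩ := this
  have := M.prob P hP
  exact Measure.isProbabilityMeasure_map (measurable_pi_apply k).aemeasurable

theorem notMem_signals_iff (hP : P ∈ M.famPsi Ψ) : k ∉ M.signals P ↔ marg k P ∈ M.H k := by
  rw [mem_signals]
  exact ⟨fun h => (hP.2.1 k).resolve_right h, fun h h' => (M.disj k).le_bot ⟨h, h'⟩⟩

theorem card_signals_le (hP : P ∈ M.famPsi (PsiLU K 0 u)) : (M.signals P).card ≤ u := hP.2.2.2

theorem signals_eq_empty (hP : P ∈ M.H0) : M.signals P = ∅ := hP.2.2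

theorem H0_subset : M.H0 ⊆ M.famPsi (PsiLU K 0 u) := fun P hP =>
  ⟨hP.1, hP.2.1, by rw [signals_eq_empty hP]; simp [PsiLU]⟩

theorem mem_H0_iff : P ∈ M.H0 ↔ P ∈ M.famPsi (PsiLU K 0 u) ∧ M.signals P = ∅ :=
  ⟨fun h => ⟨H0_subset h, signals_eq_empty h⟩, fun h => ⟨h.1.1, h.1.2.1, h.2⟩⟩

theorem mem_HPsi_iff : P ∈ M.HPsi (PsiLU K 0 u) k ↔
    P ∈ M.famPsi (PsiLU K 0 u) ∧ M.signals P ≠ ∅ ∧ k ∉ M.signals P := by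
  constructor
  · rintro ⟨⟨h1, h2⟩, h3⟩
    exact ⟨h1, fun h => h2 (mem_H0_iff.2 ⟨h1, h⟩), h3⟩
  · rintro ⟨h1, h2, h3⟩
    exact ⟨⟨h1, fun h => h2 (signals_eq_empty h)⟩, h3⟩

theorem mem_HPsi_union (hP : P ∈ M.famPsi (PsiLU K 0 u)) (h : k ∉ M.signals P) :
    P ∈ M.HPsi (PsiLU K 0 u) k ∪ M.H0 := by
  by_cases h0 : M.signals P = ∅
  · exact Or.inr (mem_H0_iff.2 ⟨hP, h0⟩)
  · exact Or.inl (mem_HPsi_iff.2 ⟨hP, h0, h⟩)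

/-- Any choice of local distributions, with signal set `A` of at most `u` elements, is realized. -/
theorem exists_mem_famPsi (hprod : M.AllProducts (PsiLU K 0 u)) {A : Finset (Fin K)}
    (hA : A.card ≤ u) {ν : ∀ k, Measure (ℕ → E k)} (hG : ∀ k ∈ A, ν k ∈ M.G k)
    (hH : ∀ k ∉ A, ν k ∈ M.H k) :
    ∃ P ∈ M.famPsi (PsiLU K 0 u), M.signals P = A ∧ ∀ k, marg k P = ν k := by
  have hν : ∀ k, ν k ∈ M.H k ∪ M.G k := fun k => by
    by_cases h : k ∈ A
    · exact Or.inr (hG k h)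
    · exact Or.inl (hH k h)
  have hiff : ∀ k, k ∈ A ↔ ν k ∈ M.G k := fun k =>
    ⟨hG k, fun h => by_contra fun h' => (M.disj k).le_bot ⟨hH k h', h⟩⟩
  have hpr : ∀ k, IsProbabilityMeasure (ν k) := fun k => isProbabilityMeasure_of_mem (hν k)
  have hm : ∀ k, marg k (Measure.pi ν) = ν k := fun k => (measurePreserving_eval ν k).map_eq
  have hs : M.signals (Measure.pi ν) = A := by
    ext k; rw [mem_signals, hm, hiff]
  refine ⟨Measure.pi ν, ⟨hprod ν hν ⟨A, ⟨Nat.zero_le _, hA⟩, hiff⟩, fun k => ?_, ?_⟩, hs, hm⟩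
  · rw [hm]; exact hν k
  · rw [hs]; exact ⟨Nat.zero_le _, hA⟩

/-- The same for given global distributions realizing the marginals. -/
theorem exists_mem_famPsi' (hprod : M.AllProducts (PsiLU K 0 u)) {A : Finset (Fin K)}
    (hA : A.card ≤ u) {p : Fin K → Measure (Paths E)} (hG : ∀ k ∈ A, marg k (p k) ∈ M.G k)
    (hH : ∀ k ∉ A, marg k (p k) ∈ M.H k) :
    ∃ P ∈ M.famPsi (PsiLU K 0 u), M.signals P = A ∧ ∀ k, marg k P = marg k (p k) :=
  exists_mem_famPsi hprod hA (ν := fun k => marg k (p k)) hG hH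

/-- A change of the distribution of one source, to the null. -/
theorem exists_update_null (hprod : M.AllProducts (PsiLU K 0 u))
    (hP : P ∈ M.famPsi (PsiLU K 0 u)) {ν : Measure (ℕ → E k)} (hν : ν ∈ M.H k) :
    ∃ P' ∈ M.famPsi (PsiLU K 0 u), M.signals P' = (M.signals P).erase k ∧ marg k P' = ν ∧
      ∀ j, j ≠ k → marg j P' = marg j P := by
  classical
  obtain ⟨P', h1, h2, h3⟩ := exists_mem_famPsi hprod (A := (M.signals P).erase k)
    (ν := Function.update (fun j => marg j P) k ν)
    ((Finset.card_le_card (Finset.erase_subset _ _)).trans (card_signals_le hP))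
    (fun j hj => by
      rw [Function.update_of_ne (Finset.mem_erase.1 hj).1]
      exact mem_signals.1 (Finset.mem_erase.1 hj).2)
    (fun j hj => by
      by_cases hjk : j = k
      · subst hjk; rwa [Function.update_self]
      · rw [Function.update_of_ne hjk]
        exact (notMem_signals_iff hP).1 fun h => hj (Finset.mem_erase.2 ⟨hjk, h⟩))
  refine ⟨P', h1, h2, by rw [h3, Function.update_self], fun j hj => ?_⟩
  rw [h3, Function.update_of_ne hj]

/-- A change of the distribution of one source, to the alternative. -/
theorem exists_update_alt (hprod : M.AllProducts (PsiLU K 0 u))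
    (hP : P ∈ M.famPsi (PsiLU K 0 u)) (hcard : (insert k (M.signals P)).card ≤ u)
    {ν : Measure (ℕ → E k)} (hν : ν ∈ M.G k) :
    ∃ P' ∈ M.famPsi (PsiLU K 0 u), M.signals P' = insert k (M.signals P) ∧ marg k P' = ν ∧
      ∀ j, j ≠ k → marg j P' = marg j P := by
  classical
  obtain ⟨P', h1, h2, h3⟩ := exists_mem_famPsi hprod hcard
    (ν := Function.update (fun j => marg j P) k ν)
    (fun j hj => by
      by_cases hjk : j = k
      · subst hjk; rwa [Function.update_self]
      · rw [Function.update_of_ne hjk]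
        exact mem_signals.1 ((Finset.mem_insert.1 hj).resolve_left hjk))
    (fun j hj => by
      rw [Finset.mem_insert, not_or] at hj
      rw [Function.update_of_ne hj.1]
      exact (notMem_signals_iff hP).1 hj.2)
  refine ⟨P', h1, h2, by rw [h3, Function.update_self], fun j hj => ?_⟩
  rw [h3, Function.update_of_ne hj]

theorem H0_nonempty (hprod : M.AllProducts (PsiLU K 0 u)) : M.H0.Nonempty := by
  obtain ⟨P, h1, h2, -⟩ := exists_mem_famPsi hprod (A := ∅) (Nat.zero_le _)
    (ν := fun k => (M.H_nonempty k).some) (by simp) fun k _ => (M.H_nonempty k).some_mem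
  exact ⟨P, mem_H0_iff.2 ⟨h1, h2⟩⟩

theorem exists_H0_marg (hprod : M.AllProducts (PsiLU K 0 u)) {ν : Measure (ℕ → E k)}
    (hν : ν ∈ M.H k) : ∃ P ∈ M.H0, marg k P = ν := by
  obtain ⟨P, hP⟩ := H0_nonempty hprod
  obtain ⟨P', h1, h2, h3, -⟩ := exists_update_null hprod (H0_subset hP) hν
  refine ⟨P', mem_H0_iff.2 ⟨h1, ?_⟩, h3⟩
  rw [h2, signals_eq_empty hP]; rfl

theorem exists_signal_marg (hu : 1 ≤ u) (hprod : M.AllProducts (PsiLU K 0 u))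
    {ν : Measure (ℕ → E k)} (hν : ν ∈ M.G k) :
    ∃ P ∈ M.famPsi (PsiLU K 0 u), M.signals P = {k} ∧ marg k P = ν := by
  obtain ⟨P, hP⟩ := H0_nonempty hprod
  obtain ⟨P', h1, h2, h3, -⟩ := exists_update_alt (u := u) hprod (H0_subset hP) (k := k)
    (by rw [signals_eq_empty hP]; simpa using hu) hν
  refine ⟨P', h1, ?_, h3⟩
  rw [h2, signals_eq_empty hP]; rfl

theorem exists_famPsi_marg (hu : 1 ≤ u) (hprod : M.AllProducts (PsiLU K 0 u))
    {ν : Measure (ℕ → E k)} (hν : ν ∈ M.H k ∪ M.G k) :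
    ∃ P ∈ M.famPsi (PsiLU K 0 u), marg k P = ν := by
  rcases hν with h | h
  · obtain ⟨P, h1, h2⟩ := exists_H0_marg hprod h
    exact ⟨P, H0_subset h1, h2⟩
  · obtain ⟨P, h1, -, h2⟩ := exists_signal_marg hu hprod h
    exact ⟨P, h1, h2⟩

/-- Under mutual absolute continuity, all distributions in `𝒫_Ψ` are equivalent on `ℱ_n^s`. -/
theorem restr_ac (hac : M.MutuallyAC (PsiLU K 0 u)) (hprod : M.AllProducts (PsiLU K 0 u))
    (hP : P ∈ M.famPsi (PsiLU K 0 u)) (hQ : Q ∈ M.famPsi (PsiLU K 0 u)) {s : Finset (Fin K)}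
    (hk : k ∈ s) (hn : 1 ≤ n) : restr s n P ≪ restr s n Q := by
  obtain ⟨R, hR⟩ := H0_nonempty hprod
  have key : ∀ P ∈ M.famPsi (PsiLU K 0 u),
      restr s n P ≪ restr s n R ∧ restr s n R ≪ restr s n P := by
    intro P hP
    by_cases h : k ∈ M.signals P
    · exact hac k P (Or.inl ⟨hP, h⟩) R (Or.inr hR) s hk n hn
    · exact (hac k R (Or.inr hR) P (mem_HPsi_union hP h) s hk n hn).symm
  exact (key P hP).1.trans (key Q hQ).2

/-- The relations between the likelihood ratios at time `n` which hold almost surely. -/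
structure Regular (M : Model E) (u n : ℕ) (ω : Paths E) : Prop where
  ne_zero : ∀ P ∈ M.famPsi (PsiLU K 0 u), ∀ Q ∈ M.famPsi (PsiLU K 0 u), ∀ k, LR {k} n P Q ω ≠ 0
  ne_top : ∀ P ∈ M.famPsi (PsiLU K 0 u), ∀ Q ∈ M.famPsi (PsiLU K 0 u), ∀ k, LR {k} n P Q ω ≠ ∞
  chain : ∀ P ∈ M.famPsi (PsiLU K 0 u), ∀ Q ∈ M.famPsi (PsiLU K 0 u),
    ∀ R ∈ M.famPsi (PsiLU K 0 u), ∀ k, LR {k} n P R ω = LR {k} n P Q ω * LR {k} n Q R ω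
  self : ∀ P ∈ M.famPsi (PsiLU K 0 u), ∀ k, LR {k} n P P ω = 1
  prod : ∀ P ∈ M.famPsi (PsiLU K 0 u), ∀ Q ∈ M.famPsi (PsiLU K 0 u),
    LR Finset.univ n P Q ω = ∏ k, LR {k} n P Q ω

/-- An identity of likelihood ratios is natural under its own reference measure `Q`. It transfers to
`P` because the two are equivalent on ℱ_n^s, which is why the event must be measurable there. -/
theorem ae_of_ae_famPsi (hac : M.MutuallyAC (PsiLU K 0 u)) (hprod : M.AllProducts (PsiLU K 0 u))
    (hP : P ∈ M.famPsi (PsiLU K 0 u)) (hQ : Q ∈ M.famPsi (PsiLU K 0 u)) {s : Finset (Fin K)}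
    (hk : k ∈ s) (hn : 1 ≤ n) {p : Paths E → Prop} (hp : MeasurableSet[filt s n] {ω | p ω})
    (h : ∀ᵐ ω ∂Q, p ω) : ∀ᵐ ω ∂P, p ω := by
  refine ae_of_ae_restr ((restr_ac hac hprod hP hQ hk hn).ae_le ?_)
  change restr s n Q {ω | p ω}ᶜ = 0
  rw [restr_apply (@MeasurableSet.compl _ _ (filt s n) hp)]
  exact h

/-- Each clause is proved under the reference measure of its ratio and transferred to `P`. The
family is finite and the times are countable, so one null set suffices. Time `0` is left out because
equivalence is assumed from time `1` on. -/
theorem ae_regular (hu : 1 ≤ u) (huK : u ≤ K) (hac : M.MutuallyAC (PsiLU K 0 u))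
    (hind : M.IndependentSources (PsiLU K 0 u)) (hprod : M.AllProducts (PsiLU K 0 u))
    (hP : P ∈ M.famPsi (PsiLU K 0 u)) : ∀ᵐ ω ∂P, ∀ n, 1 ≤ n → M.Regular u n ω := by
  have hfin : (M.famPsi (PsiLU K 0 u)).Countable :=
    (M.finite_fam.subset fun _ h => h.1).countable
  have hlek : ∀ (k : Fin K) (n : ℕ),
      (filt {k} n : MeasurableSpace (Paths E)) ≤ filt Finset.univ n := fun k n => by
    rw [filt_univ_eq]; exact le_iSup₂_of_le k (Set.mem_univ k) le_rfl
  refine ae_all_iff.2 fun n => ?_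
  by_cases hn : 1 ≤ n
  swap
  · exact Eventually.of_forall fun ω h => absurd h hn
  have hpr : ∀ Q ∈ M.famPsi (PsiLU K 0 u), IsProbabilityMeasure Q :=
    fun Q hQ => isProbabilityMeasure_of_mem_famPsi hQ
  have hm : ∀ k (Q R : Measure (Paths E)), Measurable[filt {k} n] (LR {k} n Q R) :=
    fun k Q R => measurable_LR
  have h1 : ∀ᵐ ω ∂P, ∀ Q ∈ M.famPsi (PsiLU K 0 u), ∀ R ∈ M.famPsi (PsiLU K 0 u), ∀ k,
      LR {k} n Q R ω ≠ 0 := by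
    refine (ae_ball_iff hfin).2 fun Q hQ => (ae_ball_iff hfin).2 fun R hR => ae_all_iff.2 fun k => ?_
    have := hpr Q hQ
    have := hpr R hR
    refine ae_of_ae_famPsi hac hprod hP hR (Finset.mem_singleton_self k) hn
      (hm k Q R (measurableSet_singleton 0).compl) ?_
    exact (LR_pos (restr_ac hac hprod hQ hR (Finset.mem_singleton_self k) hn)
      (restr_ac hac hprod hR hQ (Finset.mem_singleton_self k) hn)).mono fun _ h => h.ne'
  have h2 : ∀ᵐ ω ∂P, ∀ Q ∈ M.famPsi (PsiLU K 0 u), ∀ R ∈ M.famPsi (PsiLU K 0 u), ∀ k,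
      LR {k} n Q R ω ≠ ∞ := by
    refine (ae_ball_iff hfin).2 fun Q hQ => (ae_ball_iff hfin).2 fun R hR => ae_all_iff.2 fun k => ?_
    have := hpr Q hQ
    have := hpr R hR
    refine ae_of_ae_famPsi hac hprod hP hR (Finset.mem_singleton_self k) hn
      (hm k Q R (measurableSet_singleton ∞).compl) ?_
    exact LR_lt_top.mono fun _ h => h.ne
  have h3 : ∀ᵐ ω ∂P, ∀ Q ∈ M.famPsi (PsiLU K 0 u), ∀ R ∈ M.famPsi (PsiLU K 0 u),
      ∀ S ∈ M.famPsi (PsiLU K 0 u), ∀ k,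
      LR {k} n Q S ω = LR {k} n Q R ω * LR {k} n R S ω := by
    refine (ae_ball_iff hfin).2 fun Q hQ => (ae_ball_iff hfin).2 fun R hR =>
      (ae_ball_iff hfin).2 fun S hS => ae_all_iff.2 fun k => ?_
    have := hpr Q hQ
    have := hpr R hR
    have := hpr S hS
    refine ae_of_ae_famPsi hac hprod hP hS (Finset.mem_singleton_self k) hn
      (measurableSet_eq_fun (hm k Q S) ((hm k Q R).mul (hm k R S))) ?_
    exact LR_chain (restr_ac hac hprod hQ hR (Finset.mem_singleton_self k) hn)
  have h4 : ∀ᵐ ω ∂P, ∀ Q ∈ M.famPsi (PsiLU K 0 u), ∀ k, LR {k} n Q Q ω = 1 := by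
    refine (ae_ball_iff hfin).2 fun Q hQ => ae_all_iff.2 fun k => ?_
    have := hpr Q hQ
    refine ae_of_ae_famPsi hac hprod hP hQ (Finset.mem_singleton_self k) hn
      (hm k Q Q (measurableSet_singleton 1)) ?_
    exact LR_self
  have h5 : ∀ᵐ ω ∂P, ∀ Q ∈ M.famPsi (PsiLU K 0 u), ∀ R ∈ M.famPsi (PsiLU K 0 u),
      LR Finset.univ n Q R ω = ∏ k, LR {k} n Q R ω := by
    refine (ae_ball_iff hfin).2 fun Q hQ => (ae_ball_iff hfin).2 fun R hR => ?_
    have := hpr Q hQ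
    have := hpr R hR
    refine ae_of_ae_famPsi hac hprod hP hR (Finset.mem_univ (⟨0, by omega⟩ : Fin K)) hn
      (measurableSet_eq_fun measurable_LR
        (Finset.measurable_fun_prod _ fun k _ => (hm k Q R).mono (hlek k n) le_rfl)) ?_
    exact LR_univ_eq_prod (hind Q hQ) (hind R hR) fun k =>
      restr_ac hac hprod hQ hR (Finset.mem_singleton_self k) hn
  filter_upwards [h1, h2, h3, h4, h5] with ω a b c d e _ using ⟨a, b, c, d, e⟩

end Model

/-! ### Detection and isolation statistics in terms of local statistics. -/

theorem exists_eq_biSup {α : Type*} {S : Set α} (hS : S.Finite) (hne : S.Nonempty)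
    (f : α → ℝ≥0∞) : ∃ a ∈ S, ⨆ b ∈ S, f b = f a := by
  obtain ⟨a, ha, h⟩ := Set.exists_max_image S f hS hne
  exact ⟨a, ha, le_antisymm (iSup₂_le h) (le_iSup₂_of_le a ha le_rfl)⟩

/-- The isolation statistic in terms of local statistics `x`, for a system containing all
sources and at most `u` signals: the numerator. -/
noncomputable def isoNum {K : ℕ} (u : ℕ) (x : Fin K → ℝ≥0∞) (k : Fin K) : ℝ≥0∞ :=
  ⨆ A ∈ {A : Finset (Fin K) | A.card ≤ u ∧ k ∈ A}, ∏ j ∈ A, x j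

/-- The isolation statistic in terms of local statistics: the denominator. -/
noncomputable def isoDen {K : ℕ} (u : ℕ) (x : Fin K → ℝ≥0∞) (k : Fin K) : ℝ≥0∞ :=
  ⨆ A ∈ {A : Finset (Fin K) | A.card ≤ u ∧ A ≠ ∅ ∧ k ∉ A}, ∏ j ∈ A, x j

namespace Model

variable {K : ℕ} {E : Fin K → Type*} [∀ k, MeasurableSpace (E k)] {M : Model E} {u n : ℕ}
  {P Q R R' : Measure (Paths E)} {k : Fin K} {ω : Paths E}

/-- `Regular` speaks of members of 𝒫_Ψ only. The primed versions reach any measure with an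
admissible marginal at `k`, as needed for the suprema in `locStat` and for its reference
distribution. -/
theorem Regular.ne_zero' (h : M.Regular u n ω) (hu : 1 ≤ u) (hprod : M.AllProducts (PsiLU K 0 u))
    (hP : marg k P ∈ M.H k ∪ M.G k) (hQ : marg k Q ∈ M.H k ∪ M.G k) : LR {k} n P Q ω ≠ 0 := by
  obtain ⟨P', hP', eP⟩ := exists_famPsi_marg hu hprod hP
  obtain ⟨Q', hQ', eQ⟩ := exists_famPsi_marg hu hprod hQ
  rw [← LR_congr eP eQ]
  exact h.ne_zero P' hP' Q' hQ' k

theorem Regular.ne_top' (h : M.Regular u n ω) (hu : 1 ≤ u) (hprod : M.AllProducts (PsiLU K 0 u))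
    (hP : marg k P ∈ M.H k ∪ M.G k) (hQ : marg k Q ∈ M.H k ∪ M.G k) : LR {k} n P Q ω ≠ ∞ := by
  obtain ⟨P', hP', eP⟩ := exists_famPsi_marg hu hprod hP
  obtain ⟨Q', hQ', eQ⟩ := exists_famPsi_marg hu hprod hQ
  rw [← LR_congr eP eQ]
  exact h.ne_top P' hP' Q' hQ' k

theorem Regular.chain' (h : M.Regular u n ω) (hu : 1 ≤ u) (hprod : M.AllProducts (PsiLU K 0 u))
    (hP : marg k P ∈ M.H k ∪ M.G k) (hQ : marg k Q ∈ M.H k ∪ M.G k)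
    (hR : marg k R ∈ M.H k ∪ M.G k) :
    LR {k} n P R ω = LR {k} n P Q ω * LR {k} n Q R ω := by
  obtain ⟨P', hP', eP⟩ := exists_famPsi_marg hu hprod hP
  obtain ⟨Q', hQ', eQ⟩ := exists_famPsi_marg hu hprod hQ
  obtain ⟨R', hR', eR⟩ := exists_famPsi_marg hu hprod hR
  rw [← LR_congr eP eR, ← LR_congr eP eQ, ← LR_congr eQ eR]
  exact h.chain P' hP' Q' hQ' R' hR' k

theorem Regular.eq_one (h : M.Regular u n ω) (hP : P ∈ M.famPsi (PsiLU K 0 u))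
    (hQ : marg k Q = marg k P) : LR {k} n P Q ω = 1 := by
  rw [LR_congr rfl hQ]
  exact h.self P hP k

/-- The numerator of the local statistic. -/
noncomputable def supG (M : Model E) (R : Measure (Paths E)) (k : Fin K) (n : ℕ) (ω : Paths E) : ℝ≥0∞ :=
  ⨆ P ∈ {P | P ∈ M.fam ∧ marg k P ∈ M.G k}, LR {k} n P R ω

/-- The denominator of the local statistic. -/
noncomputable def supH (M : Model E) (R : Measure (Paths E)) (k : Fin K) (n : ℕ) (ω : Paths E) : ℝ≥0∞ :=
  ⨆ P ∈ {P | P ∈ M.fam ∧ marg k P ∈ M.H k}, LR {k} n P R ω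

theorem locStat_eq_div : M.locStat R k n ω = M.supG R k n ω / M.supH R k n ω := rfl

theorem le_supG (hP : P ∈ M.fam) (h : marg k P ∈ M.G k) : LR {k} n P R ω ≤ M.supG R k n ω :=
  le_iSup₂_of_le P ⟨hP, h⟩ le_rfl

theorem le_supH (hP : P ∈ M.fam) (h : marg k P ∈ M.H k) : LR {k} n P R ω ≤ M.supH R k n ω :=
  le_iSup₂_of_le P ⟨hP, h⟩ le_rfl

theorem exists_eq_supG (M : Model E) (R : Measure (Paths E)) (k : Fin K) (n : ℕ) (ω : Paths E) :
    ∃ P ∈ M.fam, marg k P ∈ M.G k ∧ M.supG R k n ω = LR {k} n P R ω := by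
  obtain ⟨ν, hν⟩ := M.G_nonempty k
  obtain ⟨P, hP, rfl⟩ := M.G_sub k hν
  obtain ⟨Q, ⟨h1, h2⟩, h3⟩ := exists_eq_biSup
    (S := {P | P ∈ M.fam ∧ marg k P ∈ M.G k}) (M.finite_fam.subset fun _ h => h.1) ⟨P, hP, hν⟩
    fun P => LR {k} n P R ω
  exact ⟨Q, h1, h2, h3⟩

theorem exists_eq_supH (M : Model E) (R : Measure (Paths E)) (k : Fin K) (n : ℕ) (ω : Paths E) :
    ∃ P ∈ M.fam, marg k P ∈ M.H k ∧ M.supH R k n ω = LR {k} n P R ω := by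
  obtain ⟨ν, hν⟩ := M.H_nonempty k
  obtain ⟨P, hP, rfl⟩ := M.H_sub k hν
  obtain ⟨Q, ⟨h1, h2⟩, h3⟩ := exists_eq_biSup
    (S := {P | P ∈ M.fam ∧ marg k P ∈ M.H k}) (M.finite_fam.subset fun _ h => h.1) ⟨P, hP, hν⟩
    fun P => LR {k} n P R ω
  exact ⟨Q, h1, h2, h3⟩

theorem Regular.supG_ne_zero (h : M.Regular u n ω) (hu : 1 ≤ u)
    (hprod : M.AllProducts (PsiLU K 0 u)) (hR : marg k R ∈ M.H k ∪ M.G k) :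
    M.supG R k n ω ≠ 0 := by
  obtain ⟨P, -, h2, h3⟩ := M.exists_eq_supG R k n ω
  rw [h3]; exact h.ne_zero' hu hprod (Or.inr h2) hR

theorem Regular.supG_ne_top (h : M.Regular u n ω) (hu : 1 ≤ u)
    (hprod : M.AllProducts (PsiLU K 0 u)) (hR : marg k R ∈ M.H k ∪ M.G k) :
    M.supG R k n ω ≠ ∞ := by
  obtain ⟨P, -, h2, h3⟩ := M.exists_eq_supG R k n ω
  rw [h3]; exact h.ne_top' hu hprod (Or.inr h2) hR

theorem Regular.supH_ne_zero (h : M.Regular u n ω) (hu : 1 ≤ u)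
    (hprod : M.AllProducts (PsiLU K 0 u)) (hR : marg k R ∈ M.H k ∪ M.G k) :
    M.supH R k n ω ≠ 0 := by
  obtain ⟨P, -, h2, h3⟩ := M.exists_eq_supH R k n ω
  rw [h3]; exact h.ne_zero' hu hprod (Or.inl h2) hR

theorem Regular.supH_ne_top (h : M.Regular u n ω) (hu : 1 ≤ u)
    (hprod : M.AllProducts (PsiLU K 0 u)) (hR : marg k R ∈ M.H k ∪ M.G k) :
    M.supH R k n ω ≠ ∞ := by
  obtain ⟨P, -, h2, h3⟩ := M.exists_eq_supH R k n ω
  rw [h3]; exact h.ne_top' hu hprod (Or.inl h2) hR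

theorem Regular.locStat_ne_zero (h : M.Regular u n ω) (hu : 1 ≤ u)
    (hprod : M.AllProducts (PsiLU K 0 u)) (hR : marg k R ∈ M.H k ∪ M.G k) :
    M.locStat R k n ω ≠ 0 :=
  ENNReal.div_ne_zero.2 ⟨h.supG_ne_zero hu hprod hR, h.supH_ne_top hu hprod hR⟩

theorem Regular.locStat_ne_top (h : M.Regular u n ω) (hu : 1 ≤ u)
    (hprod : M.AllProducts (PsiLU K 0 u)) (hR : marg k R ∈ M.H k ∪ M.G k) :
    M.locStat R k n ω ≠ ∞ :=
  ENNReal.div_ne_top (h.supG_ne_top hu hprod hR) (h.supH_ne_zero hu hprod hR)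

theorem Regular.locStat_mul (h : M.Regular u n ω) (hu : 1 ≤ u)
    (hprod : M.AllProducts (PsiLU K 0 u)) (hR : marg k R ∈ M.H k ∪ M.G k) :
    M.locStat R k n ω * M.supH R k n ω = M.supG R k n ω :=
  ENNReal.div_mul_cancel (h.supH_ne_zero hu hprod hR) (h.supH_ne_top hu hprod hR)

/-- The local statistic does not depend on the reference distribution. -/
theorem Regular.locStat_eq (h : M.Regular u n ω) (hu : 1 ≤ u)
    (hprod : M.AllProducts (PsiLU K 0 u)) (hR : marg k R ∈ M.H k ∪ M.G k)
    (hR' : marg k R' ∈ M.H k ∪ M.G k) : M.locStat R k n ω = M.locStat R' k n ω := by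
  have hG : M.supG R k n ω = M.supG R' k n ω * LR {k} n R' R ω := by
    simp_rw [supG, ENNReal.iSup_mul]
    exact iSup_congr fun P => iSup_congr fun hP => h.chain' hu hprod (Or.inr hP.2) hR' hR
  have hH : M.supH R k n ω = M.supH R' k n ω * LR {k} n R' R ω := by
    simp_rw [supH, ENNReal.iSup_mul]
    exact iSup_congr fun P => iSup_congr fun hP => h.chain' hu hprod (Or.inl hP.2) hR' hR
  rw [locStat_eq_div, locStat_eq_div, hG, hH,
    ENNReal.mul_div_mul_right _ _ (h.ne_zero' hu hprod hR' hR) (h.ne_top' hu hprod hR' hR)]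

/-- The subsystem `{k}` sees only the marginal at `k`, and every alternative at `k` is the marginal
of a distribution whose only signal is `k`; this uses `1 ≤ u`. -/
theorem biSup_GPsi (hu : 1 ≤ u) (hprod : M.AllProducts (PsiLU K 0 u)) :
    ⨆ P ∈ M.GPsi (PsiLU K 0 u) k, LR {k} n P R ω = M.supG R k n ω := by
  apply le_antisymm
  · exact iSup₂_le fun P hP => le_supG hP.1.1 (mem_signals.1 hP.2)
  · refine iSup₂_le fun P hP => ?_
    obtain ⟨P', h1, h2, h3⟩ := exists_signal_marg hu hprod hP.2
    rw [← LR_congr h3 rfl]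
    exact le_iSup₂_of_le P' ⟨h1, by simp [h2]⟩ le_rfl

theorem biSup_H0 (hprod : M.AllProducts (PsiLU K 0 u)) :
    ⨆ P ∈ M.H0, LR {k} n P R ω = M.supH R k n ω := by
  apply le_antisymm
  · refine iSup₂_le fun P hP => le_supH hP.1 ((notMem_signals_iff hP).1 ?_)
    simp [signals_eq_empty hP]
  · refine iSup₂_le fun P hP => ?_
    obtain ⟨P', h1, h3⟩ := exists_H0_marg hprod hP.2
    rw [← LR_congr h3 rfl]
    exact le_iSup₂_of_le P' h1 le_rfl

/-- The global null is excluded from `HPsi`, so a null marginal at `k` must be realized with a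
signal at some other source `j`. This is where a second source is needed. -/
theorem biSup_HPsi (hu : 1 ≤ u) (hprod : M.AllProducts (PsiLU K 0 u)) (hK : 2 ≤ K) :
    ⨆ P ∈ M.HPsi (PsiLU K 0 u) k, LR {k} n P R ω = M.supH R k n ω := by
  apply le_antisymm
  · exact iSup₂_le fun P hP => le_supH hP.1.1.1 ((notMem_signals_iff hP.1.1).1 hP.2)
  · refine iSup₂_le fun P hP => ?_
    have : Nontrivial (Fin K) := Fin.nontrivial_iff_two_le.2 hK
    obtain ⟨j, hj⟩ := exists_ne k
    obtain ⟨ν, hν⟩ := M.G_nonempty j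
    obtain ⟨P₁, h1, h2, -⟩ := exists_signal_marg hu hprod hν
    obtain ⟨P', h3, h4, h5, -⟩ := exists_update_null hprod h1 hP.2
    rw [← LR_congr h5 rfl]
    refine le_iSup₂_of_le P' (mem_HPsi_iff.2 ⟨h3, ?_, ?_⟩) le_rfl
    · refine Finset.ne_empty_of_mem (a := j) ?_
      rw [h4, h2]
      simp [hj]
    · rw [h4]; simp

theorem detStat_eq (hu : 1 ≤ u) (hprod : M.AllProducts (PsiLU K 0 u)) :
    M.detStat (PsiLU K 0 u) {k} R k n ω = M.locStat R k n ω := by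
  rw [detStat, biSup_GPsi hu hprod, biSup_H0 hprod, locStat_eq_div]

theorem isoStat_singleton_eq (hu : 1 ≤ u) (hprod : M.AllProducts (PsiLU K 0 u)) (hK : 2 ≤ K) :
    M.isoStat (PsiLU K 0 u) {k} R k n ω = M.locStat R k n ω := by
  rw [isoStat, biSup_GPsi hu hprod, biSup_HPsi hu hprod hK, locStat_eq_div]

/-- With one source, a non-null distribution has that source as its signal, so the denominator is a
supremum over the empty set, while the numerator is positive. -/
theorem Regular.isoStat_eq_top (h : M.Regular u n ω) (hu : 1 ≤ u)
    (hprod : M.AllProducts (PsiLU K 0 u)) (hK : K = 1) (hR : marg k R ∈ M.H k ∪ M.G k) :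
    M.isoStat (PsiLU K 0 u) {k} R k n ω = ∞ := by
  have hempty : ∀ P, P ∉ M.HPsi (PsiLU K 0 u) k := by
    intro P hP
    obtain ⟨-, h2, h3⟩ := mem_HPsi_iff.1 hP
    obtain ⟨j, hj⟩ := Finset.nonempty_iff_ne_empty.2 h2
    subst hK
    exact h3 (Subsingleton.elim j k ▸ hj)
  rw [isoStat, biSup_GPsi hu hprod]
  simp only [hempty, not_false_eq_true, iSup_neg, bot_eq_zero, ENNReal.iSup_zero]
  exact ENNReal.div_zero (h.supG_ne_zero hu hprod hR)

/-- For a fixed signal set `A` the product of local ratios is maximized source by source: `supG` on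
`A`, `supH` off `A`. Extracting `supH` at all sources leaves the local statistics on `A`; the
extracted factor does not depend on `A` and cancels in the isolation statistic. -/
theorem Regular.biSup_LR_univ (h : M.Regular u n ω) (hu : 1 ≤ u)
    (hprod : M.AllProducts (PsiLU K 0 u)) (hR : R ∈ M.famPsi (PsiLU K 0 u))
    (𝒜 : Set (Finset (Fin K))) :
    ⨆ P ∈ {P | P ∈ M.famPsi (PsiLU K 0 u) ∧ M.signals P ∈ 𝒜}, LR Finset.univ n P R ω =
      (⨆ A ∈ {A : Finset (Fin K) | A.card ≤ u ∧ A ∈ 𝒜}, ∏ j ∈ A, M.locStat R j n ω) *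
        ∏ j, M.supH R j n ω := by
  have hterm : ∀ A : Finset (Fin K), (∏ j ∈ A, M.locStat R j n ω) * ∏ j, M.supH R j n ω =
      ∏ j, if j ∈ A then M.supG R j n ω else M.supH R j n ω := by
    intro A
    have : ∏ j ∈ A, M.locStat R j n ω = ∏ j, if j ∈ A then M.locStat R j n ω else 1 := by
      rw [Finset.prod_ite_mem, Finset.univ_inter]
    rw [this, ← Finset.prod_mul_distrib]
    refine Finset.prod_congr rfl fun j _ => ?_
    split_ifs
    · exact h.locStat_mul hu hprod (hR.2.1 j)
    · exact one_mul _
  simp_rw [ENNReal.iSup_mul, hterm]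
  apply le_antisymm
  · refine iSup₂_le fun P hP => ?_
    refine le_iSup₂_of_le (M.signals P) ⟨card_signals_le hP.1, hP.2⟩ ?_
    rw [h.prod P hP.1 R hR]
    refine Finset.prod_le_prod' fun j _ => ?_
    split_ifs with hj
    · exact le_supG hP.1.1 (mem_signals.1 hj)
    · exact le_supH hP.1.1 ((notMem_signals_iff hP.1).1 hj)
  · refine iSup₂_le fun A hA => ?_
    choose g hg1 hg2 hg3 using fun j => M.exists_eq_supG R j n ω
    choose f hf1 hf2 hf3 using fun j => M.exists_eq_supH R j n ω
    obtain ⟨P, h1, h2, h3⟩ := exists_mem_famPsi' hprod hA.1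
      (p := fun j => if j ∈ A then g j else f j)
      (fun j hj => by rw [if_pos hj]; exact hg2 j) (fun j hj => by rw [if_neg hj]; exact hf2 j)
    refine le_iSup₂_of_le P ⟨h1, h2 ▸ hA.2⟩ ?_
    rw [h.prod P h1 R hR]
    refine Finset.prod_le_prod' fun j _ => ?_
    rw [LR_congr (h3 j) rfl]
    split_ifs with hj
    · rw [hg3]
    · rw [hf3]

theorem Regular.isoStat_univ_eq (h : M.Regular u n ω) (hu : 1 ≤ u)
    (hprod : M.AllProducts (PsiLU K 0 u)) (hR : R ∈ M.famPsi (PsiLU K 0 u)) :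
    M.isoStat (PsiLU K 0 u) Finset.univ R k n ω =
      isoNum u (fun j => M.locStat R j n ω) k / isoDen u (fun j => M.locStat R j n ω) k := by
  have hG : M.GPsi (PsiLU K 0 u) k =
      {P | P ∈ M.famPsi (PsiLU K 0 u) ∧ M.signals P ∈ {A : Finset (Fin K) | k ∈ A}} := rfl
  have hH : M.HPsi (PsiLU K 0 u) k =
      {P | P ∈ M.famPsi (PsiLU K 0 u) ∧ M.signals P ∈ {A : Finset (Fin K) | A ≠ ∅ ∧ k ∉ A}} :=
    Set.ext fun P => mem_HPsi_iff
  rw [isoStat, hG, hH, h.biSup_LR_univ hu hprod hR, h.biSup_LR_univ hu hprod hR]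
  exact ENNReal.mul_div_mul_right _ _
    (Finset.prod_ne_zero_iff.2 fun j _ => h.supH_ne_zero hu hprod (hR.2.1 j))
    (ENNReal.prod_ne_top fun j _ => h.supH_ne_top hu hprod (hR.2.1 j))

end Model

/-! ### Maximal products over admissible signal sets. -/

section Combinatorics

variable {K u : ℕ} {x : Fin K → ℝ≥0∞} {S A : Finset (Fin K)} {k : Fin K}

/-- Exchange argument: the factors over `A ∩ S` are common, and `c` separates those of `A \ S` from
those of `S \ A`. As `c ≥ 1`, having more factors only helps `S`; for `c = 1` their number is
irrelevant. -/
theorem prod_le_prod_of_dominates {c : ℝ≥0∞} (hc : 1 ≤ c) (hS : ∀ j ∈ S, c ≤ x j)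
    (hA : ∀ j ∈ A, j ∉ S → x j ≤ c) (hcard : A.card ≤ S.card ∨ c = 1) :
    ∏ j ∈ A, x j ≤ ∏ j ∈ S, x j := by
  rw [← Finset.prod_inter_mul_prod_sdiff A S, ← Finset.prod_inter_mul_prod_sdiff S A,
    Finset.inter_comm S A]
  refine mul_le_mul_right ?_ _
  calc ∏ j ∈ A \ S, x j ≤ c ^ (A \ S).card :=
        Finset.prod_le_pow_card _ _ _ fun j hj =>
          hA j (Finset.mem_sdiff.1 hj).1 (Finset.mem_sdiff.1 hj).2
    _ ≤ c ^ (S \ A).card := by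
        rcases hcard with h | rfl
        · refine pow_le_pow_right₀ hc ?_
          have h1 := Finset.card_sdiff_add_card_inter A S
          have h2 := Finset.card_sdiff_add_card_inter S A
          rw [Finset.inter_comm] at h2
          omega
        · simp
    _ ≤ ∏ j ∈ S \ A, x j :=
        Finset.pow_card_le_prod _ _ _ fun j hj => hS j (Finset.mem_sdiff.1 hj).1

theorem isoNum_eq (hS : S.card ≤ u) (hk : k ∈ S)
    (h : ∀ A : Finset (Fin K), A.card ≤ u → k ∈ A → ∏ j ∈ A, x j ≤ ∏ j ∈ S, x j) :
    isoNum u x k = ∏ j ∈ S, x j :=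
  le_antisymm (iSup₂_le fun A hA => h A hA.1 hA.2) (le_iSup₂_of_le S ⟨hS, hk⟩ le_rfl)

theorem isoDen_eq (hS : S.card ≤ u) (hne : S.Nonempty) (hk : k ∉ S)
    (h : ∀ A : Finset (Fin K), A.card ≤ u → A.Nonempty → k ∉ A →
      ∏ j ∈ A, x j ≤ ∏ j ∈ S, x j) :
    isoDen u x k = ∏ j ∈ S, x j :=
  le_antisymm (iSup₂_le fun A hA => h A hA.1 (Finset.nonempty_iff_ne_empty.2 hA.2.1) hA.2.2)
    (le_iSup₂_of_le S ⟨hS, hne.ne_empty, hk⟩ le_rfl)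

/-- The isolation statistic in terms of the local statistics. -/
noncomputable def isoRatio (u : ℕ) (x : Fin K → ℝ≥0∞) (k : Fin K) : ℝ≥0∞ :=
  isoNum u x k / isoDen u x k

theorem mul_prod_div_prod (h0 : ∀ j, x j ≠ 0) (ht : ∀ j, x j ≠ ∞) (a b : ℝ≥0∞)
    (S : Finset (Fin K)) : (a * ∏ j ∈ S, x j) / (b * ∏ j ∈ S, x j) = a / b :=
  ENNReal.mul_div_mul_right _ _ (Finset.prod_ne_zero_iff.2 fun j _ => h0 j)
    (ENNReal.prod_ne_top fun j _ => ht j)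

/-- The set `S` is optimal in two ways: it is cut out by the level `1`, or it holds the `u` largest
values at a level `c ≥ 1`. The factor `x k` is split off for later cancellation. -/
theorem isoNum_of_mem (hS : S.card ≤ u) (hk : k ∈ S) {c : ℝ≥0∞} (hc : 1 ≤ c)
    (hin : ∀ j ∈ S, c ≤ x j) (hout : ∀ j ∉ S, x j ≤ c) (hcard : u ≤ S.card ∨ c = 1) :
    isoNum u x k = x k * ∏ j ∈ S.erase k, x j := by
  rw [Finset.mul_prod_erase S x hk]
  exact isoNum_eq hS hk fun _ hA _ => prod_le_prod_of_dominates hc hin (fun j _ => hout j)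
    (hcard.imp_left fun h => hA.trans h)

theorem isoDen_of_notMem (hS : S.card ≤ u) (hne : S.Nonempty) (hk : k ∉ S) {c : ℝ≥0∞}
    (hc : 1 ≤ c) (hin : ∀ j ∈ S, c ≤ x j) (hout : ∀ j ∉ S, x j ≤ c)
    (hcard : u ≤ S.card ∨ c = 1) : isoDen u x k = ∏ j ∈ S, x j :=
  isoDen_eq hS hne hk fun _ hA _ _ => prod_le_prod_of_dominates hc hin (fun j _ => hout j)
    (hcard.imp_left fun h => hA.trans h)

/-- The best set with `k` is `S` and the best one without is `S.erase k`. The denominator admits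
only nonempty sets, hence the bound `2 ≤ S.card`. -/
theorem isoRatio_of_mem (h0 : ∀ j, x j ≠ 0) (ht : ∀ j, x j ≠ ∞) (hS : S.card ≤ u)
    (hS2 : 2 ≤ S.card) (hk : k ∈ S) (hin : ∀ j ∈ S, 1 ≤ x j) (hout : ∀ j ∉ S, x j ≤ 1) :
    isoRatio u x k = x k := by
  have hD : isoDen u x k = 1 * ∏ j ∈ S.erase k, x j := by
    rw [one_mul]
    refine isoDen_eq ((Finset.card_le_card (Finset.erase_subset _ _)).trans hS) ?_
      (Finset.notMem_erase _ _) fun A _ _ hkA => ?_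
    · rw [← Finset.card_pos, Finset.card_erase_of_mem hk]; omega
    · refine prod_le_prod_of_dominates le_rfl (fun j hj => hin j (Finset.mem_of_mem_erase hj))
        (fun j hj hjS => hout j fun h => hjS (Finset.mem_erase.2 ⟨?_, h⟩)) (Or.inr rfl)
      rintro rfl
      exact hkA hj
  rw [isoRatio, isoNum_of_mem hS hk le_rfl hin hout (Or.inr rfl), hD, mul_prod_div_prod h0 ht,
    div_one]

/-- As `S` has fewer than `u` elements, there is room to add `k` without giving anything up. -/
theorem isoRatio_of_notMem (h0 : ∀ j, x j ≠ 0) (ht : ∀ j, x j ≠ ∞) (hS : S.card < u)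
    (hne : S.Nonempty) (hk : k ∉ S) (hin : ∀ j ∈ S, 1 ≤ x j) (hout : ∀ j ∉ S, x j ≤ 1) :
    isoRatio u x k = x k := by
  have hN : isoNum u x k = x k * ∏ j ∈ S, x j := by
    rw [← Finset.prod_insert hk]
    refine isoNum_eq (by rw [Finset.card_insert_of_notMem hk]; omega)
      (Finset.mem_insert_self _ _) fun A _ hkA => ?_
    rw [← Finset.mul_prod_erase A x hkA, Finset.prod_insert hk]
    exact mul_le_mul_right (prod_le_prod_of_dominates le_rfl hin (fun j _ => hout j)
      (Or.inr rfl)) _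
  rw [isoRatio, hN, isoDen_of_notMem hS.le hne hk le_rfl hin hout (Or.inr rfl),
    ← one_mul (∏ j ∈ S, x j), ← mul_assoc, mul_one, mul_prod_div_prod h0 ht, div_one]

/-- Dropping `m` would leave the empty set, which the denominator forbids. All other values are at
most `1`, so the best replacement is the single runner-up `t`. -/
theorem isoRatio_of_singleton {m t : Fin K} (hu : 1 ≤ u) (htm : t ≠ m)
    (hm : 1 ≤ x m) (hout : ∀ j, j ≠ m → x j ≤ 1) (hmax : ∀ j, j ≠ m → x j ≤ x t) :
    isoRatio u x m = x m / x t := by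
  have hN : isoNum u x m = x m := by
    rw [isoNum_of_mem (S := {m}) (by simpa using hu) (by simp) le_rfl (by simpa using hm)
      (by simpa using hout) (Or.inr rfl)]
    simp
  have hD : isoDen u x m = x t := by
    rw [isoDen_eq (S := {t}) (by simpa using hu) (by simp) (by simpa using htm.symm),
      Finset.prod_singleton]
    intro A _ ⟨a, ha⟩ hmA
    have hA : ∀ j ∈ A, j ≠ m := fun j hj h => hmA (h ▸ hj)
    rw [Finset.prod_singleton, ← Finset.mul_prod_erase A x ha]
    exact (mul_le_of_le_one_right' (Finset.prod_le_one' fun j hj =>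
      hout j (hA j (Finset.mem_of_mem_erase hj)))).trans (hmax a (hA a ha))
  rw [isoRatio, hN, hD]

/-- The set `S` is full: `k` can enter only in place of an element, and the cheapest one to lose is
the smallest, `m`. -/
theorem isoRatio_of_notMem_of_card_eq (h0 : ∀ j, x j ≠ 0) (ht : ∀ j, x j ≠ ∞)
    (hS : S.card = u) {m : Fin K} (hm : m ∈ S) (hm1 : 1 ≤ x m) (hk : k ∉ S)
    (hin : ∀ j ∈ S, x m ≤ x j) (hout : ∀ j ∉ S, x j ≤ x m) :
    isoRatio u x k = x k / x m := by
  have hpos : 0 < S.card := Finset.card_pos.2 ⟨m, hm⟩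
  have hkm : k ∉ S.erase m := fun h => hk (Finset.mem_of_mem_erase h)
  have hce := Finset.card_erase_of_mem hm
  have hN : isoNum u x k = x k * ∏ j ∈ S.erase m, x j := by
    rw [← Finset.prod_insert hkm]
    refine isoNum_eq (by rw [Finset.card_insert_of_notMem hkm]; omega)
      (Finset.mem_insert_self _ _) fun A hA hkA => ?_
    rw [← Finset.mul_prod_erase A x hkA, Finset.prod_insert hkm]
    refine mul_le_mul_right (prod_le_prod_of_dominates hm1
      (fun j hj => hin j (Finset.mem_of_mem_erase hj)) (fun j _ hj => ?_) (Or.inl ?_)) _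
    · by_cases h : j = m
      · rw [h]
      · exact hout j fun h' => hj (Finset.mem_erase.2 ⟨h, h'⟩)
    · rw [hce, Finset.card_erase_of_mem hkA]; omega
  rw [isoRatio, hN, isoDen_of_notMem hS.le ⟨m, hm⟩ hk hm1 hin hout (Or.inl hS.ge),
    ← Finset.mul_prod_erase S x hm, mul_prod_div_prod h0 ht]

/-- Removing `k` from the full set frees a place, which is best given to the largest outside value
`x t`; this does not hurt because `1 ≤ x t`. -/
theorem isoRatio_of_mem_of_card_eq (h0 : ∀ j, x j ≠ 0) (ht : ∀ j, x j ≠ ∞)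
    (hS : S.card = u) {t : Fin K} (htS : t ∉ S) (ht1 : 1 ≤ x t) (hk : k ∈ S)
    (hin : ∀ j ∈ S, x t ≤ x j) (hout : ∀ j ∉ S, x j ≤ x t) :
    isoRatio u x k = x k / x t := by
  have hpos : 0 < S.card := Finset.card_pos.2 ⟨k, hk⟩
  have htk : t ∉ S.erase k := fun h => htS (Finset.mem_of_mem_erase h)
  have hce := Finset.card_erase_of_mem hk
  have hci := Finset.card_insert_of_notMem htk
  have hD : isoDen u x k = x t * ∏ j ∈ S.erase k, x j := by
    rw [← Finset.prod_insert htk]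
    refine isoDen_eq (by omega) ⟨t, Finset.mem_insert_self _ _⟩ ?_ fun A hA _ hkA => ?_
    · rw [Finset.mem_insert, not_or]
      exact ⟨fun h => htS (h ▸ hk), Finset.notMem_erase _ _⟩
    · refine prod_le_prod_of_dominates ht1 (fun j hj => ?_) (fun j hj hjS => hout j fun h => ?_)
        (Or.inl (by omega))
      · rcases Finset.mem_insert.1 hj with rfl | hj
        · exact le_rfl
        · exact hin j (Finset.mem_of_mem_erase hj)
      · refine hjS (Finset.mem_insert_of_mem (Finset.mem_erase.2 ⟨?_, h⟩))
        rintro rfl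
        exact hkA hj
  rw [isoRatio, isoNum_of_mem hS.le hk ht1 hin hout (Or.inl hS.ge), hD, mul_prod_div_prod h0 ht]

theorem isoRatio_one {t : Fin K} (htk : t ≠ k) (hmax : ∀ j, j ≠ k → x j ≤ x t) :
    isoRatio 1 x k = x k / x t := by
  have hN : isoNum 1 x k = x k := by
    rw [isoNum_eq (S := {k}) (by simp) (by simp), Finset.prod_singleton]
    intro A hA hkA
    rw [Finset.eq_of_subset_of_card_le (Finset.singleton_subset_iff.2 hkA) (by simpa using hA)]
  have hD : isoDen 1 x k = x t := by
    rw [isoDen_eq (S := {t}) (by simp) (by simp) (by simpa using htk.symm), Finset.prod_singleton]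
    intro A hA ⟨a, ha⟩ hkA
    rw [← Finset.eq_of_subset_of_card_le (Finset.singleton_subset_iff.2 ha) (by simpa using hA),
      Finset.prod_singleton, Finset.prod_singleton]
    exact hmax a fun h => hkA (h ▸ ha)
  rw [isoRatio, hN, hD]

open Classical in
-- Since `a < 1 < b`, avoiding the interval pushes each ratio beyond the threshold on its own side
-- of `1`; a ratio equal to `1` is ruled out. The selected set is then `S`, which is an admissible
-- nonempty decision.
theorem joint_iff {r : Fin K → ℝ≥0∞} {a b : ℝ≥0∞} (ha : a < 1) (hb : 1 < b)
    (hne : S.Nonempty) (hS : S.card ≤ u) (hin : ∀ k ∈ S, 1 ≤ r k) (hout : ∀ k ∉ S, r k ≤ 1) :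
    ((∀ k, r k ∉ Set.Ioo a b) ∧ Finset.univ.filter (fun k => 1 < r k) ∈ PsiLU K 0 u \ {∅}) ↔
      (∀ k ∈ S, b ≤ r k) ∧ ∀ k ∉ S, r k ≤ a := by
  constructor
  · rintro ⟨h, -⟩
    refine ⟨fun k hk => ?_, fun k hk => ?_⟩
    · by_contra hlt
      exact h k ⟨ha.trans_le (hin k hk), not_le.1 hlt⟩
    · by_contra hlt
      exact h k ⟨not_le.1 hlt, (hout k hk).trans_lt hb⟩
  · rintro ⟨h1, h2⟩
    have hSf : Finset.univ.filter (fun k => 1 < r k) = S := by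
      ext k
      rw [Finset.mem_filter]
      refine ⟨fun h => ?_, fun h => ⟨Finset.mem_univ k, hb.trans_le (h1 k h)⟩⟩
      by_contra hk
      exact absurd h.2 (not_lt.2 (hout k hk))
    rw [hSf]
    refine ⟨fun k hk => ?_, ⟨Nat.zero_le _, hS⟩, hne.ne_empty⟩
    by_cases hkS : k ∈ S
    · exact absurd hk.2 (not_lt.2 (h1 k hkS))
    · exact absurd hk.1 (not_lt.2 (h2 k hkS))

theorem exists_perm_antitone (x : Fin K → ℝ≥0∞) :
    ∃ σ : Equiv.Perm (Fin K), Antitone fun i => x (σ i) :=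
  ⟨Tuple.sort (OrderDual.toDual ∘ x), fun _ _ h =>
    Tuple.monotone_sort (OrderDual.toDual ∘ x) h⟩

open Classical in
theorem lt_card_filter_iff {σ : Equiv.Perm (Fin K)} (hσ : Antitone fun i => x (σ i))
    (j : Fin K) : (j : ℕ) < (Finset.univ.filter fun k => 1 < x k).card ↔ 1 < x (σ j) := by
  constructor
  · intro h
    by_contra hj
    have hsub : Finset.univ.filter (fun k => 1 < x k) ⊆ (Finset.Iio j).map σ.toEmbedding := by
      intro k hk
      rw [Finset.mem_map]
      refine ⟨σ.symm k, Finset.mem_Iio.2 ?_, by simp⟩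
      by_contra hlt
      have := hσ (not_lt.1 hlt)
      simp only [Equiv.apply_symm_apply] at this
      exact hj ((Finset.mem_filter.1 hk).2.trans_le this)
    have := Finset.card_le_card hsub
    rw [Finset.card_map, Fin.card_Iio] at this
    omega
  · intro h
    have hsub : (Finset.Iic j).map σ.toEmbedding ⊆ Finset.univ.filter (fun k => 1 < x k) := by
      intro k hk
      obtain ⟨i, hi, rfl⟩ := Finset.mem_map.1 hk
      exact Finset.mem_filter.2 ⟨Finset.mem_univ _, h.trans_le (hσ (Finset.mem_Iic.1 hi))⟩
    have := Finset.card_le_card hsub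
    rw [Finset.card_map, Fin.card_Iic] at this
    omega

end Combinatorics

/-! ### The stopping condition in terms of ordered statistics. -/

section Combinatorics

variable {K u : ℕ} {x : Fin K → ℝ≥0∞}

theorem div_le_inv_iff {y z α : ℝ≥0∞} (hz : z ≠ 0) (hz' : z ≠ ∞) (hα : α ≠ 0) (hα' : α ≠ ∞) :
    y / z ≤ α⁻¹ ↔ α * y ≤ z := by
  rw [ENNReal.div_le_iff hz hz', mul_comm, ← div_eq_mul_inv,
    ENNReal.le_div_iff_mul_le (Or.inl hα) (Or.inl hα'), mul_comm]

open Classical in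
/-- The stopping rule in terms of the ordered local statistics. -/
theorem stop_iff (hu : 1 ≤ u) (huK : u < K) (h0 : ∀ j, x j ≠ 0) (ht : ∀ j, x j ≠ ∞)
    {α b : ℝ≥0∞} (hα : 1 < α) (hα' : α ≠ ∞) (hb : 1 < b) (hb' : b ≠ ∞) :
    ((∀ k, x k ≤ α⁻¹) ∨ (∃ k, b ≤ x k) ∧ (∀ k, isoRatio u x k ∉ Set.Ioo α⁻¹ b) ∧
        Finset.univ.filter (fun k => 1 < isoRatio u x k) ∈ PsiLU K 0 u \ {∅}) ↔
      ((((ordStat 1 x ≤ α⁻¹ ∨ b ≤ ordStat 1 x ∧ ordStat 2 x ≤ min α⁻¹ (ordStat 1 x / b)) ∨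
        (1 < (Finset.univ.filter fun k => 1 < x k).card ∧
          (Finset.univ.filter fun k => 1 < x k).card < u) ∧ b ≤ ordStat 1 x ∧
          ∀ k, x k ∉ Set.Ioo α⁻¹ b) ∨
        (Finset.univ.filter fun k => 1 < x k).card = u ∧
          max b (α * ordStat (u + 1) x) ≤ ordStat u x) ∨
        u < (Finset.univ.filter fun k => 1 < x k).card ∧ b ≤ ordStat 1 x ∧
          ordStat (u + 1) x * max α b ≤ ordStat u x) := by
  obtain ⟨σ, hσ⟩ := exists_perm_antitone x
  have ho1 : ordStat 1 x = x (σ ⟨0, by omega⟩) := ordStat_eq_of_antitone x σ hσ ⟨0, by omega⟩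
  have ho2 : ordStat 2 x = x (σ ⟨1, by omega⟩) := ordStat_eq_of_antitone x σ hσ ⟨1, by omega⟩
  have hou : ordStat u x = x (σ ⟨u - 1, by omega⟩) := by
    have := ordStat_eq_of_antitone x σ hσ ⟨u - 1, by omega⟩
    rwa [show (u - 1 : ℕ) + 1 = u by omega] at this
  have hou1 : ordStat (u + 1) x = x (σ ⟨u, huK⟩) := ordStat_eq_of_antitone x σ hσ ⟨u, huK⟩
  have hp0 := lt_card_filter_iff hσ ⟨0, by omega⟩
  have hp1 := lt_card_filter_iff hσ ⟨1, by omega⟩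
  have hpu := lt_card_filter_iff hσ ⟨u - 1, by omega⟩
  have hpu1 := lt_card_filter_iff hσ ⟨u, huK⟩
  set S₀ := Finset.univ.filter fun k => 1 < x k with hS₀
  set i0 : Fin K := ⟨0, by omega⟩
  set i1 : Fin K := ⟨1, by omega⟩
  set iu : Fin K := ⟨u - 1, by omega⟩
  set iv : Fin K := ⟨u, huK⟩
  rw [ho1, ho2, hou, hou1]
  have hle : ∀ (k : Fin K) (j : Fin K), j ≤ σ.symm k → x k ≤ x (σ j) := fun k j h => by
    simpa using hσ h
  have hge : ∀ (k : Fin K) (j : Fin K), σ.symm k ≤ j → x (σ j) ≤ x k := fun k j h => by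
    simpa using hσ h
  have hmax : ∀ k, x k ≤ x (σ i0) := fun k => hle k i0 (Nat.zero_le _)
  have h1max : ∀ k, k ≠ σ i0 → x k ≤ x (σ i1) := fun k hk => hle k i1 <| by
    have : (σ.symm k : ℕ) ≠ 0 := fun h => hk (by
      rw [← Equiv.symm_apply_eq]; exact Fin.ext h)
    exact Nat.one_le_iff_ne_zero.2 this
  have hinv : α⁻¹ < 1 := ENNReal.inv_lt_one.2 hα
  have hα0 : α ≠ 0 := (zero_lt_one.trans hα).ne'
  have hb0 : b ≠ 0 := (zero_lt_one.trans hb).ne'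
  have e1 : (∀ k, x k ≤ α⁻¹) ↔ x (σ i0) ≤ α⁻¹ := ⟨fun h => h _, fun h k => (hmax k).trans h⟩
  have e2 : (∃ k, b ≤ x k) ↔ b ≤ x (σ i0) := ⟨fun ⟨k, h⟩ => h.trans (hmax k), fun h => ⟨_, h⟩⟩
  rw [e1, e2]
  by_cases c1 : x (σ i0) ≤ α⁻¹
  · simp [c1]
  by_cases c2 : b ≤ x (σ i0)
  swap
  -- No local statistic reaches `b`, so the joint condition fails. The rule with exactly `u`
  -- positive statistics fails too, as it asks the `u`-th largest to reach `b`.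
  · have : ¬ b ≤ x (σ iu) := fun h => c2 (h.trans (hmax _))
    simp [c1, c2, this]
  simp only [c1, c2, false_or, true_and]
  have hx0 : 1 < x (σ i0) := hb.trans_le c2
  have hr1 : ∀ y z, z ≠ 0 → z ≠ ∞ → (b ≤ y / z ↔ b * z ≤ y) := fun y z hz hz' =>
    ENNReal.le_div_iff_mul_le (Or.inl hz) (Or.inl hz')
  have hr2 : ∀ y z, z ≠ 0 → z ≠ ∞ → (y / z ≤ α⁻¹ ↔ α * y ≤ z) := fun y z hz hz' =>
    div_le_inv_iff hz hz' hα0 hα'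
  have hd1 : ∀ y z : ℝ≥0∞, z ≠ 0 → z ≠ ∞ → z ≤ y → 1 ≤ y / z := fun y z hz hz' h =>
    (ENNReal.le_div_iff_mul_le (Or.inl hz) (Or.inl hz')).2 (by rwa [one_mul])
  have hd2 : ∀ y z : ℝ≥0∞, z ≠ 0 → z ≠ ∞ → y ≤ z → y / z ≤ 1 := fun y z hz hz' h =>
    (ENNReal.div_le_iff hz hz').2 (by rwa [one_mul])
  have hin : ∀ j ∈ S₀, 1 < x j := fun j hj => (Finset.mem_filter.1 hj).2
  have hout : ∀ j ∉ S₀, x j ≤ 1 := fun j hj =>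
    not_lt.1 fun h => hj (Finset.mem_filter.2 ⟨Finset.mem_univ j, h⟩)
  -- the set of the `u` largest local statistics
  set S := (Finset.Iio iv).map σ.toEmbedding with hSdef
  have hScard : S.card = u := by rw [hSdef, Finset.card_map, Fin.card_Iio]
  have hmemS : ∀ k, k ∈ S ↔ σ.symm k < iv := fun k => by
    rw [hSdef, Finset.mem_map]
    refine ⟨?_, fun h => ⟨σ.symm k, Finset.mem_Iio.2 h, by simp⟩⟩
    rintro ⟨i, hi, rfl⟩
    simpa using hi
  have hSin : ∀ j ∈ S, x (σ iu) ≤ x j := fun j hj => hge j iu <| by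
    have h : (σ.symm j : ℕ) < u := (hmemS j).1 hj
    exact Nat.le_sub_one_of_lt h
  have hSout : ∀ j ∉ S, x j ≤ x (σ iv) := fun j hj => hle j iv (not_lt.1 (mt (hmemS j).2 hj))
  have hdw : x (σ iv) ≤ x (σ iu) := hσ (show u - 1 ≤ u by omega)
  have huS : σ iu ∈ S := (hmemS _).2 (by rw [Equiv.symm_apply_apply]; exact Nat.sub_one_lt (by omega))
  have hvS : σ iv ∉ S := fun h => by
    have := (hmemS _).1 h; rw [Equiv.symm_apply_apply] at this; exact lt_irrefl _ this
  -- the case of explicit ratios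
  have ratio_case : (∀ k ∈ S, isoRatio u x k = x k / x (σ iv)) →
      (∀ k ∉ S, isoRatio u x k = x k / x (σ iu)) →
      ((∀ k, isoRatio u x k ∉ Set.Ioo α⁻¹ b) ∧
        Finset.univ.filter (fun k => 1 < isoRatio u x k) ∈ PsiLU K 0 u \ {∅} ↔
        x (σ iv) * max α b ≤ x (σ iu)) := by
    intro H1 H2
    rw [joint_iff hinv hb ⟨_, huS⟩ hScard.le
      (fun k hk => by rw [H1 k hk]; exact hd1 _ _ (h0 _) (ht _) (hdw.trans (hSin k hk)))
      (fun k hk => by rw [H2 k hk]; exact hd2 _ _ (h0 _) (ht _) ((hSout k hk).trans hdw))]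
    constructor
    -- The binding constraints sit at the two sides of the gap: `σ iu` contributes the factor `b`
    -- and `σ iv` the factor `α`.
    · rintro ⟨g1, g2⟩
      have g1 := g1 _ huS
      have g2 := g2 _ hvS
      rw [H1 _ huS, hr1 _ _ (h0 _) (ht _)] at g1
      rw [H2 _ hvS, hr2 _ _ (h0 _) (ht _)] at g2
      rw [mul_comm]
      rcases max_choice α b with h | h <;> rw [h] <;> assumption
    · intro g
      refine ⟨fun k hk => ?_, fun k hk => ?_⟩
      · rw [H1 k hk, hr1 _ _ (h0 _) (ht _), mul_comm]
        exact (mul_le_mul_right (le_max_right α b) _).trans (g.trans (hSin k hk))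
      · rw [H2 k hk, hr2 _ _ (h0 _) (ht _), mul_comm]
        exact (mul_le_mul' (hSout k hk) (le_max_left α b)).trans g
  have h0p : 0 < S₀.card := hp0.2 hx0
  -- Once the largest statistic reaches `b`, the minimum in `T_1` is its first entry.
  have hinvb : α⁻¹ ≤ x (σ i0) / b := hinv.le.trans (hd1 _ _ hb0 hb' c2)
  rcases Nat.lt_or_ge u S₀.card with hcu | hcu
  · -- more than `u` positive local statistics
    have hw1 : 1 < x (σ iv) := hpu1.1 hcu
    have hx1 : 1 < x (σ i1) := hw1.trans_le (hσ (show 1 ≤ u from hu))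
    rw [ratio_case
      (fun k hk => isoRatio_of_mem_of_card_eq h0 ht hScard hvS hw1.le hk
        (fun j hj => hdw.trans (hSin j hj)) hSout)
      (fun k hk => isoRatio_of_notMem_of_card_eq h0 ht hScard huS (hw1.le.trans hdw) hk hSin
        fun j hj => (hSout j hj).trans hdw)]
    have n1 : ¬ x (σ i1) ≤ min α⁻¹ (x (σ i0) / b) := fun h =>
      absurd (h.trans (min_le_left _ _)) (not_le.2 (hinv.trans hx1))
    have n2 : ¬ S₀.card < u := by omega
    have n3 : S₀.card ≠ u := by omega
    simp only [n1, n2, n3, hcu, false_and, and_false, false_or, true_and]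
  by_cases hu1 : u = 1
  · -- at most one signal
    subst hu1
    have hcard : S₀.card = 1 := by omega
    have hx1 : x (σ i1) ≤ 1 := not_lt.1 fun h => by
      have h1 : 1 < S₀.card := hp1.2 h
      omega
    have e01 : iu = i0 := rfl
    have e11 : iv = i1 := rfl
    have hSsing : ∀ k, k ∈ S ↔ k = σ i0 := fun k => by
      rw [hmemS, ← Equiv.symm_apply_eq]
      refine ⟨fun h => Fin.ext (Nat.lt_one_iff.1 h), fun h => ?_⟩
      rw [h]; exact Nat.zero_lt_one
    have hne : σ i1 ≠ σ i0 := fun h => by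
      have := σ.injective h
      exact absurd (congrArg Fin.val this) Nat.one_ne_zero
    rw [ratio_case
      (fun k hk => by
        obtain rfl := (hSsing k).1 hk
        exact isoRatio_one hne h1max)
      (fun k hk => isoRatio_one (fun h => hk ((hSsing k).2 h.symm)) fun j _ => hmax j)]
    simp only [hcard, false_and, or_false, true_and, lt_irrefl, e01, e11]
    -- Both `T_1` and `T_3` are available here, and `T_1` implies `T_3`. The requirement with factor
    -- `b` is free, because the runner-up is at most `1`.
    constructor
    · intro h
      right
      refine max_le c2 ?_
      rw [mul_comm]
      exact (mul_le_mul_right (le_max_left _ _) _).trans h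
    · intro h
      have hα1 : α * x (σ i1) ≤ x (σ i0) := by
        rcases h with h | h
        · refine (mul_le_mul_right (h.trans (min_le_left _ _)) α).trans ?_
          rw [ENNReal.mul_inv_cancel hα0 hα']
          exact hx0.le
        · exact (le_max_right _ _).trans h
      rcases max_choice α b with h | h <;> rw [h]
      · rwa [mul_comm]
      · exact (mul_le_of_le_one_left' hx1).trans c2
  have n4 : ¬ u < S₀.card := by omega
  by_cases hp : S₀.card = 1
  · -- one positive local statistic
    have hx1 : x (σ i1) ≤ 1 := not_lt.1 fun h => by
      have h1 : 1 < S₀.card := hp1.2 h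
      omega
    have hm0 : σ i0 ∈ S₀ := Finset.mem_filter.2 ⟨Finset.mem_univ _, hx0⟩
    have hsing : ∀ k, k ∈ S₀ ↔ k = σ i0 := fun k =>
      ⟨fun h => Finset.card_le_one.1 hp.le k h _ hm0, fun h => h ▸ hm0⟩
    have hne : σ i1 ≠ σ i0 := fun h => by
      have := σ.injective h
      exact absurd (congrArg Fin.val this) Nat.one_ne_zero
    have H1 : isoRatio u x (σ i0) = x (σ i0) / x (σ i1) :=
      isoRatio_of_singleton hu hne hx0.le (fun j hj => hout j (mt (hsing j).1 hj)) h1max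
    have H2 : ∀ k ∉ S₀, isoRatio u x k = x k := fun k hk =>
      isoRatio_of_notMem h0 ht (by omega) ⟨_, hm0⟩ hk (fun j hj => (hin j hj).le) hout
    rw [joint_iff hinv hb ⟨_, hm0⟩ hcu
      (fun k hk => by
        obtain rfl := (hsing k).1 hk
        rw [H1]; exact hd1 _ _ (h0 _) (ht _) (hmax _))
      (fun k hk => by rw [H2 k hk]; exact hout k hk)]
    have n2 : ¬ 1 < S₀.card := by omega
    have n3 : S₀.card ≠ u := by omega
    simp only [n2, n3, n4, false_and, or_false, le_min_iff]
    constructor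
    · rintro ⟨-, g2⟩
      have := g2 (σ i1) (mt (hsing _).1 hne)
      rw [H2 _ (mt (hsing _).1 hne)] at this
      exact ⟨this, this.trans hinvb⟩
    · rintro ⟨g1, g2⟩
      refine ⟨fun k hk => ?_, fun k hk => ?_⟩
      · obtain rfl := (hsing k).1 hk
        rw [H1, hr1 _ _ (h0 _) (ht _), mul_comm]
        exact (ENNReal.le_div_iff_mul_le (Or.inl hb0) (Or.inl hb')).1 g2
      · rw [H2 k hk]
        exact (h1max k (mt (hsing k).2 hk)).trans g1
  have hp2 : 2 ≤ S₀.card := by omega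
  have hx1 : 1 < x (σ i1) := hp1.1 hp2
  have n1 : ¬ x (σ i1) ≤ min α⁻¹ (x (σ i0) / b) := fun h =>
    absurd (h.trans (min_le_left _ _)) (not_le.2 (hinv.trans hx1))
  have hne₀ : S₀.Nonempty := Finset.card_pos.1 h0p
  have H1 : ∀ k ∈ S₀, isoRatio u x k = x k := fun k hk =>
    isoRatio_of_mem h0 ht hcu hp2 hk (fun j hj => (hin j hj).le) hout
  rcases hcu.lt_or_eq with hlt | heq
  · -- more than one, but fewer than `u`
    have H2 : ∀ k ∉ S₀, isoRatio u x k = x k := fun k hk =>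
      isoRatio_of_notMem h0 ht hlt hne₀ hk (fun j hj => (hin j hj).le) hout
    rw [joint_iff hinv hb hne₀ hcu (fun k hk => by rw [H1 k hk]; exact (hin k hk).le)
      (fun k hk => by rw [H2 k hk]; exact hout k hk)]
    have n3 : S₀.card ≠ u := by omega
    have h1lt : 1 < S₀.card := hp2
    simp only [n1, n3, n4, hlt, h1lt, false_and, or_false, false_or, true_and]
    constructor
    · rintro ⟨g1, g2⟩ k hk
      by_cases hkS : k ∈ S₀
      · exact absurd hk.2 (not_lt.2 (H1 k hkS ▸ g1 k hkS))
      · exact absurd hk.1 (not_lt.2 (H2 k hkS ▸ g2 k hkS))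
    · intro g
      refine ⟨fun k hk => ?_, fun k hk => ?_⟩
      · rw [H1 k hk]
        by_contra hcon
        exact g k ⟨hinv.trans (hin k hk), not_le.1 hcon⟩
      · rw [H2 k hk]
        by_contra hcon
        exact g k ⟨not_le.1 hcon, (hout k hk).trans_lt hb⟩
  · -- exactly `u`
    have hxu : 1 < x (σ iu) := hpu.1 (show u - 1 < S₀.card by omega)
    have hxv : x (σ iv) ≤ 1 := not_lt.1 (mt hpu1.2 n4)
    have hSS : S = S₀ := by
      refine Finset.eq_of_subset_of_card_le (fun k hk => ?_) (by omega)
      exact Finset.mem_filter.2 ⟨Finset.mem_univ k, hxu.trans_le (hSin k hk)⟩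
    have H2 : ∀ k ∉ S₀, isoRatio u x k = x k / x (σ iu) := fun k hk =>
      isoRatio_of_notMem_of_card_eq h0 ht heq (hSS ▸ huS) hxu.le hk (hSS ▸ hSin)
        fun j hj => (hout j hj).trans hxu.le
    rw [joint_iff hinv hb hne₀ hcu (fun k hk => by rw [H1 k hk]; exact (hin k hk).le)
      (fun k hk => by
        rw [H2 k hk]; exact hd2 _ _ (h0 _) (ht _) ((hout k hk).trans hxu.le))]
    simp only [n1, heq, lt_irrefl, false_and, and_false, or_false, false_or, true_and, max_le_iff]
    constructor
    · rintro ⟨g1, g2⟩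
      have g1 := g1 (σ iu) (hSS ▸ huS)
      have g2 := g2 (σ iv) (hSS ▸ hvS)
      rw [H1 _ (hSS ▸ huS)] at g1
      rw [H2 _ (hSS ▸ hvS), hr2 _ _ (h0 _) (ht _)] at g2
      exact ⟨g1, g2⟩
    · rintro ⟨g1, g2⟩
      refine ⟨fun k hk => ?_, fun k hk => ?_⟩
      · rw [H1 k hk]
        exact g1.trans (hSin k (hSS ▸ hk))
      · rw [H2 k hk, hr2 _ _ (h0 _) (ht _)]
        exact (mul_le_mul_right (hSout k (hSS ▸ hk)) _).trans g2

end Combinatorics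

/-! ### First times and the explicit forms of the test. -/

section FirstTime

variable {Ω : Type*} {S T : ℕ → Set Ω} {ω : Ω} {n : ℕ}

theorem firstTime_le (hn : 1 ≤ n) (h : ω ∈ S n) : firstTime S ω ≤ n :=
  iInf₂_le n ⟨hn, h⟩

theorem firstTime_congr (h : ∀ n, 1 ≤ n → (ω ∈ S n ↔ ω ∈ T n)) :
    firstTime S ω = firstTime T ω :=
  iInf_congr fun n => iInf_congr_Prop (and_congr_right fun hn => h n hn) fun _ => rfl

theorem firstTime_inf : firstTime S ω ⊓ firstTime T ω = firstTime (fun n => S n ∪ T n) ω := by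
  apply le_antisymm
  · refine le_iInf₂ fun n hn => ?_
    rcases hn.2 with h | h
    · exact inf_le_left.trans (firstTime_le hn.1 h)
    · exact inf_le_right.trans (firstTime_le hn.1 h)
  · exact le_inf (le_iInf₂ fun n hn => firstTime_le hn.1 (Or.inl hn.2))
      (le_iInf₂ fun n hn => firstTime_le hn.1 (Or.inr hn.2))

theorem mem_of_firstTime_eq (h : firstTime S ω = n) : 1 ≤ n ∧ ω ∈ S n := by
  have hlt : firstTime S ω < ((n + 1 : ℕ) : ℕ∞) := by
    rw [h]; exact_mod_cast Nat.lt_succ_self n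
  obtain ⟨m, hm⟩ := iInf_lt_iff.1 hlt
  obtain ⟨hmS, hmn⟩ := iInf_lt_iff.1 hm
  have h1 : n ≤ m := by
    have := firstTime_le hmS.1 hmS.2
    rw [h] at this
    exact_mod_cast this
  have h2 : m < n + 1 := by exact_mod_cast hmn
  obtain rfl : m = n := by omega
  exact hmS

end FirstTime

namespace Model

variable {K : ℕ} {E : Fin K → Type*} [∀ k, MeasurableSpace (E k)] {M : Model E} {u n : ℕ}
  {P₀ P₀' Q₀ : Fin K → Measure (Paths E)} {ω : Paths E} {A B : ℝ}

theorem ofReal_one_div (hA : 1 < A) : ENNReal.ofReal (1 / A) = (ENNReal.ofReal A)⁻¹ := by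
  rw [one_div, ENNReal.ofReal_inv_of_pos (by linarith)]

theorem ofReal_one_div_lt_one (hA : 1 < A) : ENNReal.ofReal (1 / A) < 1 := by
  rw [ofReal_one_div hA]
  exact ENNReal.inv_lt_one.2 (by rw [← ENNReal.ofReal_one]; exact (ENNReal.ofReal_lt_ofReal_iff (by linarith)).2 hA)

theorem one_lt_ofReal (hA : 1 < A) : 1 < ENNReal.ofReal A := by
  rw [← ENNReal.ofReal_one]
  exact (ENNReal.ofReal_lt_ofReal_iff (by linarith)).2 hA

/-- The event that the condition defining `T_0` holds at time `n`. -/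
def nullSet (M : Model E) (Ψ : Set (Finset (Fin K))) (s : Fin K → Finset (Fin K))
    (P₀ : Fin K → Measure (Paths E)) (A : ℝ) (n : ℕ) : Set (Paths E) :=
  {ω | ∀ k, M.detStat Ψ (s k) (P₀ k) k n ω ≤ ENNReal.ofReal (1 / A)}

/-- The event that the condition defining `T_joint` holds at time `n`. -/
def jointSet (M : Model E) (Ψ : Set (Finset (Fin K))) (s s' : Fin K → Finset (Fin K))
    (P₀ P₀' : Fin K → Measure (Paths E)) (A B : ℝ) (n : ℕ) : Set (Paths E) :=
  {ω | (∃ k, ENNReal.ofReal B ≤ M.detStat Ψ (s k) (P₀ k) k n ω) ∧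
    (∀ k, M.isoStat Ψ (s' k) (P₀' k) k n ω ∉
      Set.Ioo (ENNReal.ofReal (1 / A)) (ENNReal.ofReal B)) ∧
    M.Diso Ψ s' P₀' n ω ∈ Ψ \ {∅}}

/-- Written as a single first time, the rule can be compared with another one at each fixed time, by
`firstTime_congr`. -/
theorem Tfwer_eq {Ψ : Set (Finset (Fin K))} {s s' : Fin K → Finset (Fin K)} :
    M.Tfwer Ψ s s' P₀ P₀' A B ω =
      firstTime (fun n => M.nullSet Ψ s P₀ A n ∪ M.jointSet Ψ s s' P₀ P₀' A B n) ω :=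
  firstTime_inf

/-- The condition of the test with isolation subsystems `{k}`. -/
theorem Regular.local_iff (hreg : M.Regular u n ω) (hu : 1 ≤ u) (huK : u = K)
    (hprod : M.AllProducts (PsiLU K 0 u)) (hP₀ : ∀ k, P₀ k ∈ M.H0) (hP₀' : ∀ k, P₀' k ∈ M.H0)
    (hQ₀ : ∀ k, marg k (Q₀ k) ∈ M.H k) (hB : 1 < B) :
    (ω ∈ M.nullSet (PsiLU K 0 u) (fun k => {k}) P₀ A n ↔
      ∀ k, M.locStat (Q₀ k) k n ω ≤ ENNReal.ofReal (1 / A)) ∧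
    (ω ∈ M.jointSet (PsiLU K 0 u) (fun k => {k}) (fun k => {k}) P₀ P₀' A B n ↔
      (∃ k, ENNReal.ofReal B ≤ M.locStat (Q₀ k) k n ω) ∧
        ∀ k, M.locStat (Q₀ k) k n ω ∉ Set.Ioo (ENNReal.ofReal (1 / A)) (ENNReal.ofReal B)) ∧
    (ω ∈ M.jointSet (PsiLU K 0 u) (fun k => {k}) (fun k => {k}) P₀ P₀' A B n →
      ∀ k, k ∈ M.Diso (PsiLU K 0 u) (fun k => {k}) P₀' n ω ↔ 1 < M.locStat (Q₀ k) k n ω) := by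
  have hloc : ∀ R ∈ M.H0, ∀ k, M.locStat R k n ω = M.locStat (Q₀ k) k n ω := fun R hR k =>
    hreg.locStat_eq hu hprod (hR.2.1 k) (Or.inl (hQ₀ k))
  have hdet : ∀ k, M.detStat (PsiLU K 0 u) {k} (P₀ k) k n ω = M.locStat (Q₀ k) k n ω :=
    fun k => (detStat_eq hu hprod).trans (hloc _ (hP₀ k) k)
  refine ⟨by simp only [nullSet, Set.mem_ofPred_eq, hdet], ?_⟩
  -- For one source the isolation statistic is infinite and `Diso` always contains the source. Its
  -- agreement with the local statistics then holds only on the joint event, which explains the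
  -- premise of the third claim.
  rcases Nat.lt_or_ge 1 K with hK | hK
  · have hiso : ∀ k, M.isoStat (PsiLU K 0 u) {k} (P₀' k) k n ω = M.locStat (Q₀ k) k n ω :=
      fun k => (isoStat_singleton_eq hu hprod hK).trans (hloc _ (hP₀' k) k)
    have hD : ∀ k, k ∈ M.Diso (PsiLU K 0 u) (fun k => {k}) P₀' n ω ↔
        1 < M.locStat (Q₀ k) k n ω := fun k => by simp [Diso, hiso]
    refine ⟨?_, fun _ => hD⟩
    simp only [jointSet, Set.mem_ofPred_eq, hdet, hiso]
    refine ⟨fun h => ⟨h.1, h.2.1⟩, fun h => ⟨h.1, h.2, ⟨Nat.zero_le _, ?_⟩, ?_⟩⟩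
    · rw [huK]; simpa using Finset.card_le_univ (M.Diso (PsiLU K 0 K) (fun k => {k}) P₀' n ω)
    · obtain ⟨k, hk⟩ := h.1
      exact Finset.ne_empty_of_mem ((hD k).2 ((one_lt_ofReal hB).trans_le hk))
  · have hK1 : K = 1 := by omega
    have hiso : ∀ k, M.isoStat (PsiLU K 0 u) {k} (P₀' k) k n ω = ∞ :=
      fun k => hreg.isoStat_eq_top hu hprod hK1 ((hP₀' k).2.1 k)
    have hD : ∀ k, k ∈ M.Diso (PsiLU K 0 u) (fun k => {k}) P₀' n ω := fun k => by
      simp [Diso, hiso]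
    have hsub : ∀ j k : Fin K, j = k := fun j k => by subst hK1; exact Subsingleton.elim j k
    simp only [jointSet, Set.mem_ofPred_eq, hdet, hiso, hD, true_iff]
    refine ⟨⟨?_, ?_⟩, ?_⟩
    · rintro ⟨⟨k, hk⟩, -⟩
      exact ⟨⟨k, hk⟩, fun j hj => absurd hj.2 (not_lt.2 (hsub k j ▸ hk))⟩
    · rintro ⟨⟨k, hk⟩, -⟩
      refine ⟨⟨k, hk⟩, fun j hj => not_top_lt hj.2, ⟨Nat.zero_le _, ?_⟩,
        Finset.ne_empty_of_mem (hD k)⟩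
      rw [huK]; simpa using Finset.card_le_univ (M.Diso (PsiLU K 0 K) (fun k => {k}) P₀' n ω)
    · rintro ⟨⟨k, hk⟩, -⟩ j
      exact hsub k j ▸ (one_lt_ofReal hB).trans_le hk

/-- When all local statistics avoid the interval, either all are at most `1 / A`, which is the
condition of `T_0`, or one reaches `B`, which gives that of `T_joint`. Stopping by `T_0` means all
statistics are below `1`, in agreement with the decision `∅`. -/
theorem intersection_rule (hreg : ∀ n, 1 ≤ n → M.Regular u n ω) (hu : 1 ≤ u) (huK : u = K)
    (hprod : M.AllProducts (PsiLU K 0 u)) (hP₀ : ∀ k, P₀ k ∈ M.H0) (hP₀' : ∀ k, P₀' k ∈ M.H0)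
    (hQ₀ : ∀ k, marg k (Q₀ k) ∈ M.H k) (hA : 1 < A) (hB : 1 < B) :
    M.Tfwer (PsiLU K 0 u) (fun k => {k}) (fun k => {k}) P₀ P₀' A B ω =
      firstTime (fun n => {ω | ∀ k, M.locStat (Q₀ k) k n ω ∉
        Set.Ioo (ENNReal.ofReal (1 / A)) (ENNReal.ofReal B)}) ω ∧
    ∀ n : ℕ, M.Tfwer (PsiLU K 0 u) (fun k => {k}) (fun k => {k}) P₀ P₀' A B ω = n →
      ∀ k, k ∈ M.Dfwer (PsiLU K 0 u) (fun k => {k}) (fun k => {k}) P₀ P₀' A B ω ↔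
        1 < M.locStat (Q₀ k) k n ω := by
  have hb := one_lt_ofReal hB
  have ha := ofReal_one_div_lt_one hA
  constructor
  · rw [Tfwer_eq]
    refine firstTime_congr fun n hn => ?_
    obtain ⟨h1, h2, -⟩ := (hreg n hn).local_iff hu huK hprod hP₀ hP₀' hQ₀ hB
    rw [Set.mem_union, h1, h2, Set.mem_ofPred_eq]
    constructor
    · rintro (h | h)
      · exact fun k hk => absurd hk.1 (not_lt.2 (h k))
      · exact h.2
    · intro h
      by_cases hall : ∀ k, M.locStat (Q₀ k) k n ω ≤ ENNReal.ofReal (1 / A)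
      · exact Or.inl hall
      · obtain ⟨k, hk⟩ := not_forall.1 hall
        exact Or.inr ⟨⟨k, not_lt.1 fun h' => h k ⟨not_le.1 hk, h'⟩⟩, h⟩
  · intro n hTn k
    have hTn' : min (M.Tnull (PsiLU K 0 u) (fun k => {k}) P₀ (fun _ => A) ω)
        (M.Tjoint (PsiLU K 0 u) (fun k => {k}) (fun k => {k}) P₀ P₀' (fun _ => A) (fun _ => B)
          (fun _ => B) ω) = n := hTn
    rw [Dfwer, Dstar]
    split_ifs with hlt
    · rw [min_eq_right hlt.le] at hTn'
      obtain ⟨hn, hmem⟩ := mem_of_firstTime_eq hTn'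
      have htn : (M.Tstar (PsiLU K 0 u) (fun k => {k}) (fun k => {k}) P₀ P₀' (fun _ => A)
        (fun _ => B) (fun _ => A) (fun _ => B) ω).toNat = n := by
        have : M.Tstar (PsiLU K 0 u) (fun k => {k}) (fun k => {k}) P₀ P₀' (fun _ => A)
          (fun _ => B) (fun _ => A) (fun _ => B) ω = n := hTn
        rw [this]; rfl
      rw [htn]
      exact ((hreg n hn).local_iff hu huK hprod hP₀ hP₀' hQ₀ hB).2.2 hmem k
    · rw [min_eq_left (not_lt.1 hlt)] at hTn'
      obtain ⟨hn, hmem⟩ := mem_of_firstTime_eq hTn'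
      have := ((hreg n hn).local_iff hu huK hprod hP₀ hP₀' hQ₀ hB).1.1 hmem k
      simp only [Finset.notMem_empty, false_iff, not_lt]
      exact this.trans ha.le

theorem gap_intersection_rule (hreg : ∀ n, 1 ≤ n → M.Regular u n ω) (hu : 1 ≤ u) (huK : u < K)
    (hprod : M.AllProducts (PsiLU K 0 u)) (hP₀ : ∀ k, P₀ k ∈ M.H0) (hP₀' : ∀ k, P₀' k ∈ M.H0)
    (hQ₀ : ∀ k, marg k (Q₀ k) ∈ M.H k) (hA : 1 < A) (hB : 1 < B) :
    M.Tfwer (PsiLU K 0 u) (fun k => {k}) (fun _ => Finset.univ) P₀ P₀' A B ω =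
      firstTime (fun n => {ω | M.ordLoc Q₀ 1 n ω ≤ ENNReal.ofReal (1 / A)}) ω ⊓
      firstTime (fun n => {ω | ENNReal.ofReal B ≤ M.ordLoc Q₀ 1 n ω ∧
        M.ordLoc Q₀ 2 n ω ≤
          min (ENNReal.ofReal (1 / A)) (M.ordLoc Q₀ 1 n ω / ENNReal.ofReal B)}) ω ⊓
      firstTime (fun n => {ω | (1 < M.numPos Q₀ n ω ∧ M.numPos Q₀ n ω < u) ∧
        ENNReal.ofReal B ≤ M.ordLoc Q₀ 1 n ω ∧
        ∀ k, M.locStat (Q₀ k) k n ω ∉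
          Set.Ioo (ENNReal.ofReal (1 / A)) (ENNReal.ofReal B)}) ω ⊓
      firstTime (fun n => {ω | M.numPos Q₀ n ω = u ∧
        max (ENNReal.ofReal B) (ENNReal.ofReal A * M.ordLoc Q₀ (u + 1) n ω) ≤
          M.ordLoc Q₀ u n ω}) ω ⊓
      firstTime (fun n => {ω | u < M.numPos Q₀ n ω ∧
        ENNReal.ofReal B ≤ M.ordLoc Q₀ 1 n ω ∧
        M.ordLoc Q₀ (u + 1) n ω * max (ENNReal.ofReal A) (ENNReal.ofReal B) ≤
          M.ordLoc Q₀ u n ω}) ω := by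
  rw [Tfwer_eq, firstTime_inf, firstTime_inf, firstTime_inf, firstTime_inf]
  refine firstTime_congr fun n hn => ?_
  have hr := hreg n hn
  have hloc : ∀ R ∈ M.H0, ∀ k, M.locStat R k n ω = M.locStat (Q₀ k) k n ω := fun R hR k =>
    hr.locStat_eq hu hprod (hR.2.1 k) (Or.inl (hQ₀ k))
  have hdet : ∀ k, M.detStat (PsiLU K 0 u) {k} (P₀ k) k n ω = M.locStat (Q₀ k) k n ω :=
    fun k => (detStat_eq hu hprod).trans (hloc _ (hP₀ k) k)
  have hiso : ∀ k, M.isoStat (PsiLU K 0 u) Finset.univ (P₀' k) k n ω =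
      isoRatio u (fun j => M.locStat (Q₀ j) j n ω) k := fun k => by
    rw [hr.isoStat_univ_eq hu hprod (H0_subset (hP₀' k)), isoRatio]
    simp only [hloc _ (hP₀' k)]
  have key := stop_iff (x := fun j => M.locStat (Q₀ j) j n ω) hu huK
    (fun j => hr.locStat_ne_zero hu hprod (Or.inl (hQ₀ j)))
    (fun j => hr.locStat_ne_top hu hprod (Or.inl (hQ₀ j)))
    (one_lt_ofReal hA) ENNReal.ofReal_ne_top (one_lt_ofReal hB) ENNReal.ofReal_ne_top
  rw [← ofReal_one_div hA] at key
  simp only [nullSet, jointSet, Set.mem_union, Set.mem_ofPred_eq, hdet, Diso, hiso]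
  exact key

end Model

/-! ### Change of measure and the lower bound for two distributions. -/

section ChangeOfMeasure

variable {K : ℕ} {E : Fin K → Type*} [∀ k, MeasurableSpace (E k)]
  {n m : ℕ} {P P' : Measure (Paths E)} {Ψ : Set (Finset (Fin K))}
  {T : Paths E → ℕ∞} {D : Paths E → Finset (Fin K)}

theorem measure_inter_Z_lt_le {s : Finset (Fin K)} [IsProbabilityMeasure P]
    [IsProbabilityMeasure P'] (h : restr s n P ≪ restr s n P') {F : Set (Paths E)}
    (hF : MeasurableSet[filt s n] F) (c : ℝ) :
    P (F ∩ {ω | Z s n P P' ω < c}) ≤ ENNReal.ofReal (Real.exp c) * P' F := by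
  have hZ : MeasurableSet[filt s n] {ω | Z s n P P' ω < c} := measurable_Z measurableSet_Iio
  have hm : MeasurableSet[filt s n] (F ∩ {ω | Z s n P P' ω < c}) :=
    @MeasurableSet.inter _ (filt s n) _ _ hF hZ
  rw [← setLIntegral_LR h hm]
  calc ∫⁻ ω in F ∩ {ω | Z s n P P' ω < c}, LR s n P P' ω ∂P'
      ≤ ∫⁻ _ in F ∩ {ω | Z s n P P' ω < c}, ENNReal.ofReal (Real.exp c) ∂P' := by
        refine setLIntegral_mono_ae measurable_const.aemeasurable ?_
        filter_upwards [LR_lt_top (s := s) (n := n) (P := P) (Q := P')] with ω hω hmem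
        -- A ratio equal to `0` needs no separate case: `Real.le_exp_log` holds there because
        -- `Real.log 0 = 0`.
        rw [← ENNReal.ofReal_toReal hω.ne]
        exact ENNReal.ofReal_le_ofReal ((Real.le_exp_log _).trans (Real.exp_le_exp.2 hmem.2.le))
    _ = ENNReal.ofReal (Real.exp c) * P' (F ∩ {ω | Z s n P P' ω < c}) := setLIntegral_const _ _
    _ ≤ _ := mul_le_mul_right (measure_mono Set.inter_subset_left) _

theorem Model.IsTest.measurableSet_decision (hT : Model.IsTest Ψ T D) (hn : 1 ≤ n)
    (𝒟 : Set (Finset (Fin K))) :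
    MeasurableSet[filt (E := E) Finset.univ n] {ω | T ω = n ∧ D ω ∈ 𝒟} := by
  have : {ω | T ω = n ∧ D ω ∈ 𝒟} =
      ⋃ A ∈ {A | A ∈ 𝒟 ∧ A ∈ Ψ}, {ω | T ω = n ∧ D ω = A} := by
    ext ω
    simp only [Set.mem_iUnion, Set.mem_ofPred_eq, exists_prop]
    constructor
    · rintro ⟨h1, h2⟩; exact ⟨D ω, ⟨h2, hT.mem ω⟩, h1, rfl⟩
    · rintro ⟨A, ⟨h1, -⟩, h2, rfl⟩; exact ⟨h2, h1⟩
  rw [this]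
  exact MeasurableSet.biUnion (Set.to_countable _) fun A hA => hT.decision n hn A hA.2

/-- The change-of-measure bound on the distribution of the stopping time of a test. -/
theorem Model.IsTest.measure_le (hT : Model.IsTest Ψ T D) [IsProbabilityMeasure P] [IsProbabilityMeasure P']
    (h : ∀ n, 1 ≤ n → restr Finset.univ n P ≪ restr Finset.univ n P') (m : ℕ) (c : ℝ)
    (𝒟 : Set (Finset (Fin K))) :
    P {ω | T ω ≤ m} ≤ P {ω | D ω ∉ 𝒟} +
      P {ω | ∃ n ∈ Finset.Icc 1 m, c ≤ Z Finset.univ n P P' ω} +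
      ENNReal.ofReal (Real.exp c) * P' {ω | D ω ∈ 𝒟} := by
  set F : ℕ → Set (Paths E) := fun n => {ω | T ω = n ∧ D ω ∈ 𝒟} with hFdef
  have hFm : ∀ n ∈ Finset.Icc 1 m, MeasurableSet (F n) := fun n hn =>
    (filt Finset.univ).le n _ (hT.measurableSet_decision (Finset.mem_Icc.1 hn).1 𝒟)
  -- Stopping by time `m` means a decision outside `𝒟`, or a log-likelihood ratio that has reached
  -- `c`, or stopping in `𝒟` with a ratio below `c`. Only the last event is carried over to `P'`, at
  -- the price `exp c`.
  have hsub : {ω | T ω ≤ m} ⊆ ({ω | D ω ∉ 𝒟} ∪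
      {ω | ∃ n ∈ Finset.Icc 1 m, c ≤ Z Finset.univ n P P' ω}) ∪
      ⋃ n ∈ Finset.Icc 1 m, (F n ∩ {ω | Z Finset.univ n P P' ω < c}) := by
    intro ω hω
    by_cases h1 : D ω ∈ 𝒟
    swap
    · exact Or.inl (Or.inl h1)
    by_cases h2 : ∃ n ∈ Finset.Icc 1 m, c ≤ Z Finset.univ n P P' ω
    · exact Or.inl (Or.inr h2)
    right
    have hω' : T ω ≤ m := hω
    obtain ⟨n, hn⟩ := ENat.ne_top_iff_exists.1 (ne_top_of_le_ne_top (ENat.natCast_ne_top m) hω')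
    have hn1 : 1 ≤ n := by have := hT.one_le ω; rw [← hn] at this; exact_mod_cast this
    have hn2 : n ≤ m := by rw [← hn] at hω'; exact_mod_cast hω'
    have hnm := Finset.mem_Icc.2 ⟨hn1, hn2⟩
    refine Set.mem_iUnion₂.2 ⟨n, hnm, ⟨hn.symm, h1⟩, ?_⟩
    exact not_le.1 fun h3 => h2 ⟨n, hnm, h3⟩
  refine (measure_mono hsub).trans ((measure_union_le _ _).trans
    (add_le_add (measure_union_le _ _) ?_))
  calc P (⋃ n ∈ Finset.Icc 1 m, (F n ∩ {ω | Z Finset.univ n P P' ω < c}))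
      ≤ ∑ n ∈ Finset.Icc 1 m, P (F n ∩ {ω | Z Finset.univ n P P' ω < c}) :=
        measure_biUnion_finset_le _ _
    _ ≤ ∑ n ∈ Finset.Icc 1 m, ENNReal.ofReal (Real.exp c) * P' (F n) := by
        refine Finset.sum_le_sum fun n hn => ?_
        have hn1 := (Finset.mem_Icc.1 hn).1
        exact measure_inter_Z_lt_le (h n hn1) (hT.measurableSet_decision hn1 𝒟) c
    _ = ENNReal.ofReal (Real.exp c) * P' (⋃ n ∈ Finset.Icc 1 m, F n) := by
        -- The events of stopping at different times are disjoint, so summing over the times costs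
        -- no factor `m`.
        rw [← Finset.mul_sum, measure_biUnion_finset _ hFm]
        intro i _ j _ hij
        refine Set.disjoint_left.2 fun ω hi hj => hij ?_
        have : (i : ℕ∞) = j := hi.1.symm.trans hj.1
        exact_mod_cast this
    _ ≤ _ := by
        refine mul_le_mul_right (measure_mono ?_) _
        exact Set.iUnion₂_subset fun n _ ω hω => hω.2

/-- `I` is an asymptotic upper bound for the rate of the running maximum of `Z_n(P, P')`. -/
def UpperRate (P P' : Measure (Paths E)) (I : ℝ) : Prop :=
  ∀ ρ : ℝ, I < ρ → Tendsto
    (fun n : ℕ => P {ω | ∃ m ∈ Finset.Icc 1 n, (n : ℝ) * ρ ≤ Z Finset.univ m P P' ω}) atTop (𝓝 0)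

/-- Markov's inequality, with `m < T` used as `m + 1 ≤ T`; the additional `1` later compensates a
floor. -/
theorem lintegral_stoppingTime_ge (hT : IsStoppingTime (filt (E := E) Finset.univ) T)
    [IsProbabilityMeasure P] {e : ℝ} (he : 0 ≤ e) (h : P {ω | T ω ≤ m} ≤ ENNReal.ofReal e) :
    ENNReal.ofReal ((1 - e) * (m + 1)) ≤ ∫⁻ ω, (T ω : ℝ≥0∞) ∂P := by
  have hm : MeasurableSet {ω | T ω ≤ m} := (filt Finset.univ).le m _ (hT m)
  have hP : ENNReal.ofReal (1 - e) ≤ P {ω | T ω ≤ m}ᶜ := by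
    rw [prob_compl_eq_one_sub hm, ENNReal.ofReal_sub _ he, ENNReal.ofReal_one]
    exact tsub_le_tsub_left h 1
  calc ENNReal.ofReal ((1 - e) * (m + 1)) = ((m + 1 : ℕ) : ℝ≥0∞) * ENNReal.ofReal (1 - e) := by
        rw [mul_comm, ENNReal.ofReal_mul (by positivity)]
        congr 1
        rw [← ENNReal.ofReal_natCast]; push_cast; rfl
    _ ≤ ((m + 1 : ℕ) : ℝ≥0∞) * P {ω | T ω ≤ m}ᶜ := mul_le_mul_right hP _
    _ = ∫⁻ _ in {ω | T ω ≤ m}ᶜ, ((m + 1 : ℕ) : ℝ≥0∞) ∂P := (setLIntegral_const _ _).symm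
    _ ≤ ∫⁻ ω in {ω | T ω ≤ m}ᶜ, (T ω : ℝ≥0∞) ∂P := by
        refine setLIntegral_mono' hm.compl fun ω hω => ?_
        have h1 : (m : ℕ∞) < T ω := not_le.1 hω
        have h2 : ((m + 1 : ℕ) : ℕ∞) ≤ T ω := by
          push_cast
          exact Order.add_one_le_of_lt h1
        exact_mod_cast ENat.toENNReal_le.2 h2
    _ ≤ _ := setLIntegral_le_lintegral _ _

/-- The asymptotic lower bound on the expected sample size of tests which distinguish `P` from `P'`
with error probabilities `x` under `P'` and `y` under `P`. -/
theorem UpperRate.eventually_le {I : ℝ} (hI : 0 < I) (hrate : UpperRate P P' I)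
    [IsProbabilityMeasure P] [IsProbabilityMeasure P']
    (h : ∀ n, 1 ≤ n → restr Finset.univ n P ≪ restr Finset.univ n P')
    {ι : Type*} {l : Filter ι} {x y : ι → ℝ} (hx : Tendsto x l (𝓝[>] 0))
    (hy : Tendsto y l (𝓝[>] 0)) {ε : ℝ} (hε : 0 < ε) (hε1 : ε < 1) :
    ∀ᶠ i in l, ∀ (T : Paths E → ℕ∞) (D : Paths E → Finset (Fin K)) (𝒟 : Set (Finset (Fin K))),
      Model.IsTest Ψ T D →
      P {ω | D ω ∉ 𝒟} ≤ ENNReal.ofReal (y i) → P' {ω | D ω ∈ 𝒟} ≤ ENNReal.ofReal (x i) →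
      ENNReal.ofReal ((1 - ε) * (I⁻¹ * |Real.log (x i)|)) ≤ ∫⁻ ω, (T ω : ℝ≥0∞) ∂P := by
  -- With `m` about `(1 - e) |log x| / I` and `c = m I (1 + e) ≤ (1 - e²) |log x|`, the transferred
  -- term is at most `x ^ (e²)`, which vanishes. The three error terms are each at most `e / 4`, and
  -- `(1 - e)² ≥ 1 - ε`. The choices do not involve the test, so the bound is uniform over tests.
  set e := ε / 2 with he
  have he0 : 0 < e := by positivity
  have hlog : Tendsto (fun i => |Real.log (x i)|) l atTop :=
    (tendsto_abs_atBot_atTop.comp Real.tendsto_log_nhdsGT_zero).comp hx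
  have hexp : Tendsto (fun i => Real.exp (-(e ^ 2 * |Real.log (x i)|))) l (𝓝 0) :=
    Real.tendsto_exp_neg_atTop_nhds_zero.comp (hlog.const_mul_atTop (by positivity))
  have hfl : Tendsto (fun i => ⌊(1 - e) * (I⁻¹ * |Real.log (x i)|)⌋₊) l atTop := by
    refine tendsto_nat_floor_atTop.comp (Tendsto.const_mul_atTop (by linarith) ?_)
    exact hlog.const_mul_atTop (by positivity)
  have hmax := (hrate (I * (1 + e)) (by nlinarith)).comp hfl
  have hq : 0 < e / 4 := by positivity
  have ex := hexp.eventually (gt_mem_nhds hq)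
  have em := hmax.eventually (gt_mem_nhds (ENNReal.ofReal_pos.2 hq))
  have ey := (hy.mono_right nhdsWithin_le_nhds).eventually (gt_mem_nhds hq)
  have ex1 := (hx.mono_right nhdsWithin_le_nhds).eventually (gt_mem_nhds one_pos)
  have ex0 := hx.eventually self_mem_nhdsWithin
  filter_upwards [ex, em, ey, ex1, ex0] with i h1 h2 h3 h4 h5 T D 𝒟 hT hP hP'
  have h5 : 0 < x i := h5
  set L := |Real.log (x i)| with hL
  have hL0 : 0 ≤ L := abs_nonneg _
  have hxL : x i = Real.exp (-L) := by
    rw [hL, abs_of_neg (Real.log_neg h5 h4), neg_neg, Real.exp_log h5]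
  set m := ⌊(1 - e) * (I⁻¹ * L)⌋₊ with hm
  have hnn : 0 ≤ (1 - e) * (I⁻¹ * L) := mul_nonneg (by linarith) (by positivity)
  have hmle : (m : ℝ) ≤ (1 - e) * (I⁻¹ * L) := Nat.floor_le hnn
  have hmlt : (1 - e) * (I⁻¹ * L) < m + 1 := Nat.lt_floor_add_one _
  have hc : (m : ℝ) * (I * (1 + e)) ≤ (1 - e ^ 2) * L := by
    calc (m : ℝ) * (I * (1 + e)) ≤ ((1 - e) * (I⁻¹ * L)) * (I * (1 + e)) :=
          mul_le_mul_of_nonneg_right hmle (by positivity)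
      _ = (I⁻¹ * I) * ((1 - e ^ 2) * L) := by ring
      _ = (1 - e ^ 2) * L := by rw [inv_mul_cancel₀ hI.ne', one_mul]
  have hthird : ENNReal.ofReal (Real.exp (m * (I * (1 + e)))) * P' {ω | D ω ∈ 𝒟} ≤
      ENNReal.ofReal (e / 4) := by
    refine (mul_le_mul' le_rfl hP').trans ?_
    rw [← ENNReal.ofReal_mul (Real.exp_pos _).le]
    refine ENNReal.ofReal_le_ofReal (le_trans ?_ h1.le)
    rw [hxL, ← Real.exp_add]
    exact Real.exp_le_exp.2 (by linarith)
  have hle : P {ω | T ω ≤ m} ≤ ENNReal.ofReal e := by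
    refine (hT.measure_le h m (m * (I * (1 + e))) 𝒟).trans ?_
    calc _ ≤ ENNReal.ofReal (e / 4) + ENNReal.ofReal (e / 4) + ENNReal.ofReal (e / 4) :=
          add_le_add (add_le_add (hP.trans (ENNReal.ofReal_le_ofReal h3.le)) h2.le) hthird
      _ ≤ ENNReal.ofReal e := by
          rw [← ENNReal.ofReal_add hq.le hq.le, ← ENNReal.ofReal_add (by positivity) hq.le]
          exact ENNReal.ofReal_le_ofReal (by linarith)
  refine le_trans (ENNReal.ofReal_le_ofReal ?_) (lintegral_stoppingTime_ge hT.stopping he0.le hle)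
  have hIL : 0 ≤ I⁻¹ * L := by positivity
  have h6 : (1 - e) * ((1 - e) * (I⁻¹ * L)) ≤ (1 - e) * (m + 1) :=
    mul_le_mul_of_nonneg_left hmlt.le (by linarith)
  refine le_trans ?_ h6
  have : (1 - ε) ≤ (1 - e) * (1 - e) := by rw [he]; nlinarith
  calc (1 - ε) * (I⁻¹ * L) ≤ ((1 - e) * (1 - e)) * (I⁻¹ * L) :=
        mul_le_mul_of_nonneg_right this hIL
    _ = _ := by ring

end ChangeOfMeasure

/-! ### Rates between distributions that differ in one or two sources. -/

namespace Model

variable {K : ℕ} {E : Fin K → Type*} [∀ k, MeasurableSpace (E k)] {M : Model E} {u n : ℕ}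
  {P P' Q : Measure (Paths E)} {ω : Paths E} {j k : Fin K}

theorem Regular.Z_eq_zero (h : M.Regular u n ω) (hP : P ∈ M.famPsi (PsiLU K 0 u))
    (hk : marg k P' = marg k P) : Z {k} n P P' ω = 0 := by
  rw [Z, h.eq_one hP hk]; simp

theorem Regular.Z_univ (h : M.Regular u n ω) (hP : P ∈ M.famPsi (PsiLU K 0 u))
    (hP' : P' ∈ M.famPsi (PsiLU K 0 u)) :
    Z Finset.univ n P P' ω = ∑ k, Z {k} n P P' ω := by
  simp only [Z]
  rw [h.prod P hP P' hP', ENNReal.toReal_prod, Real.log_prod]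
  intro k _
  exact (ENNReal.toReal_pos (h.ne_zero P hP P' hP' k) (h.ne_top P hP P' hP' k)).ne'

/-- Sources with a common marginal contribute ratio `1`, so the global log-likelihood ratio is that
of source `k`. -/
theorem upperRate_of_single (hreg : ∀ᵐ ω ∂P, ∀ n, 1 ≤ n → M.Regular u n ω)
    (hP : P ∈ M.famPsi (PsiLU K 0 u)) (hP' : P' ∈ M.famPsi (PsiLU K 0 u))
    (hne : ∀ j, j ≠ k → marg j P' = marg j P) {I : ℝ} (hI : HasInfo {k} P P' I) :
    UpperRate P P' I := by
  intro ρ hρ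
  refine (hI.2.1 ρ hρ).congr fun n => measure_congr ?_
  filter_upwards [hreg] with ω hω
  refine propext (exists_congr fun m => and_congr_right fun hm => ?_)
  have hr := hω m (Finset.mem_Icc.1 hm).1
  rw [hr.Z_univ hP hP', Finset.sum_eq_single k (fun j _ hj => hr.Z_eq_zero hP (hne j hj))
    (fun h => absurd (Finset.mem_univ k) h)]

/-- The global log-likelihood ratio is the sum of two local ones. If it exceeds `n ρ`, one of them
exceeds its rate plus half of the excess `ρ - (I + J)`. -/
theorem upperRate_of_pair (hreg : ∀ᵐ ω ∂P, ∀ n, 1 ≤ n → M.Regular u n ω)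
    (hP : P ∈ M.famPsi (PsiLU K 0 u)) (hP' : P' ∈ M.famPsi (PsiLU K 0 u)) (hjk : j ≠ k)
    (hne : ∀ i, i ≠ j → i ≠ k → marg i P' = marg i P) {I J : ℝ} (hI : HasInfo {j} P P' I)
    (hJ : HasInfo {k} P P' J) : UpperRate P P' (I + J) := by
  intro ρ hρ
  set η := (ρ - (I + J)) / 2 with hη
  have hη0 : 0 < η := by rw [hη]; linarith
  have hsum := (hI.2.1 (I + η) (by linarith)).add (hJ.2.1 (J + η) (by linarith))
  rw [add_zero] at hsum
  refine tendsto_of_tendsto_of_tendsto_of_le_of_le tendsto_const_nhds hsum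
    (fun _ => bot_le) fun n => ?_
  refine (measure_mono_ae ?_).trans (measure_union_le _ _)
  filter_upwards [hreg] with ω hω
  rintro ⟨m, hm, h⟩
  have hr := hω m (Finset.mem_Icc.1 hm).1
  rw [hr.Z_univ hP hP', ← Finset.sum_subset (Finset.subset_univ {j, k}) (fun i _ hi => by
    simp only [Finset.mem_insert, Finset.mem_singleton, not_or] at hi
    exact hr.Z_eq_zero hP (hne i hi.1 hi.2)), Finset.sum_pair hjk] at h
  by_cases h1 : (n : ℝ) * (I + η) ≤ Z {j} m P P' ω
  · exact Or.inl ⟨m, hm, h1⟩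
  · refine Or.inr ⟨m, hm, ?_⟩
    have : (n : ℝ) * ρ = n * (I + η) + n * (J + η) := by rw [hη]; ring
    rw [this] at h
    linarith [not_le.1 h1]

end Model

/-! ### Upper bound on the expected sample size through summable bad events. -/

/-- All times from `N` up to the first good one are bad, so the number of bad times pays for the
delay beyond `N`. If no good time comes, this number is infinite. -/
theorem toENNReal_le_add_tsum {Ω : Type*} {τ : ℕ∞} {G : ℕ → Set Ω} {N : ℕ} {ω : Ω}
    (h : ∀ n, N ≤ n → ω ∈ G n → τ ≤ n) :
    (τ : ℝ≥0∞) ≤ N + ∑' n, (G n)ᶜ.indicator (fun _ => (1 : ℝ≥0∞)) ω := by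
  have key : ∀ m, (∀ n ∈ Finset.Ico N m, ω ∉ G n) →
      ((m - N : ℕ) : ℝ≥0∞) ≤ ∑' n, (G n)ᶜ.indicator (fun _ => (1 : ℝ≥0∞)) ω := by
    intro m hm
    refine le_trans (le_of_eq ?_) (ENNReal.sum_le_tsum (Finset.Ico N m))
    rw [Finset.sum_congr rfl fun n hn => Set.indicator_of_mem (hm n hn) _]
    simp
  by_cases hex : ∃ n, N ≤ n ∧ ω ∈ G n
  · classical
    set n₀ := Nat.find hex with hn₀
    obtain ⟨h1, h2⟩ := Nat.find_spec hex
    have h3 : ∀ n ∈ Finset.Ico N n₀, ω ∉ G n := fun n hn hG =>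
      Nat.find_min hex (Finset.mem_Ico.1 hn).2 ⟨(Finset.mem_Ico.1 hn).1, hG⟩
    calc (τ : ℝ≥0∞) ≤ (n₀ : ℝ≥0∞) := by
          exact_mod_cast ENat.toENNReal_le.2 (h n₀ h1 h2)
      _ = N + ((n₀ - N : ℕ) : ℝ≥0∞) := by
          rw [← Nat.cast_add, Nat.add_sub_cancel' h1]
      _ ≤ _ := add_le_add_right (key n₀ h3) _
  · have htop : ∑' n, (G n)ᶜ.indicator (fun _ => (1 : ℝ≥0∞)) ω = ∞ := by
      refine ENNReal.eq_top_of_forall_nnreal_le fun r => ?_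
      obtain ⟨m, hm⟩ := exists_nat_ge r
      have := key (N + m) fun n hn hG => hex ⟨n, (Finset.mem_Ico.1 hn).1, hG⟩
      rw [Nat.add_sub_cancel_left] at this
      refine le_trans ?_ this
      exact_mod_cast hm
    rw [htop, add_top]
    exact le_top

theorem lintegral_le_add_tsum {Ω : Type*} {_ : MeasurableSpace Ω} {P : Measure Ω}
    [IsProbabilityMeasure P] {T : Ω → ℕ∞} {G : ℕ → Set Ω} (hG : ∀ n, MeasurableSet (G n)) {N : ℕ}
    (h : ∀ᵐ ω ∂P, ∀ n, N ≤ n → ω ∈ G n → T ω ≤ n) :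
    ∫⁻ ω, (T ω : ℝ≥0∞) ∂P ≤ N + ∑' n, P (G n)ᶜ := by
  calc ∫⁻ ω, (T ω : ℝ≥0∞) ∂P
      ≤ ∫⁻ ω, (N + ∑' n, (G n)ᶜ.indicator (fun _ => (1 : ℝ≥0∞)) ω) ∂P :=
        lintegral_mono_ae (h.mono fun ω hω => toENNReal_le_add_tsum hω)
    _ = N + ∑' n, P (G n)ᶜ := by
        rw [lintegral_add_left measurable_const, lintegral_const, measure_univ, mul_one,
          lintegral_tsum fun n => (measurable_const.indicator (hG n).compl).aemeasurable]
        congr 1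
        exact tsum_congr fun n => lintegral_indicator_one (hG n).compl

namespace Model

variable {K : ℕ} {E : Fin K → Type*} [∀ k, MeasurableSpace (E k)] {M : Model E} {u n : ℕ}
  {P Q R : Measure (Paths E)} {ω : Paths E} {k : Fin K} {c : ℝ}

theorem Regular.LR_mul_LR (h : M.Regular u n ω) (hP : P ∈ M.famPsi (PsiLU K 0 u))
    (hQ : Q ∈ M.famPsi (PsiLU K 0 u)) (k : Fin K) : LR {k} n P Q ω * LR {k} n Q P ω = 1 := by
  rw [← h.chain P hP Q hQ P hP k, h.self P hP k]

theorem Regular.ofReal_exp_le_LR (h : M.Regular u n ω) (hP : P ∈ M.famPsi (PsiLU K 0 u))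
    (hQ : Q ∈ M.famPsi (PsiLU K 0 u)) (hc : c ≤ Z {k} n P Q ω) :
    ENNReal.ofReal (Real.exp c) ≤ LR {k} n P Q ω := by
  have h0 := h.ne_zero P hP Q hQ k
  have ht := h.ne_top P hP Q hQ k
  rw [← ENNReal.ofReal_toReal ht]
  refine ENNReal.ofReal_le_ofReal ?_
  rw [← Real.exp_log (ENNReal.toReal_pos h0 ht)]
  exact Real.exp_le_exp.2 hc

theorem Regular.LR_le_ofReal_exp (h : M.Regular u n ω) (hP : P ∈ M.famPsi (PsiLU K 0 u))
    (hQ : Q ∈ M.famPsi (PsiLU K 0 u)) (hc : c ≤ Z {k} n P Q ω) :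
    LR {k} n Q P ω ≤ ENNReal.ofReal (Real.exp (-c)) := by
  have h1 := h.ofReal_exp_le_LR hP hQ hc
  have h2 : LR {k} n Q P ω = (LR {k} n P Q ω)⁻¹ :=
    ENNReal.eq_inv_of_mul_eq_one_left (h.LR_mul_LR hQ hP k)
  rw [h2, Real.exp_neg, ENNReal.ofReal_inv_of_pos (Real.exp_pos c)]
  exact ENNReal.inv_le_inv.2 h1

/-- The local distribution of source `k` under `Q` belongs to the other hypothesis than under
`P`. -/
def Opposite (M : Model E) (P : Measure (Paths E)) (k : Fin K) (Q : Measure (Paths E)) : Prop :=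
  (k ∈ M.signals P → marg k Q ∈ M.H k) ∧ (k ∉ M.signals P → marg k Q ∈ M.G k)

/-- With `P` itself as reference, the numerator is at least `LR P P = 1`, and every candidate in the
denominator is at most `exp (-c)`. -/
theorem Regular.le_locStat (h : M.Regular u n ω) (hu : 1 ≤ u)
    (hprod : M.AllProducts (PsiLU K 0 u)) (hP : P ∈ M.famPsi (PsiLU K 0 u))
    (hR : marg k R ∈ M.H k ∪ M.G k) (hk : k ∈ M.signals P)
    (hc : ∀ Q ∈ M.famPsi (PsiLU K 0 u), M.Opposite P k Q → c ≤ Z {k} n P Q ω) :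
    ENNReal.ofReal (Real.exp c) ≤ M.locStat R k n ω := by
  rw [h.locStat_eq hu hprod hR (hP.2.1 k), locStat_eq_div]
  obtain ⟨Q, -, h2, h3⟩ := M.exists_eq_supH P k n ω
  obtain ⟨Q', h4, h5⟩ := exists_H0_marg hprod h2
  rw [h3, ← LR_congr h5 rfl]
  have hQ' := H0_subset (u := u) h4
  rw [ENNReal.le_div_iff_mul_le (Or.inl (h.ne_zero _ hQ' _ hP k))
    (Or.inl (h.ne_top _ hQ' _ hP k))]
  have h6 := h.ofReal_exp_le_LR hP hQ'
    (hc Q' hQ' ⟨fun _ => h5 ▸ h2, fun h => absurd hk h⟩)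
  refine (mul_le_mul_left h6 _).trans ?_
  rw [h.LR_mul_LR hP hQ' k, ← h.self P hP k]
  exact le_supG hP.1 (mem_signals.1 hk)

/-- Dual to `Regular.le_locStat`: under the reference `P` the denominator is at least `1`, and the
numerator is at most `exp (-c)`. -/
theorem Regular.locStat_le (h : M.Regular u n ω) (hu : 1 ≤ u)
    (hprod : M.AllProducts (PsiLU K 0 u)) (hP : P ∈ M.famPsi (PsiLU K 0 u))
    (hR : marg k R ∈ M.H k ∪ M.G k) (hk : k ∉ M.signals P)
    (hc : ∀ Q ∈ M.famPsi (PsiLU K 0 u), M.Opposite P k Q → c ≤ Z {k} n P Q ω) :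
    M.locStat R k n ω ≤ ENNReal.ofReal (Real.exp (-c)) := by
  rw [h.locStat_eq hu hprod hR (hP.2.1 k), locStat_eq_div]
  obtain ⟨Q, -, h2, h3⟩ := M.exists_eq_supG P k n ω
  obtain ⟨Q', h4, -, h5⟩ := exists_signal_marg hu hprod h2
  rw [h3, ← LR_congr h5 rfl]
  have h6 := h.LR_le_ofReal_exp hP h4 (hc Q' h4 ⟨fun h => absurd h hk, fun _ => h5 ▸ h2⟩)
  have h7 : 1 ≤ M.supH P k n ω := by
    rw [← h.self P hP k]
    exact le_supH hP.1 ((notMem_signals_iff hP).1 hk)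
  exact (ENNReal.div_le_of_le_mul' (by
    calc LR {k} n Q' P ω = 1 * LR {k} n Q' P ω := (one_mul _).symm
      _ ≤ _ := mul_le_mul' h7 le_rfl)).trans h6

/-- The number `I k` is the smallest information number of `P` against the opposite local
distributions of source `k`, and it is attained at `Q k`. -/
structure Rates (M : Model E) (u : ℕ) (P : Measure (Paths E)) (I : Fin K → ℝ)
    (Q : Fin K → Measure (Paths E)) : Prop where
  opposite : ∀ k, M.Opposite P k (Q k)
  info : ∀ k, HasInfo {k} P (Q k) (I k)
  sum_lt_top : ∀ k, ∀ R ∈ M.famPsi (PsiLU K 0 u), M.Opposite P k R → ∀ ρ < I k,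
    ∑' n : ℕ, P {ω | Z {k} n P R ω < (n : ℝ) * ρ} < ∞

theorem Rates.pos {I : Fin K → ℝ} {Q : Fin K → Measure (Paths E)} (h : M.Rates u P I Q)
    (k : Fin K) : 0 < I k := (h.info k).1

/-- The assumption takes its pair with the signal at `k` first. If `k` is not a signal under `P`,
its interchanged half applies. -/
theorem exists_info (hu : 1 ≤ u) (hinfo : M.InfoNumbersExist (PsiLU K 0 u))
    (hprod : M.AllProducts (PsiLU K 0 u)) (hP : P ∈ M.famPsi (PsiLU K 0 u))
    (hQ : M.Opposite P k Q) : ∃ I, HasInfo {k} P Q I := by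
  by_cases hk : k ∈ M.signals P
  · obtain ⟨Q', h1, h2⟩ := exists_H0_marg hprod (hQ.1 hk)
    obtain ⟨I, hI⟩ := (hinfo k P ⟨hP, hk⟩ Q' (Or.inr h1) {k} (Finset.mem_singleton_self k)).1
    exact ⟨I, hI.congr rfl h2⟩
  · obtain ⟨Q', h1, h2, h3⟩ := exists_signal_marg hu hprod (hQ.2 hk)
    obtain ⟨I, hI⟩ := (hinfo k Q' ⟨h1, by simp [h2]⟩ P (mem_HPsi_union hP hk) {k}
      (Finset.mem_singleton_self k)).2
    exact ⟨I, hI.congr rfl h3⟩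

/-- The family is finite, so the smallest information number is attained. The minimizer serves the
lower bound; the summability below `I k` for all competitors serves the upper bound. -/
theorem exists_rates (hu : 1 ≤ u) (hinfo : M.InfoNumbersExist (PsiLU K 0 u))
    (hprod : M.AllProducts (PsiLU K 0 u)) (hP : P ∈ M.famPsi (PsiLU K 0 u)) :
    ∃ I Q, M.Rates u P I Q := by
  have key : ∀ k, ∃ (I : ℝ) (Q : Measure (Paths E)), M.Opposite P k Q ∧ HasInfo {k} P Q I ∧
      ∀ R ∈ M.famPsi (PsiLU K 0 u), M.Opposite P k R → ∀ ρ < I,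
        ∑' n : ℕ, P {ω | Z {k} n P R ω < (n : ℝ) * ρ} < ∞ := by
    intro k
    have hex : ∀ Q, ∃ I, M.Opposite P k Q → HasInfo {k} P Q I := fun Q => by
      by_cases hQ : M.Opposite P k Q
      · obtain ⟨I, hI⟩ := exists_info hu hinfo hprod hP hQ
        exact ⟨I, fun _ => hI⟩
      · exact ⟨0, fun h => absurd h hQ⟩
    choose I hI using hex
    have hfin : {Q | Q ∈ M.famPsi (PsiLU K 0 u) ∧ M.Opposite P k Q}.Finite :=
      M.finite_fam.subset fun _ h => h.1.1
    have hne : {Q | Q ∈ M.famPsi (PsiLU K 0 u) ∧ M.Opposite P k Q}.Nonempty := by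
      by_cases hk : k ∈ M.signals P
      · obtain ⟨Q', h1, h2⟩ := exists_H0_marg hprod (M.H_nonempty k).some_mem
        exact ⟨Q', H0_subset h1, fun _ => h2 ▸ (M.H_nonempty k).some_mem, fun h => absurd hk h⟩
      · obtain ⟨Q', h1, -, h2⟩ := exists_signal_marg hu hprod (M.G_nonempty k).some_mem
        exact ⟨Q', h1, fun h => absurd h hk, fun _ => h2 ▸ (M.G_nonempty k).some_mem⟩
    obtain ⟨Q, hQ, hmin⟩ := Set.exists_min_image _ I hfin hne
    exact ⟨I Q, Q, hQ.2, hI Q hQ.2, fun R hR hop ρ hρ =>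
      (hI R hop).2.2 ρ (hρ.trans_le (hmin R ⟨hR, hop⟩))⟩
  choose I Q h1 h2 h3 using key
  exact ⟨I, Q, h1, h2, h3⟩

/-- The event that all local log-likelihood ratios at time `n` are almost as large as expected. -/
def goodSet (M : Model E) (u : ℕ) (P : Measure (Paths E)) (I : Fin K → ℝ) (ε : ℝ) (n : ℕ) :
    Set (Paths E) :=
  {ω | ∀ k, ∀ R ∈ M.famPsi (PsiLU K 0 u), M.Opposite P k R →
    (n : ℝ) * ((1 - ε) * I k) ≤ Z {k} n P R ω}

theorem finite_opposite (M : Model E) (u : ℕ) (P : Measure (Paths E)) (k : Fin K) :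
    {R | R ∈ M.famPsi (PsiLU K 0 u) ∧ M.Opposite P k R}.Finite :=
  M.finite_fam.subset fun _ h => h.1.1

theorem compl_goodSet {I : Fin K → ℝ} {ε : ℝ} : (M.goodSet u P I ε n)ᶜ =
    ⋃ k ∈ Finset.univ, ⋃ R ∈ (finite_opposite M u P k).toFinset,
      {ω | Z {k} n P R ω < (n : ℝ) * ((1 - ε) * I k)} := by
  ext ω
  simp only [goodSet, Set.mem_compl_iff, Set.mem_ofPred_eq, Set.mem_iUnion, Finset.mem_univ,
    Set.Finite.mem_toFinset, not_forall, not_le, exists_prop, true_and]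
  exact exists_congr fun k => exists_congr fun R => and_assoc.symm

theorem measurableSet_goodSet {I : Fin K → ℝ} {ε : ℝ} (n : ℕ) :
    MeasurableSet (M.goodSet u P I ε n) := by
  rw [← MeasurableSet.compl_iff, compl_goodSet]
  exact Finset.measurableSet_biUnion _ fun k _ => Finset.measurableSet_biUnion _ fun R _ =>
    measurable_Z' measurableSet_Iio

theorem Rates.tsum_compl_goodSet {I : Fin K → ℝ} {Q : Fin K → Measure (Paths E)}
    (h : M.Rates u P I Q) {ε : ℝ} (hε : 0 < ε) :
    ∑' n, P (M.goodSet u P I ε n)ᶜ ≠ ∞ := by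
  refine ne_top_of_le_ne_top (b := ∑ k, ∑ R ∈ (finite_opposite M u P k).toFinset,
    ∑' n : ℕ, P {ω | Z {k} n P R ω < (n : ℝ) * ((1 - ε) * I k)}) ?_ ?_
  · refine ENNReal.sum_ne_top.2 fun k _ => ENNReal.sum_ne_top.2 fun R hR => ?_
    rw [Set.Finite.mem_toFinset] at hR
    refine (h.sum_lt_top k R hR.1 hR.2 _ ?_).ne
    have := h.pos k
    nlinarith
  · have hle : ∀ n, P (M.goodSet u P I ε n)ᶜ ≤ ∑ k, ∑ R ∈ (finite_opposite M u P k).toFinset,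
        P {ω | Z {k} n P R ω < (n : ℝ) * ((1 - ε) * I k)} := fun n => by
      rw [compl_goodSet]
      exact (measure_biUnion_finset_le _ _).trans (Finset.sum_le_sum fun k _ =>
        measure_biUnion_finset_le _ _)
    refine (ENNReal.tsum_le_tsum hle).trans (le_of_eq ?_)
    rw [Summable.tsum_finsetSum fun _ _ => ENNReal.summable]
    exact Finset.sum_congr rfl fun k _ => Summable.tsum_finsetSum fun _ _ => ENNReal.summable

/-- The upper bound on the expected sample size. -/
theorem Rates.lintegral_le {I : Fin K → ℝ} {Q : Fin K → Measure (Paths E)}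
    (h : M.Rates u P I Q) (hP : P ∈ M.famPsi (PsiLU K 0 u)) {ε : ℝ} (hε : 0 < ε) (hε1 : ε < 1) :
    ∃ C : ℝ, 0 ≤ C ∧ ∀ (T : Paths E → ℕ∞) (t : ℝ), 0 ≤ t →
      (∀ᵐ ω ∂P, ∀ n : ℕ, 1 ≤ n → t ≤ (1 - ε) * n → ω ∈ M.goodSet u P I ε n → T ω ≤ n) →
      ∫⁻ ω, (T ω : ℝ≥0∞) ∂P ≤ ENNReal.ofReal ((1 - ε)⁻¹ * t + C) := by
  have := isProbabilityMeasure_of_mem_famPsi hP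
  have hfin := h.tsum_compl_goodSet hε
  set S := ∑' n, P (M.goodSet u P I ε n)ᶜ with hS
  -- The `2` covers the rounding in the ceiling and the `1` added to `N`, which ensures that only
  -- times `n ≥ 1` are used. The constant depends on neither `T` nor `t`.
  refine ⟨2 + S.toReal, by positivity, fun T t ht hT => ?_⟩
  have h1 : 0 < 1 - ε := by linarith
  set N := ⌈(1 - ε)⁻¹ * t⌉₊ + 1 with hN
  have hNle : (N : ℝ) ≤ (1 - ε)⁻¹ * t + 2 := by
    have := (Nat.ceil_lt_add_one (a := (1 - ε)⁻¹ * t) (by positivity)).le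
    rw [hN]; push_cast; linarith
  have hNge : (1 - ε)⁻¹ * t ≤ N := by
    have := Nat.le_ceil ((1 - ε)⁻¹ * t)
    rw [hN]; push_cast; linarith
  refine (lintegral_le_add_tsum (G := M.goodSet u P I ε) (N := N)
    measurableSet_goodSet (hT.mono fun ω hω n hn hg => hω n (by omega) ?_ hg)).trans ?_
  · have hnN : (N : ℝ) ≤ n := by exact_mod_cast hn
    have := mul_le_mul_of_nonneg_left (hNge.trans hnN) h1.le
    rwa [mul_inv_cancel_left₀ h1.ne'] at this
  · rw [← hS, ← add_assoc, ENNReal.ofReal_add (by positivity) ENNReal.toReal_nonneg,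
      ENNReal.ofReal_toReal hfin]
    refine add_le_add_left ?_ _
    rw [← ENNReal.ofReal_natCast]
    exact ENNReal.ofReal_le_ofReal hNle

end Model

/-! ### Order statistics of separated values and the rule that stops. -/

section OrderStatistics

variable {K u : ℕ} {x : Fin K → ℝ≥0∞} {c : ℝ≥0∞} {S : Finset (Fin K)}

theorem le_ordStat (h : ∀ k ∈ S, c ≤ x k) : c ≤ ordStat S.card x :=
  le_iSup₂_of_le S rfl (le_iInf₂ h)

theorem le_ordStat_one {k : Fin K} (h : c ≤ x k) : c ≤ ordStat 1 x :=
  le_ordStat (S := {k}) (by simpa using h)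

/-- By pigeonhole, any `j` indices include one outside `S`. -/
theorem ordStat_le {j : ℕ} (hj : S.card < j) (h : ∀ k ∉ S, x k ≤ c) : ordStat j x ≤ c := by
  refine iSup₂_le fun A hA => ?_
  obtain ⟨k, hk, hkS⟩ := Finset.exists_mem_notMem_of_card_lt_card (hA ▸ hj)
  exact (iInf₂_le k hk).trans (h k hkS)

open Classical in
theorem filter_one_lt_eq (hin : ∀ k ∈ S, 1 < x k) (hout : ∀ k ∉ S, x k ≤ 1) :
    Finset.univ.filter (fun k => 1 < x k) = S := by
  ext k
  rw [Finset.mem_filter]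
  refine ⟨fun h => ?_, fun h => ⟨Finset.mem_univ k, hin k h⟩⟩
  by_contra hk
  exact absurd h.2 (not_lt.2 (hout k hk))

end OrderStatistics

namespace Model

variable {K : ℕ} {E : Fin K → Type*} [∀ k, MeasurableSpace (E k)] {M : Model E} {u n : ℕ}
  {P Q R : Measure (Paths E)} {ω : Paths E} {k : Fin K} {P₀ P₀' : Fin K → Measure (Paths E)}
  {A B : ℝ} {S : Finset (Fin K)}

theorem marg_mem_of_H0 (hP₀ : ∀ k, P₀ k ∈ M.H0) (k : Fin K) : marg k (P₀ k) ∈ M.H k :=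
  (notMem_signals_iff (hP₀ k)).1 (by simp [signals_eq_empty (hP₀ k)])

theorem Tfwer_local_le (hreg : ∀ n, 1 ≤ n → M.Regular u n ω) (hu : 1 ≤ u) (huK : u = K)
    (hprod : M.AllProducts (PsiLU K 0 u)) (hP₀ : ∀ k, P₀ k ∈ M.H0) (hP₀' : ∀ k, P₀' k ∈ M.H0)
    (hA : 1 < A) (hB : 1 < B) (hn : 1 ≤ n)
    (hin : ∀ k ∈ S, ENNReal.ofReal B ≤ M.locStat (P₀ k) k n ω)
    (hout : ∀ k ∉ S, M.locStat (P₀ k) k n ω ≤ ENNReal.ofReal (1 / A)) :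
    M.Tfwer (PsiLU K 0 u) (fun k => {k}) (fun k => {k}) P₀ P₀' A B ω ≤ n := by
  rw [(intersection_rule hreg hu huK hprod hP₀ hP₀' (marg_mem_of_H0 hP₀) hA hB).1]
  refine firstTime_le hn fun k hk => ?_
  by_cases hkS : k ∈ S
  · exact absurd hk.2 (not_lt.2 (hin k hkS))
  · exact absurd hk.1 (not_lt.2 (hout k hkS))

/-- The number of signals selects the rule that stops: `T_0` for none, `T_1` for one, `T_2` for
more. -/
theorem Tfwer_global_le (hreg : ∀ n, 1 ≤ n → M.Regular u n ω) (hu : 1 ≤ u) (huK : u < K)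
    (hprod : M.AllProducts (PsiLU K 0 u)) (hP₀ : ∀ k, P₀ k ∈ M.H0) (hP₀' : ∀ k, P₀' k ∈ M.H0)
    (hA : 1 < A) (hB : 1 < B) (hn : 1 ≤ n) (hS : S.card < u)
    (hin : ∀ k ∈ S, ENNReal.ofReal B ≤ M.locStat (P₀ k) k n ω)
    (hout : ∀ k ∉ S, M.locStat (P₀ k) k n ω ≤ ENNReal.ofReal (1 / A)) :
    M.Tfwer (PsiLU K 0 u) (fun k => {k}) (fun _ => Finset.univ) P₀ P₀' A B ω ≤ n := by
  rw [gap_intersection_rule hreg hu huK hprod hP₀ hP₀' (marg_mem_of_H0 hP₀) hA hB]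
  have ha := ofReal_one_div_lt_one hA
  have hb := one_lt_ofReal hB
  rcases S.eq_empty_or_nonempty with hS0 | ⟨k₀, hk₀⟩
  · refine inf_le_left.trans (inf_le_left.trans (inf_le_left.trans (inf_le_left.trans
      (firstTime_le hn ?_))))
    exact ordStat_le (S := S) (by simp [hS0]) hout
  have h1 : ENNReal.ofReal B ≤ M.ordLoc P₀ 1 n ω := le_ordStat_one (hin k₀ hk₀)
  rcases Nat.lt_or_ge 1 S.card with h2 | h2
  · refine inf_le_left.trans (inf_le_left.trans (inf_le_right.trans (firstTime_le hn ?_)))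
    have hcard : M.numPos P₀ n ω = S.card := by
      rw [numPos, filter_one_lt_eq (S := S) (fun k hk => hb.trans_le (hin k hk))
        fun k hk => (hout k hk).trans ha.le]
    refine ⟨by rw [hcard]; exact ⟨h2, hS⟩, h1, fun k hk => ?_⟩
    by_cases hkS : k ∈ S
    · exact absurd hk.2 (not_lt.2 (hin k hkS))
    · exact absurd hk.1 (not_lt.2 (hout k hkS))
  · refine inf_le_left.trans (inf_le_left.trans (inf_le_left.trans (inf_le_right.trans
      (firstTime_le hn ?_))))
    have h3 : M.ordLoc P₀ 2 n ω ≤ ENNReal.ofReal (1 / A) :=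
      ordStat_le (S := S) (by omega) hout
    refine ⟨h1, le_min h3 (h3.trans (ha.le.trans ?_))⟩
    rw [ENNReal.le_div_iff_mul_le (Or.inl (zero_lt_one.trans hb).ne')
      (Or.inl ENNReal.ofReal_ne_top), one_mul]
    exact h1

/-- The rule `T_3` stops here. It does not ask the statistics outside `S` to fall below `1 / A`,
only to stay a factor `A` below those in `S`. -/
theorem Tfwer_global_le_of_card_eq (hreg : ∀ n, 1 ≤ n → M.Regular u n ω) (hu : 1 ≤ u)
    (huK : u < K) (hprod : M.AllProducts (PsiLU K 0 u)) (hP₀ : ∀ k, P₀ k ∈ M.H0)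
    (hP₀' : ∀ k, P₀' k ∈ M.H0) (hA : 1 < A) (hB : 1 < B) (hn : 1 ≤ n) (hS : S.card = u)
    {c d : ℝ≥0∞} (hc : ENNReal.ofReal B ≤ c) (hd : d ≤ 1) (hcd : ENNReal.ofReal A * d ≤ c)
    (hin : ∀ k ∈ S, c ≤ M.locStat (P₀ k) k n ω) (hout : ∀ k ∉ S, M.locStat (P₀ k) k n ω ≤ d) :
    M.Tfwer (PsiLU K 0 u) (fun k => {k}) (fun _ => Finset.univ) P₀ P₀' A B ω ≤ n := by
  rw [gap_intersection_rule hreg hu huK hprod hP₀ hP₀' (marg_mem_of_H0 hP₀) hA hB]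
  have hb := one_lt_ofReal hB
  refine inf_le_left.trans (inf_le_right.trans (firstTime_le hn ⟨?_, ?_⟩))
  · rw [numPos, filter_one_lt_eq (S := S) (fun k hk => hb.trans_le (hc.trans (hin k hk)))
      fun k hk => (hout k hk).trans hd, hS]
  · have h1 : c ≤ M.ordLoc P₀ u n ω := hS ▸ le_ordStat hin
    have h2 : M.ordLoc P₀ (u + 1) n ω ≤ d := ordStat_le (S := S) (by omega) hout
    exact (max_le hc ((mul_le_mul_right h2 _).trans hcd)).trans h1

/-! ### Lower bounds -/

theorem measure_mem_le {A : Finset (Fin K)} (hk : k ∉ A) (D : Paths E → Finset (Fin K)) :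
    P {ω | k ∈ D ω} ≤ P {ω | (D ω \ A).Nonempty} :=
  measure_mono fun _ hω => Exists.intro k (Finset.mem_sdiff.2 ⟨hω, hk⟩)

theorem measure_notMem_le {A : Finset (Fin K)} (hk : k ∈ A) (D : Paths E → Finset (Fin K)) :
    P {ω | k ∉ D ω} ≤ P {ω | (A \ D ω).Nonempty} :=
  measure_mono fun _ hω => Exists.intro k (Finset.mem_sdiff.2 ⟨hk, hω⟩)

/-- The set `𝒟` collects decisions likely under `P` and unlikely under `Q`. The bound for a pair is
uniform over tests, so it passes to the infimum. -/
theorem eventually_le_optimalESS (hu : 1 ≤ u) (huK : u ≤ K) (hac : M.MutuallyAC (PsiLU K 0 u))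
    (hprod : M.AllProducts (PsiLU K 0 u))
    (hP : P ∈ M.famPsi (PsiLU K 0 u)) (hQ : Q ∈ M.famPsi (PsiLU K 0 u)) {I : ℝ} (hI : 0 < I)
    (hrate : UpperRate P Q I) {x y : ℝ × ℝ → ℝ}
    (hx : Tendsto x (𝓝[>] 0 ×ˢ 𝓝[>] 0) (𝓝[>] 0)) (hy : Tendsto y (𝓝[>] 0 ×ˢ 𝓝[>] 0) (𝓝[>] 0))
    (𝒟 : Set (Finset (Fin K)))
    (herr : ∀ p : ℝ × ℝ, ∀ X ∈ M.fwerClass (PsiLU K 0 u) p.1 p.2,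
      P {ω | X.2 ω ∉ 𝒟} ≤ ENNReal.ofReal (y p) ∧ Q {ω | X.2 ω ∈ 𝒟} ≤ ENNReal.ofReal (x p))
    {ε : ℝ} (hε : 0 < ε) (hε1 : ε < 1) :
    ∀ᶠ p in 𝓝[>] (0 : ℝ) ×ˢ 𝓝[>] (0 : ℝ),
      ENNReal.ofReal ((1 - ε) * (I⁻¹ * |Real.log (x p)|)) ≤
        M.optimalESS (PsiLU K 0 u) p.1 p.2 P := by
  have := isProbabilityMeasure_of_mem_famPsi hP
  have := isProbabilityMeasure_of_mem_famPsi hQ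
  have hK : 0 < K := by omega
  filter_upwards [hrate.eventually_le (Ψ := PsiLU K 0 u) hI (fun n hn => restr_ac hac hprod hP hQ
    (Finset.mem_univ (⟨0, hK⟩ : Fin K)) hn) hx hy hε hε1] with p hp
  exact le_iInf₂ fun X hX => hp X.1 X.2 𝒟 hX.1 (herr p X hX).1 (herr p X hX).2

variable {I : Fin K → ℝ} {q : Fin K → Measure (Paths E)}

/-- Turning the signal `k` into a null makes its selection a false positive under `Q`, so `γ`
governs the bound. -/
theorem Rates.lower_null (hr : M.Rates u P I q) (hu : 1 ≤ u) (huK : u ≤ K)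
    (hac : M.MutuallyAC (PsiLU K 0 u)) (hind : M.IndependentSources (PsiLU K 0 u))
    (hprod : M.AllProducts (PsiLU K 0 u)) (hP : P ∈ M.famPsi (PsiLU K 0 u))
    (hk : k ∈ M.signals P) {ε : ℝ} (hε : 0 < ε) (hε1 : ε < 1) :
    ∀ᶠ p in 𝓝[>] (0 : ℝ) ×ˢ 𝓝[>] (0 : ℝ),
      ENNReal.ofReal ((1 - ε) * ((I k)⁻¹ * |Real.log p.1|)) ≤
        M.optimalESS (PsiLU K 0 u) p.1 p.2 P := by
  obtain ⟨Q, hQ, hs, hm, hne⟩ := exists_update_null hprod hP ((hr.opposite k).1 hk)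
  refine eventually_le_optimalESS hu huK hac hprod hP hQ (hr.pos k)
    (upperRate_of_single (ae_regular hu huK hac hind hprod hP) hP hQ hne
      ((hr.info k).congr rfl hm.symm)) tendsto_fst tendsto_snd {D | k ∈ D} ?_ hε hε1
  intro p X hX
  constructor
  · exact (measure_notMem_le hk X.2).trans (hX.2 P hP).2
  · refine (measure_mem_le ?_ X.2).trans (hX.2 Q hQ).1
    rw [hs]; exact Finset.notMem_erase _ _

/-- Turning `k` into a signal, for which there is room, makes its omission a false negative under
`Q`, so `δ` governs the bound. -/
theorem Rates.lower_alt (hr : M.Rates u P I q) (hu : 1 ≤ u) (huK : u ≤ K)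
    (hac : M.MutuallyAC (PsiLU K 0 u)) (hind : M.IndependentSources (PsiLU K 0 u))
    (hprod : M.AllProducts (PsiLU K 0 u)) (hP : P ∈ M.famPsi (PsiLU K 0 u))
    (hk : k ∉ M.signals P) (hcard : (M.signals P).card < u) {ε : ℝ} (hε : 0 < ε) (hε1 : ε < 1) :
    ∀ᶠ p in 𝓝[>] (0 : ℝ) ×ˢ 𝓝[>] (0 : ℝ),
      ENNReal.ofReal ((1 - ε) * ((I k)⁻¹ * |Real.log p.2|)) ≤
        M.optimalESS (PsiLU K 0 u) p.1 p.2 P := by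
  obtain ⟨Q, hQ, hs, hm, hne⟩ := exists_update_alt hprod hP
    (by rw [Finset.card_insert_of_notMem hk]; exact hcard) ((hr.opposite k).2 hk)
  refine eventually_le_optimalESS hu huK hac hprod hP hQ (hr.pos k)
    (upperRate_of_single (ae_regular hu huK hac hind hprod hP) hP hQ hne
      ((hr.info k).congr rfl hm.symm)) tendsto_snd tendsto_fst {D | k ∉ D} ?_ hε hε1
  intro p X hX
  constructor
  · simpa only [Set.mem_ofPred_eq, not_not] using (measure_mem_le hk X.2).trans (hX.2 P hP).1
  · refine (measure_notMem_le ?_ X.2).trans (hX.2 Q hQ).2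
    rw [hs]; exact Finset.mem_insert_self _ _

/-- When no signal can be added, `k` may still replace `j`, and the two informations add up. Only
the omission of `k` is exploited; the bound in `γ` from the same pair would be weaker than
`Rates.lower_null`. -/
theorem Rates.lower_swap (hr : M.Rates u P I q) (hu : 1 ≤ u) (huK : u ≤ K)
    (hac : M.MutuallyAC (PsiLU K 0 u)) (hind : M.IndependentSources (PsiLU K 0 u))
    (hprod : M.AllProducts (PsiLU K 0 u)) (hP : P ∈ M.famPsi (PsiLU K 0 u))
    {j : Fin K} (hj : j ∈ M.signals P) (hk : k ∉ M.signals P) {ε : ℝ} (hε : 0 < ε)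
    (hε1 : ε < 1) :
    ∀ᶠ p in 𝓝[>] (0 : ℝ) ×ˢ 𝓝[>] (0 : ℝ),
      ENNReal.ofReal ((1 - ε) * ((I j + I k)⁻¹ * |Real.log p.2|)) ≤
        M.optimalESS (PsiLU K 0 u) p.1 p.2 P := by
  have hjk : j ≠ k := fun h => hk (h ▸ hj)
  obtain ⟨R, hR, hsR, hmR, hneR⟩ := exists_update_null hprod hP ((hr.opposite j).1 hj)
  have hcard : (insert k (M.signals R)).card ≤ u := by
    refine (Finset.card_insert_le _ _).trans ?_
    rw [hsR, Finset.card_erase_add_one hj]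
    exact card_signals_le hP
  obtain ⟨Q, hQ, hs, hm, hne⟩ := exists_update_alt hprod hR hcard ((hr.opposite k).2 hk)
  have hmj : marg j (q j) = marg j Q := by rw [hne j hjk, hmR]
  refine eventually_le_optimalESS hu huK hac hprod hP hQ (add_pos (hr.pos j) (hr.pos k))
    (upperRate_of_pair (ae_regular hu huK hac hind hprod hP) hP hQ hjk
      (fun i hij hik => (hne i hik).trans (hneR i hij))
      ((hr.info j).congr rfl hmj) ((hr.info k).congr rfl hm.symm))
    tendsto_snd tendsto_fst {D | k ∉ D} ?_ hε hε1
  intro p X hX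
  constructor
  · simpa only [Set.mem_ofPred_eq, not_not] using (measure_mem_le hk X.2).trans (hX.2 P hP).1
  · refine (measure_notMem_le ?_ X.2).trans (hX.2 Q hQ).2
    rw [hs]; exact Finset.mem_insert_self _ _

/-! ### From the bounds to asymptotic optimality -/

theorem tendsto_abs_log_nhdsGT_zero : Tendsto (fun x : ℝ => |Real.log x|) (𝓝[>] 0) atTop :=
  tendsto_abs_atBot_atTop.comp Real.tendsto_log_nhdsGT_zero

/-- The ratio is at least `1` because the test belongs to the class. It is at most a factor tending
to `1` with `ε`, since `L` tends to infinity and absorbs `C`. No relation between the speeds of `γ`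
and `δ` is needed, and one of `a`, `b` may vanish. -/
theorem tendsto_ratio_of_bounds {Ψ : Set (Finset (Fin K))} {s s' : Fin K → Finset (Fin K)}
    {A B : ℝ → ℝ → ℝ} (hsel : M.ThresholdSelection Ψ s s' P₀ P₀' A B) {a b : ℝ} (ha : 0 ≤ a)
    (hb : 0 ≤ b) (hab : 0 < a ∨ 0 < b)
    (hupper : ∀ ε : ℝ, 0 < ε → ε < 1 → ∃ C : ℝ, 0 ≤ C ∧ ∀ A B : ℝ, 1 < A → 1 < B →
      ∫⁻ ω, (M.Tfwer Ψ s s' P₀ P₀' A B ω : ℝ≥0∞) ∂P ≤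
        ENNReal.ofReal ((1 - ε)⁻¹ * max (a * Real.log B) (b * Real.log A) + C))
    (hlower : ∀ ε : ℝ, 0 < ε → ε < 1 → ∀ᶠ p in 𝓝[>] (0 : ℝ) ×ˢ 𝓝[>] (0 : ℝ),
      ENNReal.ofReal ((1 - ε) * max (a * |Real.log p.1|) (b * |Real.log p.2|)) ≤
        M.optimalESS Ψ p.1 p.2 P) :
    Tendsto (fun p : ℝ × ℝ =>
        (∫⁻ ω, (M.Tfwer Ψ s s' P₀ P₀' (A p.1 p.2) (B p.1 p.2) ω : ℝ≥0∞) ∂P) /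
          M.optimalESS Ψ p.1 p.2 P)
      (𝓝[>] 0 ×ˢ 𝓝[>] 0) (𝓝 1) := by
  set L : ℝ × ℝ → ℝ := fun p => max (a * |Real.log p.1|) (b * |Real.log p.2|) with hL
  have hLtop : Tendsto L (𝓝[>] 0 ×ˢ 𝓝[>] 0) atTop := by
    rcases hab with h | h
    · exact tendsto_atTop_mono (fun p => le_max_left _ _)
        ((tendsto_abs_log_nhdsGT_zero.comp tendsto_fst).const_mul_atTop h)
    · exact tendsto_atTop_mono (fun p => le_max_right _ _)
        ((tendsto_abs_log_nhdsGT_zero.comp tendsto_snd).const_mul_atTop h)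
  have hIoo : ∀ᶠ p in 𝓝[>] (0 : ℝ) ×ˢ 𝓝[>] (0 : ℝ),
      p.1 ∈ Set.Ioo (0 : ℝ) 1 ∧ p.2 ∈ Set.Ioo (0 : ℝ) 1 :=
    (tendsto_fst.eventually (Ioo_mem_nhdsGT one_pos)).and
      (tendsto_snd.eventually (Ioo_mem_nhdsGT one_pos))
  set U : ℝ × ℝ → ℝ≥0∞ := fun p =>
    ∫⁻ ω, (M.Tfwer Ψ s s' P₀ P₀' (A p.1 p.2) (B p.1 p.2) ω : ℝ≥0∞) ∂P with hU
  have hbound : ∀ ε : ℝ, 0 < ε → ε < 1 → ∀ᶠ p in 𝓝[>] (0 : ℝ) ×ˢ 𝓝[>] (0 : ℝ),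
      1 ≤ U p / M.optimalESS Ψ p.1 p.2 P ∧
      U p / M.optimalESS Ψ p.1 p.2 P ≤
        ENNReal.ofReal (((1 - ε)⁻¹ * (1 + ε) + ε) / (1 - ε)) := by
    intro ε hε hε1
    have h1ε : 0 < 1 - ε := by linarith
    obtain ⟨C, hC, hup⟩ := hupper ε hε hε1
    have hLC := hLtop.eventually (eventually_ge_atTop (C / ε))
    have hL0 := hLtop.eventually (eventually_gt_atTop 0)
    have hAe := hsel.log_A.def hε
    have hBe := hsel.log_B.def hε
    filter_upwards [hlower ε hε hε1, hLC, hL0, hAe, hBe, hIoo] with p hlo hLC hL0 hAe hBe hp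
    have hA := hsel.one_lt_A p.1 hp.1 p.2 hp.2
    have hB := hsel.one_lt_B p.1 hp.1 p.2 hp.2
    have hA' : Real.log (A p.1 p.2) ≤ (1 + ε) * |Real.log p.2| := by
      simp only [Pi.sub_apply, Real.norm_eq_abs, abs_abs] at hAe
      linarith [(abs_le.1 hAe).2]
    have hB' : Real.log (B p.1 p.2) ≤ (1 + ε) * |Real.log p.1| := by
      simp only [Pi.sub_apply, Real.norm_eq_abs, abs_abs] at hBe
      linarith [(abs_le.1 hBe).2]
    have hmax : max (a * Real.log (B p.1 p.2)) (b * Real.log (A p.1 p.2)) ≤ (1 + ε) * L p := by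
      refine max_le ?_ ?_
      · calc a * Real.log (B p.1 p.2) ≤ a * ((1 + ε) * |Real.log p.1|) :=
              mul_le_mul_of_nonneg_left hB' ha
          _ = (1 + ε) * (a * |Real.log p.1|) := by ring
          _ ≤ _ := mul_le_mul_of_nonneg_left (le_max_left _ _) (by linarith)
      · calc b * Real.log (A p.1 p.2) ≤ b * ((1 + ε) * |Real.log p.2|) :=
              mul_le_mul_of_nonneg_left hA' hb
          _ = (1 + ε) * (b * |Real.log p.2|) := by ring
          _ ≤ _ := mul_le_mul_of_nonneg_left (le_max_right _ _) (by linarith)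
    have hUle : U p ≤ ENNReal.ofReal (((1 - ε)⁻¹ * (1 + ε) + ε) * L p) := by
      refine (hup _ _ hA hB).trans (ENNReal.ofReal_le_ofReal ?_)
      have h1 := mul_le_mul_of_nonneg_left hmax (inv_pos.2 h1ε).le
      have h2 : C ≤ L p * ε := (div_le_iff₀ hε).1 hLC
      linarith
    have hden0 : 0 < (1 - ε) * L p := mul_pos h1ε hL0
    have hopt0 : M.optimalESS Ψ p.1 p.2 P ≠ 0 :=
      ((ENNReal.ofReal_pos.2 hden0).trans_le hlo).ne'
    have hoptU : M.optimalESS Ψ p.1 p.2 P ≤ U p :=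
      iInf₂_le _ (hsel.control p.1 hp.1 p.2 hp.2)
    have hopttop : M.optimalESS Ψ p.1 p.2 P ≠ ∞ :=
      ne_top_of_le_ne_top ENNReal.ofReal_ne_top (hoptU.trans hUle)
    constructor
    · rw [ENNReal.le_div_iff_mul_le (Or.inl hopt0) (Or.inl hopttop), one_mul]
      exact hoptU
    · calc U p / M.optimalESS Ψ p.1 p.2 P
          ≤ ENNReal.ofReal (((1 - ε)⁻¹ * (1 + ε) + ε) * L p) /
              ENNReal.ofReal ((1 - ε) * L p) := ENNReal.div_le_div hUle hlo
        _ = _ := by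
            rw [← ENNReal.ofReal_div_of_pos hden0, mul_div_mul_right _ _ hL0.ne']
  have hlim : Tendsto (fun ε : ℝ => ENNReal.ofReal (((1 - ε)⁻¹ * (1 + ε) + ε) / (1 - ε)))
      (𝓝[>] 0) (𝓝 1) := by
    have hc : ContinuousAt (fun ε : ℝ => ((1 - ε)⁻¹ * (1 + ε) + ε) / (1 - ε)) 0 := by
      have h1 : ContinuousAt (fun ε : ℝ => 1 - ε) 0 := by fun_prop
      have h2 : (fun ε : ℝ => 1 - ε) 0 ≠ 0 := by norm_num
      exact (((h1.inv₀ h2).mul (by fun_prop)).add (by fun_prop)).div h1 h2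
    have := (ENNReal.continuous_ofReal.tendsto _).comp (hc.tendsto.mono_left (nhdsWithin_le_nhds (s := Set.Ioi 0)))
    have hval : ((1 - 0 : ℝ)⁻¹ * (1 + 0) + 0) / (1 - 0) = 1 := by norm_num
    rw [hval, ENNReal.ofReal_one] at this
    exact this
  rw [tendsto_order]
  constructor
  · intro c hc
    filter_upwards [hbound (1 / 2) (by norm_num) (by norm_num)] with p hp
    exact hc.trans_le hp.1
  · intro c hc
    obtain ⟨ε, hε, hεc⟩ :=
      (Eventually.and (Ioo_mem_nhdsGT (one_pos (α := ℝ)))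
        (hlim.eventually (gt_mem_nhds hc))).exists
    filter_upwards [hbound ε hε.1 hε.2] with p hp
    exact hp.2.trans_lt hεc

end Model

/-! ### Asymptotic optimality, by the number of signals. -/

namespace Model

variable {K : ℕ} {E : Fin K → Type*} [∀ k, MeasurableSpace (E k)] {M : Model E} {u n : ℕ}
  {P Q R : Measure (Paths E)} {ω : Paths E} {k : Fin K} {P₀ P₀' : Fin K → Measure (Paths E)}

theorem ofReal_le_ofReal_exp {B c : ℝ} (hB : 1 < B) (h : Real.log B ≤ c) :
    ENNReal.ofReal B ≤ ENNReal.ofReal (Real.exp c) := by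
  refine ENNReal.ofReal_le_ofReal ?_
  rw [← Real.exp_log (zero_lt_one.trans hB)]
  exact Real.exp_le_exp.2 h

theorem ofReal_exp_neg_le {A c : ℝ} (hA : 1 < A) (h : Real.log A ≤ c) :
    ENNReal.ofReal (Real.exp (-c)) ≤ ENNReal.ofReal (1 / A) := by
  refine ENNReal.ofReal_le_ofReal ?_
  rw [one_div, ← Real.exp_log (zero_lt_one.trans hA), ← Real.exp_neg]
  exact Real.exp_le_exp.2 (by linarith)

theorem le_mul_of_inv_mul_le {I J x t : ℝ} (hI : 0 < I) (hIJ : I ≤ J) (ht : 0 ≤ t)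
    (h : I⁻¹ * x ≤ t) : x ≤ t * J := by
  have h1 : x ≤ t * I := by
    have := mul_le_mul_of_nonneg_right h hI.le
    rwa [mul_comm I⁻¹ x, mul_assoc, inv_mul_cancel₀ hI.ne', mul_one] at this
  exact h1.trans (mul_le_mul_of_nonneg_left hIJ ht)

/-- Asymptotic optimality of a rule which stops as soon as all local statistics have passed the
thresholds in the right direction, or, with the maximal number `u < K` of signals, as soon as
they are separated. -/
theorem optimal_of_stops (hu : 1 ≤ u) (huK : u ≤ K) (hac : M.MutuallyAC (PsiLU K 0 u))
    (hinfo : M.InfoNumbersExist (PsiLU K 0 u)) (hind : M.IndependentSources (PsiLU K 0 u))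
    (hprod : M.AllProducts (PsiLU K 0 u)) (hP₀ : ∀ k, P₀ k ∈ M.H0)
    {s s' : Fin K → Finset (Fin K)}
    (hfire : ∀ (ω : Paths E) (A B : ℝ) (n : ℕ) (S : Finset (Fin K)), 1 < A → 1 < B →
      (∀ n, 1 ≤ n → M.Regular u n ω) → 1 ≤ n → S.card < u ∨ u = K →
      (∀ k ∈ S, ENNReal.ofReal B ≤ M.locStat (P₀ k) k n ω) →
      (∀ k ∉ S, M.locStat (P₀ k) k n ω ≤ ENNReal.ofReal (1 / A)) →
      M.Tfwer (PsiLU K 0 u) s s' P₀ P₀' A B ω ≤ n)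
    (hfire' : ∀ (ω : Paths E) (A B : ℝ) (n : ℕ) (S : Finset (Fin K)) (c d : ℝ≥0∞), 1 < A →
      1 < B → (∀ n, 1 ≤ n → M.Regular u n ω) → 1 ≤ n → S.card = u → u < K →
      ENNReal.ofReal B ≤ c → d ≤ 1 → ENNReal.ofReal A * d ≤ c →
      (∀ k ∈ S, c ≤ M.locStat (P₀ k) k n ω) → (∀ k ∉ S, M.locStat (P₀ k) k n ω ≤ d) →
      M.Tfwer (PsiLU K 0 u) s s' P₀ P₀' A B ω ≤ n) :
    M.FwerAsymptoticallyOptimal (PsiLU K 0 u) s s' P₀ P₀' := by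
  intro A B hsel P hP
  obtain ⟨I, q, hr⟩ := exists_rates hu hinfo hprod hP
  have hreg := ae_regular hu huK hac hind hprod hP
  have hmarg : ∀ k, marg k (P₀ k) ∈ M.H k ∪ M.G k := fun k => (hP₀ k).2.1 k
  set S := M.signals P with hSdef
  -- behaviour on the good set
  have hin : ∀ {ω ε n}, M.Regular u n ω → ω ∈ M.goodSet u P I ε n → ∀ k ∈ S,
      ENNReal.ofReal (Real.exp (n * ((1 - ε) * I k))) ≤ M.locStat (P₀ k) k n ω :=
    fun h hg k hk => h.le_locStat hu hprod hP (hmarg k) hk (hg k)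
  have hout : ∀ {ω ε n}, M.Regular u n ω → ω ∈ M.goodSet u P I ε n → ∀ k ∉ S,
      M.locStat (P₀ k) k n ω ≤ ENNReal.ofReal (Real.exp (-(n * ((1 - ε) * I k)))) :=
    fun h hg k hk => h.locStat_le hu hprod hP (hmarg k) hk (hg k)
  -- the upper bound follows from a statement about the good set
  have upper : ∀ a b : ℝ, 0 ≤ a → 0 ≤ b →
      (∀ (ω : Paths E) (ε A B : ℝ) (n : ℕ), ε < 1 → 1 < A → 1 < B →
        (∀ n, 1 ≤ n → M.Regular u n ω) → 1 ≤ n → a * Real.log B ≤ (1 - ε) * n →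
        b * Real.log A ≤ (1 - ε) * n → ω ∈ M.goodSet u P I ε n →
        M.Tfwer (PsiLU K 0 u) s s' P₀ P₀' A B ω ≤ n) →
      ∀ ε : ℝ, 0 < ε → ε < 1 → ∃ C : ℝ, 0 ≤ C ∧ ∀ A B : ℝ, 1 < A → 1 < B →
        ∫⁻ ω, (M.Tfwer (PsiLU K 0 u) s s' P₀ P₀' A B ω : ℝ≥0∞) ∂P ≤
          ENNReal.ofReal ((1 - ε)⁻¹ * max (a * Real.log B) (b * Real.log A) + C) := by
    intro a b ha hb H ε hε hε1
    obtain ⟨C, hC, hle⟩ := hr.lintegral_le hP hε hε1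
    refine ⟨C, hC, fun A B hA hB => hle _ _ ?_ ?_⟩
    · exact le_max_of_le_left (mul_nonneg ha (Real.log_pos hB).le)
    · filter_upwards [hreg] with ω hω n hn ht hg
      exact H ω ε A B n hε1 hA hB hω hn ((le_max_left _ _).trans ht)
        ((le_max_right _ _).trans ht) hg
  have lower : ∀ a b : ℝ,
      (∀ ε : ℝ, 0 < ε → ε < 1 → ∀ᶠ p in 𝓝[>] (0 : ℝ) ×ˢ 𝓝[>] (0 : ℝ),
        ENNReal.ofReal ((1 - ε) * (a * |Real.log p.1|)) ≤
          M.optimalESS (PsiLU K 0 u) p.1 p.2 P) →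
      (∀ ε : ℝ, 0 < ε → ε < 1 → ∀ᶠ p in 𝓝[>] (0 : ℝ) ×ˢ 𝓝[>] (0 : ℝ),
        ENNReal.ofReal ((1 - ε) * (b * |Real.log p.2|)) ≤
          M.optimalESS (PsiLU K 0 u) p.1 p.2 P) →
      ∀ ε : ℝ, 0 < ε → ε < 1 → ∀ᶠ p in 𝓝[>] (0 : ℝ) ×ˢ 𝓝[>] (0 : ℝ),
        ENNReal.ofReal ((1 - ε) * max (a * |Real.log p.1|) (b * |Real.log p.2|)) ≤
          M.optimalESS (PsiLU K 0 u) p.1 p.2 P := by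
    intro a b h1 h2 ε hε hε1
    filter_upwards [h1 ε hε hε1, h2 ε hε hε1] with p hp1 hp2
    rcases max_choice (a * |Real.log p.1|) (b * |Real.log p.2|) with h | h <;> rw [h] <;>
      assumption
  have lower_zero : ∀ (f : ℝ × ℝ → ℝ) (ε : ℝ), 0 < ε → ε < 1 →
      ∀ᶠ p in 𝓝[>] (0 : ℝ) ×ˢ 𝓝[>] (0 : ℝ),
        ENNReal.ofReal ((1 - ε) * (0 * f p)) ≤ M.optimalESS (PsiLU K 0 u) p.1 p.2 P :=
    fun f ε _ _ => Eventually.of_forall fun p => by simp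
  have hSu : S.card ≤ u := card_signals_le hP
  -- the smallest information numbers
  have hminS : S.Nonempty → ∃ j ∈ S, ∀ k ∈ S, I j ≤ I k := fun h => S.exists_min_image I h
  have hminC : S.card < K → ∃ j ∉ S, ∀ k ∉ S, I j ≤ I k := fun h => by
    have hne : Sᶜ.Nonempty := by
      rw [← Finset.card_pos, Finset.card_compl, Fintype.card_fin]; omega
    obtain ⟨j, hj, hmin⟩ := Sᶜ.exists_min_image I hne
    exact ⟨j, Finset.mem_compl.1 hj, fun k hk => hmin k (Finset.mem_compl.2 hk)⟩
  have hcommI : ∀ (n ε x : ℝ), n * ((1 - ε) * x) = (1 - ε) * n * x := fun n ε x => by ring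
  rcases S.eq_empty_or_nonempty with hS0 | hSne
  · -- no signal
    have hS0' : S.card = 0 := by rw [hS0]; rfl
    obtain ⟨j, hj, hmin⟩ := hminC (by omega)
    -- Without signals no statistic has to reach `B`, so `γ` does not enter.
    refine tendsto_ratio_of_bounds hsel (a := 0) (b := (I j)⁻¹) le_rfl (inv_pos.2 (hr.pos j)).le
      (Or.inr (inv_pos.2 (hr.pos j))) (upper _ _ le_rfl (inv_pos.2 (hr.pos j)).le ?_)
      (lower _ _ (lower_zero _) fun ε hε hε1 =>
        hr.lower_alt hu huK hac hind hprod hP hj (show S.card < u by omega) hε hε1)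
    intro ω ε A B n hε1 hA hB hω hn _ hAn hg
    refine hfire ω A B n S hA hB hω hn (Or.inl (by omega)) (by simp [hS0]) fun k hk =>
      (hout (hω n hn) hg k hk).trans (ofReal_exp_neg_le hA ?_)
    rw [hcommI]
    exact le_mul_of_inv_mul_le (hr.pos j) (hmin k hk)
      (mul_nonneg (by linarith) (Nat.cast_nonneg n)) hAn
  obtain ⟨i, hi, himin⟩ := hminS hSne
  have hiI := inv_pos.2 (hr.pos i)
  have lower_i := fun ε (hε : (0 : ℝ) < ε) (hε1 : ε < 1) =>
    hr.lower_null hu huK hac hind hprod hP hi hε hε1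
  rcases hSu.lt_or_eq with hlt | heq
  · -- some signals, fewer than the maximal number
    obtain ⟨j, hj, hmin⟩ := hminC (by omega)
    refine tendsto_ratio_of_bounds hsel hiI.le (inv_pos.2 (hr.pos j)).le (Or.inl hiI)
      (upper _ _ hiI.le (inv_pos.2 (hr.pos j)).le ?_)
      (lower _ _ lower_i fun ε hε hε1 =>
        hr.lower_alt hu huK hac hind hprod hP hj hlt hε hε1)
    intro ω ε A B n hε1 hA hB hω hn hBn hAn hg
    have h0 : 0 ≤ (1 - ε) * (n : ℝ) := mul_nonneg (by linarith) (Nat.cast_nonneg n)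
    refine hfire ω A B n S hA hB hω hn (Or.inl hlt) (fun k hk => ?_) fun k hk => ?_
    · refine (ofReal_le_ofReal_exp hB ?_).trans (hin (hω n hn) hg k hk)
      rw [hcommI]
      exact le_mul_of_inv_mul_le (hr.pos i) (himin k hk) h0 hBn
    · refine (hout (hω n hn) hg k hk).trans (ofReal_exp_neg_le hA ?_)
      rw [hcommI]
      exact le_mul_of_inv_mul_le (hr.pos j) (hmin k hk) h0 hAn
  rcases huK.lt_or_eq with hltK | heqK
  · -- the maximal number of signals, not all sources
    obtain ⟨j, hj, hmin⟩ := hminC (by omega)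
    have hij := add_pos (hr.pos i) (hr.pos j)
    refine tendsto_ratio_of_bounds hsel hiI.le (inv_pos.2 hij).le (Or.inl hiI)
      (upper _ _ hiI.le (inv_pos.2 hij).le ?_)
      (lower _ _ lower_i fun ε hε hε1 =>
        hr.lower_swap hu huK hac hind hprod hP hi hj hε hε1)
    intro ω ε A B n hε1 hA hB hω hn hBn hAn hg
    have h0 : 0 ≤ (1 - ε) * (n : ℝ) := mul_nonneg (by linarith) (Nat.cast_nonneg n)
    -- The quotient of the two levels is `exp ((1 - ε) n (I i + I j))`, so the gap `A` is reached at
    -- the rate of the swap bound. The second level need not fall below `1 / A`.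
    refine hfire' ω A B n S (ENNReal.ofReal (Real.exp ((1 - ε) * n * I i)))
      (ENNReal.ofReal (Real.exp (-((1 - ε) * n * I j)))) hA hB hω hn heq hltK
      (ofReal_le_ofReal_exp hB (le_mul_of_inv_mul_le (hr.pos i) le_rfl h0 hBn)) ?_ ?_
      (fun k hk => le_trans (ENNReal.ofReal_le_ofReal (Real.exp_le_exp.2 ?_))
        (hin (hω n hn) hg k hk))
      (fun k hk => (hout (hω n hn) hg k hk).trans
        (ENNReal.ofReal_le_ofReal (Real.exp_le_exp.2 ?_)))
    · exact ENNReal.ofReal_le_one.2 (Real.exp_le_one_iff.2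
        (neg_nonpos.2 (mul_nonneg h0 (hr.pos j).le)))
    · have h1 := le_mul_of_inv_mul_le hij le_rfl h0 hAn
      rw [← ENNReal.ofReal_mul (by linarith)]
      refine ENNReal.ofReal_le_ofReal ?_
      conv_lhs => rw [← Real.exp_log (zero_lt_one.trans hA)]
      rw [← Real.exp_add]
      exact Real.exp_le_exp.2 (by rw [mul_add] at h1; linarith)
    · rw [hcommI]
      exact mul_le_mul_of_nonneg_left (himin k hk) h0
    · rw [hcommI]
      exact neg_le_neg (mul_le_mul_of_nonneg_left (hmin k hk) h0)
  · -- all sources are signals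
    -- There is no source outside `S`, so `δ` does not enter.
    refine tendsto_ratio_of_bounds hsel hiI.le le_rfl (Or.inl hiI) (upper _ _ hiI.le le_rfl ?_)
      (lower _ _ lower_i (lower_zero _))
    intro ω ε A B n hε1 hA hB hω hn hBn _ hg
    have h0 : 0 ≤ (1 - ε) * (n : ℝ) := mul_nonneg (by linarith) (Nat.cast_nonneg n)
    have hSuniv : S = Finset.univ := by
      rw [← Finset.card_eq_iff_eq_univ, Fintype.card_fin]; omega
    refine hfire ω A B n S hA hB hω hn (Or.inr heqK) (fun k hk => ?_)
      fun k hk => absurd (Finset.mem_univ k) (hSuniv ▸ hk)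
    refine (ofReal_le_ofReal_exp hB ?_).trans (hin (hω n hn) hg k hk)
    rw [hcommI]
    exact le_mul_of_inv_mul_le (hr.pos i) (himin k hk) h0 hBn

end Model

end SeqTest

open SeqTest in
theorem mainTheorem9 {K : ℕ} {E : Fin K → Type*} [∀ k, MeasurableSpace (E k)] (M : Model E)
    (u : ℕ) (hu : 1 ≤ u) (huK : u ≤ K)
    (hac : M.MutuallyAC (PsiLU K 0 u))
    (hinfo : M.InfoNumbersExist (PsiLU K 0 u))
    (hind : M.IndependentSources (PsiLU K 0 u))
    (hprod : M.AllProducts (PsiLU K 0 u))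
    -- the arbitrary reference distributions of the detection, isolation and local statistics
    (P₀ P₀' Q₀ : Fin K → Measure (Paths E))
    (hP₀ : ∀ k, P₀ k ∈ M.H0) (hP₀' : ∀ k, P₀' k ∈ M.H0)
    (hQ₀ : ∀ k, Q₀ k ∈ M.fam ∧ marg k (Q₀ k) ∈ M.H k) :
    (u = K →
      M.FwerAsymptoticallyOptimal (PsiLU K 0 u) (fun k => {k}) (fun k => {k}) P₀ P₀' ∧
      ∀ A B : ℝ, 1 < A → 1 < B → ∀ P ∈ M.famPsi (PsiLU K 0 u), ∀ᵐ ω ∂P,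
        M.Tfwer (PsiLU K 0 u) (fun k => {k}) (fun k => {k}) P₀ P₀' A B ω =
          firstTime (fun n => {ω | ∀ k, M.locStat (Q₀ k) k n ω ∉
            Set.Ioo (ENNReal.ofReal (1 / A)) (ENNReal.ofReal B)}) ω ∧
        ∀ n : ℕ, M.Tfwer (PsiLU K 0 u) (fun k => {k}) (fun k => {k}) P₀ P₀' A B ω = n →
          ∀ k, k ∈ M.Dfwer (PsiLU K 0 u) (fun k => {k}) (fun k => {k}) P₀ P₀' A B ω ↔
            1 < M.locStat (Q₀ k) k n ω) ∧
    (u < K →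
      M.FwerAsymptoticallyOptimal (PsiLU K 0 u) (fun k => {k}) (fun _ => Finset.univ) P₀ P₀' ∧
      ∀ A B : ℝ, 1 < A → 1 < B → ∀ P ∈ M.famPsi (PsiLU K 0 u), ∀ᵐ ω ∂P,
        M.Tfwer (PsiLU K 0 u) (fun k => {k}) (fun _ => Finset.univ) P₀ P₀' A B ω =
          firstTime (fun n => {ω | M.ordLoc Q₀ 1 n ω ≤ ENNReal.ofReal (1 / A)}) ω ⊓
          firstTime (fun n => {ω | ENNReal.ofReal B ≤ M.ordLoc Q₀ 1 n ω ∧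
            M.ordLoc Q₀ 2 n ω ≤
              min (ENNReal.ofReal (1 / A)) (M.ordLoc Q₀ 1 n ω / ENNReal.ofReal B)}) ω ⊓
          firstTime (fun n => {ω | (1 < M.numPos Q₀ n ω ∧ M.numPos Q₀ n ω < u) ∧
            ENNReal.ofReal B ≤ M.ordLoc Q₀ 1 n ω ∧
            ∀ k, M.locStat (Q₀ k) k n ω ∉
              Set.Ioo (ENNReal.ofReal (1 / A)) (ENNReal.ofReal B)}) ω ⊓
          firstTime (fun n => {ω | M.numPos Q₀ n ω = u ∧
            max (ENNReal.ofReal B) (ENNReal.ofReal A * M.ordLoc Q₀ (u + 1) n ω) ≤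
              M.ordLoc Q₀ u n ω}) ω ⊓
          firstTime (fun n => {ω | u < M.numPos Q₀ n ω ∧
            ENNReal.ofReal B ≤ M.ordLoc Q₀ 1 n ω ∧
            M.ordLoc Q₀ (u + 1) n ω * max (ENNReal.ofReal A) (ENNReal.ofReal B) ≤
              M.ordLoc Q₀ u n ω}) ω) := by
  have hQ₀' : ∀ k, marg k (Q₀ k) ∈ M.H k := fun k => (hQ₀ k).2
  have hreg := fun P hP => Model.ae_regular (M := M) (P := P) hu huK hac hind hprod hP
  constructor
  · intro h
    refine ⟨Model.optimal_of_stops hu huK hac hinfo hind hprod hP₀ ?_ ?_,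
      fun A B hA hB P hP => (hreg P hP).mono fun ω hω =>
        Model.intersection_rule hω hu h hprod hP₀ hP₀' hQ₀' hA hB⟩
    · intro ω A B n S hA hB hω hn _ hin hout
      exact Model.Tfwer_local_le hω hu h hprod hP₀ hP₀' hA hB hn hin hout
    · intro ω A B n S c d _ _ _ _ _ hlt
      exact absurd h hlt.ne
  · intro h
    refine ⟨Model.optimal_of_stops hu huK hac hinfo hind hprod hP₀ ?_ ?_,
      fun A B hA hB P hP => (hreg P hP).mono fun ω hω =>
        Model.gap_intersection_rule hω hu h hprod hP₀ hP₀' hQ₀' hA hB⟩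
    · intro ω A B n S hA hB hω hn hS hin hout
      exact Model.Tfwer_global_le hω hu h hprod hP₀ hP₀' hA hB hn (hS.resolve_right h.ne) hin hout
    · intro ω A B n S c d hA hB hω hn hS _ hc hd hcd hin hout
      exact Model.Tfwer_global_le_of_card_eq hω hu h hprod hP₀ hP₀' hA hB hn hS hc hd hcd hin hout
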